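/- A unimodal sequence $\lambda$ of size $n$ consists of positive integers $$\lambda_1^{[L]}\le\dots\le\lambda_r^{[L]}\le\lambda_{\mathrm{PK}}\ge\lambda_s^{[R]}\ge\dots\ge\lambda_1^{[R]},\qquad r,s\ge 0,$$ with a specified peak $\lambda_{\mathrm{PK}}$, whose total sum is $n$. Let $\mathcal U_n$ be the set of unimodal sequences of size $n$, let $\mathbf P_n$ be the uniform probability measure on $\mathcal U_n$ (for $n\ge 1$), let $X_k^{[L]}(\lambda)$ (resp. $X_k^{[R]}(\lambda)$) be the number of parts equal to $k$ to the left (resp. right) of the peak, the peak itself not being counted, and let $B=\frac{\sqrt 3}{\pi}$. (1) Let $k_n\ge 0$ be integers with $k_n=o(n^{1/4})$ as $n\to\infty$, and for each $n$ let $\left(v_{n,k}^{[j]}\right)_{1\le k\le k_n,\ j\in\{L,R\}}\in[0,\infty)^{2k_n}$. Then $$\lim_{n\to\infty}\left(\mathbf P_n\left(\frac{kX_k^{[j]}}{B\sqrt n}\le v_{n,k}^{[j]}\ \text{ for all } 1\le k\le k_n,\ j\in\{L,R\}\right)-\prod_{\substack{1\le k\le k_n\\ j\in\{L,R\}}}\int_0^{v_{n,k}^{[j]}}e^{-u}\,du\right)=0.$$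 (2) Let $k=k(n)\ge 1$ be integers with $k(n)=o(n^{1/2})$ as $n\to\infty$. Then for all $v^{[L]},v^{[R]}\in\mathbb R$, $$\lim_{n\to\infty}\mathbf P_n\left(\frac{kX_k^{[L]}}{B\sqrt n}\le v^{[L]},\ \frac{kX_k^{[R]}}{B\sqrt n}\le v^{[R]}\right)=\left(1-e^{-\max(v^{[L]},0)}\right)\left(1-e^{-\max(v^{[R]},0)}\right).$$ In particular the limit equals $(1-e^{-v^{[L]}})(1-e^{-v^{[R]}})$ for $v^{[L]},v^{[R]}\ge 0$. -/

import Mathlib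

open Filter Asymptotics

/-- A unimodal sequence of positive integers with a specified peak: the parts to the left of the
peak, the peak, and the parts to the right of the peak, each list in order of appearance. -/
structure UnimodalSequence where
  left : List ℕ
  peak : ℕ
  right : List ℕ
  pos : ∀ a ∈ left ++ peak :: right, 0 < a
  increasing : (left ++ [peak]).Pairwise (· ≤ ·)
  decreasing : (peak :: right).Pairwise (· ≥ ·)

namespace UnimodalSequence

/-- The size: the sum of all parts, including the peak. -/
def size (s : UnimodalSequence) : ℕ := s.left.sum + s.peak + s.right.sum

/-- The number of parts equal to `k` to the left of the peak. -/
def XL (k : ℕ) (s : UnimodalSequence) : ℕ := s.left.count k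

/-- The number of parts equal to `k` to the right of the peak. -/
def XR (k : ℕ) (s : UnimodalSequence) : ℕ := s.right.count k

/-- Every set of unimodal sequences is an event. -/
instance : MeasurableSpace UnimodalSequence := ⊤

/-- The uniform probability measure on the (finite) set of unimodal sequences of size `n`. -/
noncomputable def P (n : ℕ) : MeasureTheory.Measure UnimodalSequence :=
  ProbabilityTheory.uniformOn {s | s.size = n}

end UnimodalSequence

/-- The constant `B = √3 / π`. -/
noncomputable def constB : ℝ := Real.sqrt 3 / Real.pi

/-! Appending the peak to the left list turns a unimodal sequence of size n into a pair of
partitions (colours `false` and `true`) of total weight n whose largest part occurs in colour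
`false`. Without that last condition pairs are tractable. Give the multiplicity of each coloured
part k an independent geometric law of ratio q^k, q = exp(-t). All pairs of weight n are then
equally likely, so conditioning on the weight gives the uniform measure, and t = π/√(3n) puts the
mean weight within O(1/t) of n.

Small parts. By Fourier inversion on [-π, π], the law of the multiplicities in a finite set J,
jointly with the weight being n, differs from the independent prediction by an integral in which
only the factors of J are altered, each by O(|θ|/t). The remaining characteristic function has first
absolute moment O(t^3) (`integral_abs_mul_prod_norm_le`), so the error is O(|J| t^2). The weight is
n with probability at least c t^(3/2), by comparison with a Gaussian (`exists_card_configs_lower`).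
The relative error is therefore O(|J| √t), of order |J| n^(-1/4), which explains the range of k_n in
part (1).

Largest part. Exchanging the colours of all parts above K keeps the weight and every bound on parts
of size at most K, and reverses the colour that holds the largest part (`two_mul_card_leads`). So
half of each box is led by `false`, up to pairs with no part above K and pairs whose largest part
occurs in both colours. The former are rare because the large parts are unlikely to be all absent.
The latter inject into pairs with many ones (`card_tieConfigs_le`). The factor 1/2 cancels in the
quotient that defines the uniform measure.

Passing from geometric to exponential laws costs at most kt for each coloured part k. For a single k
only kt → 0 is needed, whence the range o(n^(1/2)) in part (2). -/

namespace UnimodalLimit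

open Complex (I)

/-! ### Characteristic functions of geometric variables -/

/-- The characteristic function at `y` of a geometric variable with ratio `p`. -/
noncomputable def geomChar (p y : ℝ) : ℂ := (1 - p) / (1 - p * Complex.exp (I * y))

/-- The part of the characteristic function `geomChar` carried by the values below `b`. -/
noncomputable def truncChar (p : ℝ) (b : ℕ) (y : ℝ) : ℂ :=
  (1 - p) * ∑ j ∈ Finset.range b, (p * Complex.exp (I * y)) ^ j

lemma norm_exp_I_mul (y : ℝ) : ‖Complex.exp (I * y)‖ = 1 := by
  rw [mul_comm]; exact Complex.norm_exp_ofReal_mul_I y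

lemma norm_ofReal_mul_exp_I {p : ℝ} (hp : 0 ≤ p) (y : ℝ) :
    ‖(p : ℂ) * Complex.exp (I * y)‖ = p := by
  rw [norm_mul, norm_exp_I_mul, mul_one, Complex.norm_real, Real.norm_of_nonneg hp]

lemma one_sub_ne_zero_of_norm_lt {z : ℂ} (hz : ‖z‖ < 1) : 1 - z ≠ 0 := by
  intro h
  have : z = 1 := by linear_combination -h
  simp [this] at hz

/-- Second order Taylor bound for the exponential on the imaginary axis. -/
lemma norm_exp_I_taylor (y : ℝ) :
    ‖Complex.exp (I * y) - 1 - I * y + (y : ℂ) ^ 2 / 2‖ ≤ 4 * |y| ^ 3 := by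
  rcases le_total |y| 1 with h | h
  · have h1 := Complex.norm_exp_sub_sum_le_norm_mul_exp (I * y) 3
    have h2 : ‖I * (y : ℂ)‖ = |y| := by simp
    have h3 : Complex.exp (I * y) - 1 - I * y + (y : ℂ) ^ 2 / 2 =
        Complex.exp (I * y) - ∑ m ∈ Finset.range 3, (I * (y : ℂ)) ^ m / (m.factorial : ℂ) := by
      simp only [Finset.sum_range_succ, Finset.sum_range_zero, mul_pow, Complex.I_sq]
      norm_num [Nat.factorial]
      ring
    rw [h3]
    refine h1.trans ?_
    rw [h2, mul_comm]
    have h4 : Real.exp |y| ≤ 4 := by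
      calc Real.exp |y| ≤ Real.exp 1 := Real.exp_le_exp.mpr h
        _ ≤ 4 := by linarith [Real.exp_one_lt_d9]
    gcongr
  · have h1 : ‖Complex.exp (I * y) - 1 - I * y + (y : ℂ) ^ 2 / 2‖ ≤ 1 + 1 + |y| + |y| ^ 2 / 2 := by
      refine (norm_add_le _ _).trans ?_
      have : ‖(y : ℂ) ^ 2 / 2‖ = |y| ^ 2 / 2 := by simp
      rw [this]
      gcongr
      refine (norm_sub_le _ _).trans ?_
      have : ‖I * (y : ℂ)‖ = |y| := by simp
      rw [this]
      gcongr
      refine (norm_sub_le _ _).trans ?_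
      rw [norm_exp_I_mul]; simp
    refine h1.trans ?_
    nlinarith [mul_le_mul h h (by norm_num) (abs_nonneg y), pow_le_pow_left₀ (by norm_num) h 3,
      pow_le_pow_right₀ h (show 1 ≤ 3 by norm_num), pow_le_pow_right₀ h (show 2 ≤ 3 by norm_num)]

/-- After shifting the index, (n+1)^2 ≤ (n+2)(n+1) dominates the series by 2p times the expansion of
1/(1-p)^3 in binomial coefficients. -/
lemma hasSum_sq_mul_geometric_le {p : ℝ} (h0 : 0 ≤ p) (h1 : p < 1) :
    Summable (fun n : ℕ => (n : ℝ) ^ 2 * p ^ n) ∧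
      ∑' n : ℕ, (n : ℝ) ^ 2 * p ^ n ≤ 2 * (p / (1 - p) ^ 3) := by
  have hn : ‖p‖ < 1 := by rwa [Real.norm_of_nonneg h0]
  have hs := summable_pow_mul_geometric_of_norm_lt_one 2 hn
  refine ⟨hs, ?_⟩
  have hc := hasSum_choose_mul_geometric_of_norm_lt_one 2 hn
  rw [hs.tsum_eq_zero_add]
  simp only [Nat.cast_zero, ne_eq, OfNat.ofNat_ne_zero, not_false_eq_true, zero_pow, zero_mul,
    zero_add]
  have h2 : HasSum (fun n : ℕ => 2 * p * (((n + 2).choose 2 : ℝ) * p ^ n))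
      (2 * p * (1 / (1 - p) ^ 3)) := hc.mul_left _
  calc ∑' n : ℕ, ((n + 1 : ℕ) : ℝ) ^ 2 * p ^ (n + 1)
      ≤ 2 * p * (1 / (1 - p) ^ 3) := by
        rw [← h2.tsum_eq]
        refine Summable.tsum_le_tsum (fun n => ?_) ((summable_nat_add_iff 1).mpr hs) h2.summable
        have : ((n + 2).choose 2 : ℝ) = (n + 2) * (n + 1) / 2 := by
          rw [Nat.cast_choose_two]; push_cast; ring
        rw [this, pow_succ p n]
        have hp : 0 ≤ p ^ n * p := by positivity
        push_cast
        nlinarith [mul_nonneg hp (show (0 : ℝ) ≤ n by positivity)]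
    _ = 2 * (p / (1 - p) ^ 3) := by ring

/-- A logarithm of `geomChar`, with its Taylor expansion and a bound for its real part. -/
lemma exists_log_geomChar {p : ℝ} (h0 : 0 ≤ p) (h1 : p < 1) (y : ℝ) :
    ∃ L : ℂ, Complex.exp L = geomChar p y ∧
      ‖L - I * y * (p / (1 - p) : ℝ) + (y : ℂ) ^ 2 / 2 * (p / (1 - p) ^ 2 : ℝ)‖
        ≤ 8 * |y| ^ 3 * (p / (1 - p) ^ 3) ∧
      L.re ≤ -(p * (1 - Real.cos y)) := by
  set z : ℂ := p * Complex.exp (I * y) with hz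
  have hzn : ‖z‖ < 1 := by rw [hz, norm_ofReal_mul_exp_I h0]; exact h1
  have hpn : ‖(p : ℂ)‖ < 1 := by rwa [Complex.norm_real, Real.norm_of_nonneg h0]
  have e1 : Complex.exp (Complex.log (1 - (p : ℂ))) = 1 - p :=
    Complex.exp_log (one_sub_ne_zero_of_norm_lt hpn)
  have e2 : Complex.exp (Complex.log (1 - z)) = 1 - z :=
    Complex.exp_log (one_sub_ne_zero_of_norm_lt hzn)
  -- The logarithm is a difference of two Taylor series, at p e^(iy) and at p, rather than the
  -- principal logarithm of the quotient. Only its exponential matters, so no branch question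
  -- arises.
  have hs : HasSum (fun n : ℕ => (p : ℂ) ^ n / n * (Complex.exp (I * (n * y : ℝ)) - 1))
      (Complex.log (1 - (p : ℂ)) - Complex.log (1 - z)) := by
    have := (Complex.hasSum_taylorSeries_neg_log hzn).sub
      (Complex.hasSum_taylorSeries_neg_log hpn)
    convert! this using 1
    · funext n
      have : Complex.exp (I * (n * y : ℝ)) = Complex.exp (I * y) ^ n := by
        rw [← Complex.exp_nat_mul]; congr 1; push_cast; ring
      rw [this, hz, mul_pow]; ring
    · ring
  refine ⟨Complex.log (1 - (p : ℂ)) - Complex.log (1 - z), ?_, ?_, ?_⟩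
  · rw [Complex.exp_sub, e1, e2]; rfl
  · have hA : HasSum (fun n : ℕ => I * y * (if n = 0 then 0 else (p : ℂ) ^ n))
        (I * y * (p / (1 - p) : ℝ)) := by
      refine HasSum.mul_left _ ?_
      have h := hasSum_geometric_of_norm_lt_one hpn
      rw [← hasSum_nat_add_iff' 1] at h ⊢
      simp only [Nat.add_eq_zero_iff, one_ne_zero, and_false, if_false, Finset.sum_range_one,
        if_true, sub_zero, pow_zero] at h ⊢
      convert! h using 1
      push_cast
      field_simp [one_sub_ne_zero_of_norm_lt hpn]
      ring
    have hB : HasSum (fun n : ℕ => (y : ℂ) ^ 2 / 2 * (n * (p : ℂ) ^ n))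
        ((y : ℂ) ^ 2 / 2 * (p / (1 - p) ^ 2 : ℝ)) := by
      refine HasSum.mul_left _ ?_
      convert! hasSum_coe_mul_geometric_of_norm_lt_one hpn using 1
      push_cast; rfl
    have hT := (hs.sub hA).add hB
    obtain ⟨hq, hq'⟩ := hasSum_sq_mul_geometric_le h0 h1
    rw [← hT.tsum_eq]
    -- The cubic Taylor error at ny, weighted by p^n/n, leaves n^2 p^n, which sums to order
    -- p/(1-p)^3.
    have hbound : ∀ n : ℕ, ‖(p : ℂ) ^ n / n * (Complex.exp (I * (n * y : ℝ)) - 1) -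
        I * y * (if n = 0 then 0 else (p : ℂ) ^ n) + (y : ℂ) ^ 2 / 2 * (n * (p : ℂ) ^ n)‖ ≤
        4 * |y| ^ 3 * ((n : ℝ) ^ 2 * p ^ n) := by
      intro n
      rcases Nat.eq_zero_or_pos n with rfl | hn
      · simp
      · have hn' : (n : ℂ) ≠ 0 := by exact_mod_cast hn.ne'
        have e : (p : ℂ) ^ n / n * (Complex.exp (I * (n * y : ℝ)) - 1) -
            I * y * (if n = 0 then 0 else (p : ℂ) ^ n) + (y : ℂ) ^ 2 / 2 * (n * (p : ℂ) ^ n) =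
            (p : ℂ) ^ n / n * (Complex.exp (I * (n * y : ℝ)) - 1 - I * (n * y : ℝ) +
              ((n * y : ℝ) : ℂ) ^ 2 / 2) := by
          rw [if_neg hn.ne']
          push_cast
          field_simp
        rw [e, norm_mul, norm_div, norm_pow, Complex.norm_real, Real.norm_of_nonneg h0,
          Complex.norm_natCast]
        have hn'' : (0 : ℝ) < n := by exact_mod_cast hn
        calc p ^ n / n * ‖_‖ ≤ p ^ n / n * (4 * |n * y| ^ 3) := by
              gcongr; exact norm_exp_I_taylor _
          _ = 4 * |y| ^ 3 * ((n : ℝ) ^ 2 * p ^ n) := by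
              rw [abs_mul, abs_of_pos hn'']; field_simp
    calc ‖_‖ ≤ ∑' n : ℕ, 4 * |y| ^ 3 * ((n : ℝ) ^ 2 * p ^ n) :=
          tsum_of_norm_bounded (hq.mul_left _).hasSum hbound
      _ = 4 * |y| ^ 3 * ∑' n : ℕ, (n : ℝ) ^ 2 * p ^ n := tsum_mul_left
      _ ≤ 4 * |y| ^ 3 * (2 * (p / (1 - p) ^ 3)) := by gcongr
      _ = _ := by ring
  · have hre := Complex.hasSum_re hs
    have hterm : ∀ n : ℕ, ((p : ℂ) ^ n / n * (Complex.exp (I * (n * y : ℝ)) - 1)).re =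
        p ^ n / n * (Real.cos (n * y) - 1) := by
      intro n
      have : (p : ℂ) ^ n / n = ((p ^ n / n : ℝ) : ℂ) := by push_cast; rfl
      rw [this, Complex.re_ofReal_mul, Complex.sub_re, mul_comm I, Complex.exp_ofReal_mul_I_re,
        Complex.one_re]
    simp only [hterm] at hre
    -- All terms of the negated series are nonnegative, so the single term n = 1 already bounds the
    -- sum from below.
    have hneg := hre.neg
    have := hneg.summable.sum_le_tsum {1} (fun n _ => by
      have : Real.cos (n * y) - 1 ≤ 0 := by linarith [Real.cos_le_one (n * y)]
      have h' : 0 ≤ p ^ n / n := by positivity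
      nlinarith)
    rw [hneg.tsum_eq] at this
    simp only [Finset.sum_singleton, pow_one, Nat.cast_one, div_one, one_mul] at this
    linarith

lemma norm_geomChar_le_exp {p : ℝ} (h0 : 0 ≤ p) (h1 : p < 1) (y : ℝ) :
    ‖geomChar p y‖ ≤ Real.exp (-(p * (1 - Real.cos y))) := by
  obtain ⟨L, hL, -, hre⟩ := exists_log_geomChar h0 h1 y
  rw [← hL, Complex.norm_exp]
  exact Real.exp_le_exp.mpr hre

lemma norm_geomChar_le_one {p : ℝ} (h0 : 0 ≤ p) (h1 : p < 1) (y : ℝ) : ‖geomChar p y‖ ≤ 1 := by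
  refine (norm_geomChar_le_exp h0 h1 y).trans (Real.exp_le_one_iff.mpr ?_)
  have := Real.cos_le_one y
  have := mul_nonneg h0 (sub_nonneg.mpr this)
  linarith

lemma norm_geomChar_sub_one_le {p : ℝ} (h0 : 0 ≤ p) (h1 : p < 1) (y : ℝ) :
    ‖geomChar p y - 1‖ ≤ |y| * (p / (1 - p)) := by
  have hz : ‖(p : ℂ) * Complex.exp (I * y)‖ < 1 := by rwa [norm_ofReal_mul_exp_I h0]
  have hne := one_sub_ne_zero_of_norm_lt hz
  have e : geomChar p y - 1 =
      p * (Complex.exp (I * y) - 1) / (1 - p * Complex.exp (I * y)) := by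
    rw [geomChar]; field_simp; ring
  rw [e, norm_div, norm_mul, Complex.norm_real, Real.norm_of_nonneg h0]
  have h2 : 1 - p ≤ ‖1 - (p : ℂ) * Complex.exp (I * y)‖ := by
    have := norm_sub_norm_le (1 : ℂ) (p * Complex.exp (I * y))
    rwa [norm_one, norm_ofReal_mul_exp_I h0] at this
  have h3 : ‖Complex.exp (I * y) - 1‖ ≤ |y| := Real.norm_exp_I_mul_ofReal_sub_one_le
  have h4 : 0 < 1 - p := by linarith
  calc p * ‖Complex.exp (I * y) - 1‖ / ‖1 - (p : ℂ) * Complex.exp (I * y)‖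
      ≤ p * |y| / (1 - p) := by gcongr
    _ = _ := by ring

lemma continuous_geomChar {p : ℝ} (h0 : 0 ≤ p) (h1 : p < 1) : Continuous (geomChar p) := by
  unfold geomChar
  refine Continuous.div (by fun_prop) (by fun_prop) fun y => ?_
  exact one_sub_ne_zero_of_norm_lt (by rwa [norm_ofReal_mul_exp_I h0])

lemma continuous_truncChar (p : ℝ) (b : ℕ) : Continuous (truncChar p b) := by
  unfold truncChar
  fun_prop

lemma tendsto_truncChar {p : ℝ} (h0 : 0 ≤ p) (h1 : p < 1) (y : ℝ) :
    Tendsto (fun b => truncChar p b y) atTop (nhds (geomChar p y)) := by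
  have hz : ‖(p : ℂ) * Complex.exp (I * y)‖ < 1 := by rwa [norm_ofReal_mul_exp_I h0]
  exact ((hasSum_geometric_of_norm_lt_one hz).tendsto_sum_nat).const_mul _

lemma sum_geometric_mul_one_sub (p : ℝ) (b : ℕ) :
    (1 - p) * ∑ j ∈ Finset.range b, p ^ j = 1 - p ^ b := by
  rw [mul_comm, geom_sum_mul_neg]

lemma truncChar_zero (p : ℝ) (b : ℕ) : truncChar p b 0 = ((1 - p ^ b : ℝ) : ℂ) := by
  rw [← sum_geometric_mul_one_sub, truncChar]
  push_cast
  simp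

lemma norm_truncChar_le_one {p : ℝ} (h0 : 0 ≤ p) (h1 : p < 1) (b : ℕ) (y : ℝ) :
    ‖truncChar p b y‖ ≤ 1 := by
  have h4 : 0 ≤ 1 - p := by linarith
  have h5 : ‖(1 - p : ℂ)‖ = 1 - p := by
    rw [← Complex.ofReal_one, ← Complex.ofReal_sub, Complex.norm_real, Real.norm_of_nonneg h4]
  calc ‖truncChar p b y‖ ≤ (1 - p) * ∑ j ∈ Finset.range b, p ^ j := by
        rw [truncChar, norm_mul, h5]
        refine mul_le_mul_of_nonneg_left ((norm_sum_le _ _).trans ?_) h4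
        refine Finset.sum_le_sum fun j _ => ?_
        rw [norm_pow, norm_ofReal_mul_exp_I h0]
    _ = 1 - p ^ b := sum_geometric_mul_one_sub p b
    _ ≤ 1 := by linarith [pow_nonneg h0 b]

/-- The j-th term moves by at most j|y|p^j before normalisation, so the mean of the full geometric
law is a Lipschitz constant, uniformly in the cut-off b. -/
lemma norm_truncChar_sub_le {p : ℝ} (h0 : 0 ≤ p) (h1 : p < 1) (b : ℕ) (y : ℝ) :
    ‖truncChar p b y - truncChar p b 0‖ ≤ |y| * (p / (1 - p)) := by
  have h4 : 0 ≤ 1 - p := by linarith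
  have h4' : 1 - p ≠ 0 := by linarith
  have h5 : ‖(1 - p : ℂ)‖ = 1 - p := by
    rw [← Complex.ofReal_one, ← Complex.ofReal_sub, Complex.norm_real, Real.norm_of_nonneg h4]
  have hpn : ‖p‖ < 1 := by rwa [Real.norm_of_nonneg h0]
  have hs := hasSum_coe_mul_geometric_of_norm_lt_one hpn
  have hj : ∀ j : ℕ, ‖((p : ℂ) * Complex.exp (I * y)) ^ j - (p * Complex.exp (I * (0 : ℝ))) ^ j‖
      ≤ |y| * (j * p ^ j) := by
    intro j
    have e : ((p : ℂ) * Complex.exp (I * y)) ^ j - (p * Complex.exp (I * (0 : ℝ))) ^ j =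
        (p : ℂ) ^ j * (Complex.exp (I * (j * y : ℝ)) - 1) := by
      have : Complex.exp (I * (j * y : ℝ)) = Complex.exp (I * y) ^ j := by
        rw [← Complex.exp_nat_mul]; congr 1; push_cast; ring
      rw [this, mul_pow]; simp; ring
    rw [e, norm_mul, norm_pow, Complex.norm_real, Real.norm_of_nonneg h0]
    have : ‖Complex.exp (I * (j * y : ℝ)) - 1‖ ≤ ‖(j * y : ℝ)‖ :=
      Real.norm_exp_I_mul_ofReal_sub_one_le
    calc _ ≤ p ^ j * ‖(j * y : ℝ)‖ := by gcongr
      _ = _ := by rw [norm_mul, Real.norm_natCast, Real.norm_eq_abs]; ring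
  rw [truncChar, truncChar, ← mul_sub, ← Finset.sum_sub_distrib, norm_mul, h5]
  calc (1 - p) * ‖_‖ ≤ (1 - p) * ∑ j ∈ Finset.range b, |y| * (j * p ^ j) := by
        gcongr
        exact (norm_sum_le _ _).trans (Finset.sum_le_sum fun j _ => hj j)
    _ ≤ (1 - p) * (|y| * (p / (1 - p) ^ 2)) := by
        rw [← Finset.mul_sum]
        gcongr
        exact sum_le_hasSum _ (fun j _ => by positivity) hs
    _ = _ := by field_simp

/-! ### Fourier inversion for counting configurations -/

lemma integral_exp_I_int (m : ℤ) :
    ∫ θ in (-Real.pi)..Real.pi, Complex.exp (I * (m * θ : ℝ)) =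
      if m = 0 then 2 * (Real.pi : ℂ) else 0 := by
  split_ifs with h
  · subst h
    simp
    ring
  · have hc : I * (m : ℂ) ≠ 0 := mul_ne_zero Complex.I_ne_zero (by exact_mod_cast h)
    have e : ∀ θ : ℝ, Complex.exp (I * (m * θ : ℝ)) = Complex.exp (I * m * θ) := by
      intro θ; congr 1; push_cast; ring
    simp only [e]
    rw [integral_exp_mul_complex hc]
    have : Complex.exp (I * m * (Real.pi : ℝ)) = Complex.exp (I * m * ((-Real.pi : ℝ) : ℂ)) := by
      rw [Complex.exp_eq_exp_iff_exists_int]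
      exact ⟨m, by push_cast; ring⟩
    rw [this]; simp

lemma prod_norm_le_one {α 𝕜 : Type*} [NormedField 𝕜] (s : Finset α) (f : α → 𝕜)
    (h : ∀ i ∈ s, ‖f i‖ ≤ 1) :
    ‖∏ i ∈ s, f i‖ ≤ 1 := by
  rw [norm_prod]
  exact Finset.prod_le_one (fun _ _ => norm_nonneg _) h

lemma pow_weight_bounds {q : ℝ} (hq0 : 0 < q) (hq1 : q < 1) {ι : Type*} {w : ι → ℕ}
    (hw : ∀ i, 1 ≤ w i) (i : ι) : 0 ≤ q ^ w i ∧ q ^ w i < 1 :=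
  ⟨by positivity, pow_lt_one₀ hq0.le hq1 (by have := hw i; omega)⟩

lemma norm_prod_sub_prod_le {α 𝕜 : Type*} [DecidableEq α] [NormedField 𝕜] (s : Finset α)
    (f g : α → 𝕜)
    (hf : ∀ i ∈ s, ‖f i‖ ≤ 1) (hg : ∀ i ∈ s, ‖g i‖ ≤ 1) :
    ‖∏ i ∈ s, f i - ∏ i ∈ s, g i‖ ≤ ∑ i ∈ s, ‖f i - g i‖ := by
  induction s using Finset.induction_on with
  | empty => simp
  | insert j s hj ih =>
    rw [Finset.prod_insert hj, Finset.prod_insert hj, Finset.sum_insert hj]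
    have hf' : ∀ i ∈ s, ‖f i‖ ≤ 1 := fun i hi => hf i (Finset.mem_insert_of_mem hi)
    have hg' : ∀ i ∈ s, ‖g i‖ ≤ 1 := fun i hi => hg i (Finset.mem_insert_of_mem hi)
    have e : f j * ∏ i ∈ s, f i - g j * ∏ i ∈ s, g i =
        (f j - g j) * ∏ i ∈ s, f i + g j * (∏ i ∈ s, f i - ∏ i ∈ s, g i) := by ring
    rw [e]
    refine (norm_add_le _ _).trans ?_
    rw [norm_mul, norm_mul]
    have h1 := prod_norm_le_one s f hf'
    have h2 := hg j (Finset.mem_insert_self _ _)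
    have h3 := ih hf' hg'
    have h4 := norm_nonneg (∏ i ∈ s, f i - ∏ i ∈ s, g i)
    have h5 := norm_nonneg (f j - g j)
    nlinarith

section Configs

variable {ι : Type*} [Fintype ι]

lemma le_of_sum_eq {w : ι → ℕ} (hw : ∀ i, 1 ≤ w i) {n : ℕ} {a : ι → ℕ}
    (h : ∑ i, w i * a i = n) (i : ι) : a i ≤ n := by
  calc a i ≤ w i * a i := Nat.le_mul_of_pos_left _ (hw i)
    _ ≤ ∑ i, w i * a i := Finset.single_le_sum (f := fun i => w i * a i)
        (fun _ _ => Nat.zero_le _) (Finset.mem_univ i)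
    _ = n := h

variable [DecidableEq ι]

/-- The multiplicity functions `a` on the index set `ι` of total weight `n`. -/
def configs (w : ι → ℕ) (n : ℕ) : Finset (ι → ℕ) :=
  (Fintype.piFinset fun _ => Finset.range (n + 1)).filter fun a => ∑ i, w i * a i = n

lemma mem_configs {w : ι → ℕ} (hw : ∀ i, 1 ≤ w i) {n : ℕ} {a : ι → ℕ} :
    a ∈ configs w n ↔ ∑ i, w i * a i = n := by
  simp only [configs, Finset.mem_filter, Fintype.mem_piFinset, Finset.mem_range,
    and_iff_right_iff_imp]
  intro h i
  exact Nat.lt_succ_of_le (le_of_sum_eq hw h i)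

/-- The configurations of weight `n` with at most `b i - 1` copies of `i` for `i ∈ J`. -/
def boxConfigs (w : ι → ℕ) (n : ℕ) (J : Finset ι) (b : ι → ℕ) : Finset (ι → ℕ) :=
  (configs w n).filter fun a => ∀ i ∈ J, a i < b i

lemma boxConfigs_empty (w : ι → ℕ) (n : ℕ) (b : ι → ℕ) : boxConfigs w n ∅ b = configs w n := by
  simp [boxConfigs]

lemma boxConfigs_eq {w : ι → ℕ} (hw : ∀ i, 1 ≤ w i) (n : ℕ) (J : Finset ι) (b : ι → ℕ)
    {L : ℕ} (hL : n < L) :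
    boxConfigs w n J b =
      (Fintype.piFinset fun i => Finset.range (if i ∈ J then b i else L)).filter
        fun a => ∑ i, w i * a i = n := by
  ext a
  simp only [boxConfigs, Finset.mem_filter, mem_configs hw, Fintype.mem_piFinset,
    Finset.mem_range]
  constructor
  · rintro ⟨h1, h2⟩
    refine ⟨fun i => ?_, h1⟩
    split_ifs with hi
    · exact h2 i hi
    · exact (le_of_sum_eq hw h1 i).trans_lt hL
  · rintro ⟨h1, h2⟩
    exact ⟨h2, fun i hi => by simpa [hi] using h1 i⟩

/-- Expanding the product gives each configuration a Boltzmann weight that depends only on its total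
weight. Orthogonality of the exponentials keeps those of weight n, all with the same coefficient, so
the integral counts them. -/
lemma card_filter_fourier (w : ι → ℕ) (b : ι → ℕ) (n : ℕ) (q : ℝ) :
    ((((Fintype.piFinset fun i => Finset.range (b i)).filter
        fun a => ∑ i, w i * a i = n).card : ℝ) * (q ^ n * ∏ i, (1 - q ^ w i)) : ℝ) =
      (1 / (2 * Real.pi) : ℂ) * ∫ θ in (-Real.pi)..Real.pi,
        (∏ i, truncChar (q ^ w i) (b i) (w i * θ)) * Complex.exp (-(I * (n * θ : ℝ))) := by
  have hexp : ∀ θ : ℝ,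
      (∏ i, truncChar (q ^ w i) (b i) (w i * θ)) * Complex.exp (-(I * (n * θ : ℝ))) =
      ∑ a ∈ Fintype.piFinset fun i => Finset.range (b i),
        (∏ i, (1 - (q : ℂ) ^ w i)) * (q : ℂ) ^ (∑ i, w i * a i) *
          Complex.exp (I * ((((∑ i, w i * a i : ℕ) : ℤ) - n : ℤ) * θ : ℝ)) := by
    intro θ
    simp only [truncChar, Finset.prod_mul_distrib]
    rw [Finset.prod_univ_sum, Finset.mul_sum, Finset.sum_mul]
    refine Finset.sum_congr rfl fun a _ => ?_
    have h1 : ∏ i, (((q ^ w i : ℝ) : ℂ) * Complex.exp (I * ((w i * θ : ℝ) : ℂ))) ^ a i =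
        (q : ℂ) ^ (∑ i, w i * a i) * Complex.exp (I * ((∑ i, w i * a i : ℕ) * θ : ℝ)) := by
      simp only [mul_pow, Finset.prod_mul_distrib, Complex.ofReal_pow, ← pow_mul]
      rw [Finset.prod_pow_eq_pow_sum]
      congr 1
      simp only [← Complex.exp_nat_mul]
      rw [← Complex.exp_sum]
      congr 1
      push_cast
      rw [Finset.sum_mul, Finset.mul_sum]
      exact Finset.sum_congr rfl fun i _ => by ring
    have h2 : Complex.exp (I * ((((∑ i, w i * a i : ℕ) : ℤ) - n : ℤ) * θ : ℝ)) =
        Complex.exp (I * ((∑ i, w i * a i : ℕ) * θ : ℝ)) * Complex.exp (-(I * (n * θ : ℝ))) := by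
      rw [← Complex.exp_add]
      congr 1
      push_cast
      ring
    rw [h1, h2]
    push_cast
    ring
  simp only [hexp]
  rw [intervalIntegral.integral_finsetSum
    (fun a _ => Continuous.intervalIntegrable (by fun_prop) _ _)]
  simp only [intervalIntegral.integral_const_mul, integral_exp_I_int]
  have hpi : (Real.pi : ℂ) ≠ 0 := by exact_mod_cast Real.pi_ne_zero
  have hif : ∀ a : ι → ℕ, (∏ i, (1 - (q : ℂ) ^ w i)) * (q : ℂ) ^ (∑ i, w i * a i) *
      (if (((∑ i, w i * a i : ℕ) : ℤ) - n : ℤ) = 0 then 2 * (Real.pi : ℂ) else 0) =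
      if ∑ i, w i * a i = n then
        (∏ i, (1 - (q : ℂ) ^ w i)) * (q : ℂ) ^ n * (2 * (Real.pi : ℂ)) else 0 := by
    intro a
    by_cases h : ∑ i, w i * a i = n
    · simp [h]
    · have : (((∑ i, w i * a i : ℕ) : ℤ) - n : ℤ) ≠ 0 := by omega
      rw [if_neg this, if_neg h, mul_zero]
  simp only [hif]
  rw [← Finset.sum_filter, Finset.sum_const, nsmul_eq_mul]
  push_cast
  field_simp

/-- A cap L > n on the multiplicities outside J does not change the count, so L may tend to infinity
under the integral, where the integrands are bounded by 1. -/
lemma card_boxConfigs_fourier {w : ι → ℕ} (hw : ∀ i, 1 ≤ w i) (n : ℕ) (J : Finset ι) (b : ι → ℕ)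
    {q : ℝ} (hq0 : 0 < q) (hq1 : q < 1) :
    (((boxConfigs w n J b).card : ℝ) * (q ^ n * ∏ i, (1 - q ^ w i)) : ℝ) =
      (1 / (2 * Real.pi) : ℂ) * ∫ θ in (-Real.pi)..Real.pi,
        (∏ i, if i ∈ J then truncChar (q ^ w i) (b i) (w i * θ) else
          geomChar (q ^ w i) (w i * θ)) * Complex.exp (-(I * (n * θ : ℝ))) := by
  set F : ℕ → ℝ → ℂ := fun L θ =>
    (∏ i, truncChar (q ^ w i) (if i ∈ J then b i else L) (w i * θ)) *
      Complex.exp (-(I * (n * θ : ℝ)))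
  have hconst : ∀ᶠ L in atTop, (1 / (2 * Real.pi) : ℂ) * ∫ θ in (-Real.pi)..Real.pi, F L θ =
      (((boxConfigs w n J b).card : ℝ) * (q ^ n * ∏ i, (1 - q ^ w i)) : ℝ) := by
    filter_upwards [eventually_gt_atTop n] with L hL
    rw [boxConfigs_eq hw n J b hL, card_filter_fourier]
  have hlim : Tendsto (fun L => (1 / (2 * Real.pi) : ℂ) * ∫ θ in (-Real.pi)..Real.pi, F L θ) atTop
      (nhds ((1 / (2 * Real.pi) : ℂ) * ∫ θ in (-Real.pi)..Real.pi,
        (∏ i, if i ∈ J then truncChar (q ^ w i) (b i) (w i * θ) else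
          geomChar (q ^ w i) (w i * θ)) * Complex.exp (-(I * (n * θ : ℝ))))) := by
    refine Tendsto.const_mul _ ?_
    refine intervalIntegral.tendsto_integral_filter_of_dominated_convergence (fun _ => 1) ?_ ?_
      (by simp) ?_
    · refine Eventually.of_forall fun L => Continuous.aestronglyMeasurable ?_
      refine Continuous.mul (continuous_finsetProd _ fun i _ => ?_) (by fun_prop)
      exact (continuous_truncChar _ _).comp (by fun_prop)
    · refine Eventually.of_forall fun L => Eventually.of_forall fun θ _ => ?_
      have : ‖Complex.exp (-(I * (n * θ : ℝ)))‖ = 1 := by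
        rw [← mul_neg, ← Complex.ofReal_neg, norm_exp_I_mul]
      rw [norm_mul, this, mul_one]
      exact prod_norm_le_one _ _ fun i _ => norm_truncChar_le_one
        (pow_weight_bounds hq0 hq1 hw i).1 (pow_weight_bounds hq0 hq1 hw i).2 _ _
    · refine Eventually.of_forall fun θ _ => ?_
      refine Tendsto.mul_const _ (tendsto_finsetProd _ fun i _ => ?_)
      split_ifs
      · exact tendsto_const_nhds
      · exact tendsto_truncChar
          (pow_weight_bounds hq0 hq1 hw i).1 (pow_weight_bounds hq0 hq1 hw i).2 _
  exact (tendsto_nhds_unique (hlim.congr' hconst) tendsto_const_nhds).symm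

/-- Comparison of the number of configurations in a box with the value for independent
geometric variables. -/
lemma abs_card_boxConfigs_sub_le {w : ι → ℕ} (hw : ∀ i, 1 ≤ w i) (n : ℕ) (J : Finset ι)
    (b : ι → ℕ) {q : ℝ} (hq0 : 0 < q) (hq1 : q < 1) :
    |((boxConfigs w n J b).card : ℝ) - (configs w n).card * ∏ i ∈ J, (1 - (q ^ w i) ^ b i)| *
        (q ^ n * ∏ i, (1 - q ^ w i)) ≤
      (∑ i ∈ J, w i * (q ^ w i / (1 - q ^ w i))) * ∫ θ in (-Real.pi)..Real.pi,
        |θ| * ∏ i ∈ Jᶜ, ‖geomChar (q ^ w i) (w i * θ)‖ := by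
  have hp := pow_weight_bounds hq0 hq1 hw
  set S := ∑ i ∈ J, w i * (q ^ w i / (1 - q ^ w i)) with hS
  have hpos : 0 ≤ q ^ n * ∏ i, (1 - q ^ w i) :=
    mul_nonneg (by positivity) (Finset.prod_nonneg fun i _ => by linarith [(hp i).2])
  have hb := card_boxConfigs_fourier hw n J b hq0 hq1
  have hc := card_boxConfigs_fourier hw n ∅ b hq0 hq1
  rw [boxConfigs_empty] at hc
  simp only [Finset.notMem_empty, if_false] at hc
  set G : ℝ → ℂ := fun θ => (∏ i, if i ∈ J then truncChar (q ^ w i) (b i) (w i * θ) else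
          geomChar (q ^ w i) (w i * θ)) * Complex.exp (-(I * (n * θ : ℝ))) with hG
  set H : ℝ → ℂ := fun θ => (∏ i, geomChar (q ^ w i) (w i * θ)) *
      Complex.exp (-(I * (n * θ : ℝ))) with hH
  have cgeom : ∀ i, Continuous fun θ : ℝ => geomChar (q ^ w i) (w i * θ) := fun i =>
    (continuous_geomChar (hp i).1 (hp i).2).comp (by fun_prop)
  have cG : Continuous G := by
    refine Continuous.mul (continuous_finsetProd _ fun i _ => ?_) (by fun_prop)
    split_ifs
    · exact (continuous_truncChar _ _).comp (by fun_prop)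
    · exact cgeom i
  have cH : Continuous H :=
    Continuous.mul (continuous_finsetProd _ fun i _ => cgeom i) (by fun_prop)
  have hdiff : (((((boxConfigs w n J b).card : ℝ) -
      (configs w n).card * ∏ i ∈ J, (1 - (q ^ w i) ^ b i)) *
        (q ^ n * ∏ i, (1 - q ^ w i)) : ℝ) : ℂ) =
      (1 / (2 * Real.pi) : ℂ) * ∫ θ in (-Real.pi)..Real.pi,
        (G θ - H θ * ∏ i ∈ J, truncChar (q ^ w i) (b i) 0) := by
    have hH' : IntervalIntegrable (fun θ => H θ * ∏ i ∈ J, truncChar (q ^ w i) (b i) 0)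
        MeasureTheory.volume (-Real.pi) Real.pi := (cH.mul continuous_const).intervalIntegrable _ _
    rw [intervalIntegral.integral_sub (cG.intervalIntegrable _ _) hH',
      intervalIntegral.integral_mul_const, mul_sub, ← hb, ← mul_assoc (1 / (2 * Real.pi) : ℂ), ← hc]
    simp only [truncChar_zero]
    push_cast
    ring
  have hptw : ∀ θ : ℝ, ‖G θ - H θ * ∏ i ∈ J, truncChar (q ^ w i) (b i) 0‖ ≤
      2 * S * (|θ| * ∏ i ∈ Jᶜ, ‖geomChar (q ^ w i) (w i * θ)‖) := by
    intro θ
    have h1 : ‖Complex.exp (-(I * (n * θ : ℝ)))‖ = 1 := by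
      rw [← mul_neg, ← Complex.ofReal_neg, norm_exp_I_mul]
    -- The two integrands agree outside J. The common product over Jᶜ factors out and supplies the
    -- decay in θ.
    have e : G θ - H θ * ∏ i ∈ J, truncChar (q ^ w i) (b i) 0 =
        (∏ i ∈ Jᶜ, geomChar (q ^ w i) (w i * θ)) *
        (∏ i ∈ J, truncChar (q ^ w i) (b i) (w i * θ) -
          ∏ i ∈ J, (geomChar (q ^ w i) (w i * θ) * truncChar (q ^ w i) (b i) 0)) *
        Complex.exp (-(I * (n * θ : ℝ))) := by
      simp only [hG, hH]
      rw [← Finset.prod_mul_prod_compl J, ← Finset.prod_mul_prod_compl J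
        (fun i => geomChar (q ^ w i) (w i * θ)), Finset.prod_mul_distrib]
      rw [Finset.prod_congr rfl (fun i hi => if_pos hi), Finset.prod_congr (s₁ := Jᶜ) rfl
        (fun i hi => if_neg (Finset.mem_compl.mp hi))]
      ring
    rw [e, norm_mul, norm_mul, h1, mul_one, norm_prod]
    have h2 : ‖∏ i ∈ J, truncChar (q ^ w i) (b i) (w i * θ) -
          ∏ i ∈ J, (geomChar (q ^ w i) (w i * θ) * truncChar (q ^ w i) (b i) 0)‖ ≤
        2 * S * |θ| := by
      refine (norm_prod_sub_prod_le J _ _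
        (fun i _ => norm_truncChar_le_one (hp i).1 (hp i).2 _ _) (fun i _ => ?_)).trans ?_
      · rw [norm_mul]
        exact mul_le_one₀ (norm_geomChar_le_one (hp i).1 (hp i).2 _) (norm_nonneg _)
          (norm_truncChar_le_one (hp i).1 (hp i).2 _ _)
      · rw [hS, Finset.mul_sum, Finset.sum_mul]
        refine Finset.sum_le_sum fun i _ => ?_
        -- Both factors are compared with their values at angle 0, where `geomChar` equals 1. The
        -- two displacements give the factor 2 in front of S.
        have e2 : truncChar (q ^ w i) (b i) (w i * θ) -
            geomChar (q ^ w i) (w i * θ) * truncChar (q ^ w i) (b i) 0 =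
            (truncChar (q ^ w i) (b i) (w i * θ) - truncChar (q ^ w i) (b i) 0) -
            (geomChar (q ^ w i) (w i * θ) - 1) * truncChar (q ^ w i) (b i) 0 := by ring
        rw [e2]
        refine (norm_sub_le _ _).trans ?_
        rw [norm_mul]
        have a1 := norm_truncChar_sub_le (hp i).1 (hp i).2 (b i) (w i * θ)
        have a2 := norm_geomChar_sub_one_le (hp i).1 (hp i).2 (w i * θ)
        have a3 := norm_truncChar_le_one (hp i).1 (hp i).2 (b i) 0
        have a4 : |(w i : ℝ) * θ| = w i * |θ| := by rw [abs_mul, Nat.abs_cast]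
        rw [a4] at a1 a2
        have a5 := mul_le_mul a2 a3 (norm_nonneg _)
          ((norm_nonneg _).trans a2)
        linarith
    calc _ ≤ (∏ i ∈ Jᶜ, ‖geomChar (q ^ w i) (w i * θ)‖) * (2 * S * |θ|) :=
          mul_le_mul_of_nonneg_left h2 (Finset.prod_nonneg fun _ _ => norm_nonneg _)
      _ = _ := by ring
  have hπ := Real.pi_pos
  have hb3 : Continuous fun θ : ℝ => 2 * S * (|θ| * ∏ i ∈ Jᶜ, ‖geomChar (q ^ w i) (w i * θ)‖) :=
    continuous_const.mul (continuous_abs.mul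
      (continuous_finsetProd _ fun i _ => (cgeom i).norm))
  have hle : ‖∫ θ in (-Real.pi)..Real.pi, (G θ - H θ * ∏ i ∈ J, truncChar (q ^ w i) (b i) 0)‖ ≤
      ∫ θ in (-Real.pi)..Real.pi, 2 * S * (|θ| * ∏ i ∈ Jᶜ, ‖geomChar (q ^ w i) (w i * θ)‖) :=
    intervalIntegral.norm_integral_le_of_norm_le (by linarith)
      (Eventually.of_forall fun θ _ => hptw θ) (hb3.intervalIntegrable _ _)
  rw [intervalIntegral.integral_const_mul] at hle
  rw [← abs_of_nonneg hpos, ← abs_mul, ← Real.norm_eq_abs, ← Complex.norm_real, hdiff, norm_mul]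
  have hn : ‖(1 / (2 * Real.pi) : ℂ)‖ = 1 / (2 * Real.pi) := by
    rw [show (1 / (2 * Real.pi) : ℂ) = ((1 / (2 * Real.pi) : ℝ) : ℂ) by push_cast; rfl,
      Complex.norm_real, Real.norm_of_nonneg (by positivity)]
  have hI0 : 0 ≤ S * ∫ θ in (-Real.pi)..Real.pi,
      |θ| * ∏ i ∈ Jᶜ, ‖geomChar (q ^ w i) (w i * θ)‖ := by
    have := (norm_nonneg _).trans hle
    linarith
  rw [hn]
  calc _ ≤ 1 / (2 * Real.pi) * (2 * S * ∫ θ in (-Real.pi)..Real.pi,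
      |θ| * ∏ i ∈ Jᶜ, ‖geomChar (q ^ w i) (w i * θ)‖) := by gcongr
    _ = (1 / Real.pi) * (S * ∫ θ in (-Real.pi)..Real.pi,
      |θ| * ∏ i ∈ Jᶜ, ‖geomChar (q ^ w i) (w i * θ)‖) := by ring
    _ ≤ 1 * (S * ∫ θ in (-Real.pi)..Real.pi,
      |θ| * ∏ i ∈ Jᶜ, ‖geomChar (q ^ w i) (w i * θ)‖) := by
        gcongr
        rw [div_le_one hπ]
        linarith [Real.pi_gt_three]
    _ = _ := one_mul _

end Configs

/-! ### Decay of the characteristic function for pairs of partitions -/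

/-- The weights of the parts of a pair of partitions with parts at most `M`. -/
def weight (M : ℕ) (i : Fin M × Bool) : ℕ := i.1 + 1

lemma one_le_weight (M : ℕ) (i : Fin M × Bool) : 1 ≤ weight M i := Nat.le_add_left 1 _

lemma sum_weight (M : ℕ) (f : ℕ → ℝ) :
    ∑ i : Fin M × Bool, f (weight M i) = 2 * ∑ k ∈ Finset.range M, f (k + 1) := by
  rw [Fintype.sum_prod_type]
  simp only [Fintype.sum_bool, weight]
  rw [Fin.sum_univ_eq_sum_range (fun k => f (k + 1) + f (k + 1)), Finset.mul_sum]
  exact Finset.sum_congr rfl fun _ _ => by ring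

/-- Difference of the geometric series at q and at q e^(iθ), in real parts. Twice this sum is the
exponent that bounds the modulus of the full characteristic function. -/
lemma hasSum_geometric_one_sub_cos {q : ℝ} (h0 : 0 ≤ q) (h1 : q < 1) (θ : ℝ) :
    HasSum (fun k : ℕ => q ^ (k + 1) * (1 - Real.cos ((k + 1 : ℕ) * θ)))
      (q * (1 + q) * (1 - Real.cos θ) /
        ((1 - q) * ((1 - q) ^ 2 + 2 * q * (1 - Real.cos θ)))) := by
  have hz : ‖(q : ℂ) * Complex.exp (I * θ)‖ < 1 := by rwa [norm_ofReal_mul_exp_I h0]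
  have hA := Complex.hasSum_re (hasSum_geometric_of_norm_lt_one hz)
  have hB := hasSum_geometric_of_lt_one h0 h1
  have hC := hB.sub hA
  have hterm : ∀ k : ℕ, q ^ k - (((q : ℂ) * Complex.exp (I * θ)) ^ k).re =
      q ^ k * (1 - Real.cos (k * θ)) := by
    intro k
    have : ((q : ℂ) * Complex.exp (I * θ)) ^ k =
        ((q ^ k : ℝ) : ℂ) * Complex.exp ((k * θ : ℝ) * I) := by
      rw [mul_pow, ← Complex.exp_nat_mul]
      push_cast
      congr 2
      ring
    rw [this, Complex.re_ofReal_mul, Complex.exp_ofReal_mul_I_re]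
    ring
  simp only [hterm] at hC
  rw [← hasSum_nat_add_iff' 1] at hC
  simp only [Finset.sum_range_one, Nat.cast_zero, zero_mul, Real.cos_zero, sub_self, mul_zero,
    sub_zero] at hC
  convert! hC using 1
  have hre : (1 - (q : ℂ) * Complex.exp (I * θ)).re = 1 - q * Real.cos θ := by
    rw [Complex.sub_re, Complex.re_ofReal_mul, mul_comm I, Complex.exp_ofReal_mul_I_re,
      Complex.one_re]
  have him : (1 - (q : ℂ) * Complex.exp (I * θ)).im = -(q * Real.sin θ) := by
    rw [Complex.sub_im, Complex.im_ofReal_mul, mul_comm I, Complex.exp_ofReal_mul_I_im,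
      Complex.one_im, zero_sub]
  rw [Complex.inv_re, Complex.normSq_apply, hre, him]
  have hc := Real.cos_le_one θ
  have e : (1 - q * Real.cos θ) * (1 - q * Real.cos θ) + -(q * Real.sin θ) * -(q * Real.sin θ) =
      (1 - q) ^ 2 + 2 * q * (1 - Real.cos θ) := by
    nlinarith [Real.sin_sq_add_cos_sq θ]
  rw [e]
  have h2 : 0 < (1 - q) ^ 2 + 2 * q * (1 - Real.cos θ) := by
    have := mul_nonneg h0 (sub_nonneg.mpr hc)
    have : 0 < (1 - q) ^ 2 := by have : 0 < 1 - q := by linarith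
                                 positivity
    linarith
  have h3 : 1 - q ≠ 0 := by linarith
  rw [← one_div, div_sub_div _ _ h3 h2.ne']
  congr 1
  ring

lemma pi_sq_le_ten : Real.pi ^ 2 ≤ 10 := by
  have := Real.pi_lt_d2
  have := Real.pi_pos
  nlinarith

/-- The profile governing the decay of the characteristic function. -/
noncomputable def decay (t θ : ℝ) : ℝ := min ((θ / t) ^ 2) 1

lemma decay_nonneg (t θ : ℝ) : 0 ≤ decay t θ := le_min (sq_nonneg _) zero_le_one

lemma decay_le_one (t θ : ℝ) : decay t θ ≤ 1 := min_le_right _ _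

lemma one_sub_exp_neg_bounds {t : ℝ} (h0 : 0 < t) (h1 : t ≤ 1) :
    t / 2 ≤ 1 - Real.exp (-t) ∧ 1 - Real.exp (-t) ≤ t := by
  have ha := Real.add_one_le_exp t
  have hb := Real.add_one_le_exp (-t)
  refine ⟨?_, by linarith⟩
  have : Real.exp (-t) ≤ 1 / (t + 1) := by
    rw [Real.exp_neg, ← one_div]
    exact one_div_le_one_div_of_le (by linarith) ha
  have h2 : 1 / (t + 1) ≤ 1 - t / 2 := by
    rw [div_le_iff₀ (by linarith)]
    nlinarith
  linarith

/-- With q close to 1 the fraction has order θ^2/t^3 while |θ| ≤ t and order 1/t beyond; the minimum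
in `decay` records both regimes. -/
lemma decay_le_geometric {t θ : ℝ} (h0 : 0 < t) (h1 : t ≤ 1) (hθ : |θ| ≤ Real.pi) :
    decay t θ / (16 * t) ≤ Real.exp (-t) * (1 + Real.exp (-t)) * (1 - Real.cos θ) /
        ((1 - Real.exp (-t)) * ((1 - Real.exp (-t)) ^ 2 +
          2 * Real.exp (-t) * (1 - Real.cos θ))) := by
  set q := Real.exp (-t) with hq
  set c := 1 - Real.cos θ with hc
  have hq1 : 1 / 3 ≤ q := by
    have : Real.exp (-1) ≤ q := Real.exp_le_exp.mpr (by linarith)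
    have h2 : (1 : ℝ) / 3 ≤ Real.exp (-1) := by
      rw [Real.exp_neg, ← one_div]
      exact one_div_le_one_div_of_le (Real.exp_pos 1) (by linarith [Real.exp_one_lt_d9])
    linarith
  obtain ⟨hd1, hd2⟩ := one_sub_exp_neg_bounds h0 h1
  rw [← hq] at hd1 hd2
  have hd0 : 0 < 1 - q := by linarith
  have hcl : θ ^ 2 / 5 ≤ c := by
    have := Real.cos_le_one_sub_mul_cos_sq hθ
    have h2 : 1 / 5 ≤ 2 / Real.pi ^ 2 := by
      rw [div_le_div_iff₀ (by norm_num) (by positivity)]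
      linarith [pi_sq_le_ten]
    have h3 := mul_le_mul_of_nonneg_right h2 (sq_nonneg θ)
    rw [hc]; linarith
  set m := decay t θ with hm
  have hm0 := decay_nonneg t θ
  have hm1 := decay_le_one t θ
  rw [← hm] at hm0 hm1
  have hcm : t ^ 2 * m / 5 ≤ c := by
    have : m ≤ (θ / t) ^ 2 := min_le_left _ _
    have h2 : t ^ 2 * m ≤ θ ^ 2 := by
      calc t ^ 2 * m ≤ t ^ 2 * (θ / t) ^ 2 := by gcongr
        _ = θ ^ 2 := by field_simp
    linarith
  have hc0 : 0 ≤ c := le_trans (by positivity) hcm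
  have hstep : 4 / 9 * c / (t * (t ^ 2 + 2 * c)) ≤
      q * (1 + q) * c / ((1 - q) * ((1 - q) ^ 2 + 2 * q * c)) := by
    have hqle : q ≤ 1 := by linarith
    have hden : 0 < (1 - q) * ((1 - q) ^ 2 + 2 * q * c) := by positivity
    have hnum : 4 / 9 * c ≤ q * (1 + q) * c := by
      refine mul_le_mul_of_nonneg_right ?_ hc0
      nlinarith
    have hden2 : (1 - q) * ((1 - q) ^ 2 + 2 * q * c) ≤ t * (t ^ 2 + 2 * c) := by
      have : 2 * q * c ≤ 2 * c := by nlinarith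
      gcongr
    exact div_le_div₀ (by positivity) hnum hden hden2
  refine le_trans ?_ hstep
  rw [div_le_div_iff₀ (by positivity) (by positivity)]
  -- The bound t^2 m ≤ 5c and m ≤ 1 give 5c + 2c. This suffices because 16 · 4/9 = 64/9 exceeds 7.
  have key : m * (t ^ 2 + 2 * c) ≤ 7 * c := by nlinarith
  have : 4 / 9 * c * (16 * t) - m * (t * (t ^ 2 + 2 * c)) =
    t * (64 / 9 * c - m * (t ^ 2 + 2 * c)) := by ring
  nlinarith

/-- The mass of the squared part sizes beyond `M` is negligible. -/
def TailSmall (t : ℝ) (M : ℕ) : Prop :=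
  ∑' k : ℕ, ((k + M + 1 : ℕ) : ℝ) ^ 2 * Real.exp (-t) ^ (k + M + 1) ≤ 1

lemma exp_neg_lt_one {t : ℝ} (h0 : 0 < t) : Real.exp (-t) < 1 := by
  rw [Real.exp_lt_one_iff]; linarith

lemma summable_sq_mul_exp {t : ℝ} (h0 : 0 < t) :
    Summable fun k : ℕ => ((k : ℕ) : ℝ) ^ 2 * Real.exp (-t) ^ k :=
  summable_pow_mul_geometric_of_norm_lt_one 2
    (by rw [Real.norm_of_nonneg (Real.exp_pos _).le]; exact exp_neg_lt_one h0)

lemma exists_tailSmall (t : ℝ) (n : ℕ) : ∃ M, n ≤ M ∧ TailSmall t M := by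
  have h := tendsto_sum_nat_add fun k : ℕ => ((k : ℕ) : ℝ) ^ 2 * Real.exp (-t) ^ k
  have h2 := (h.comp (tendsto_add_atTop_nat 1)).eventually (ge_mem_nhds zero_lt_one)
  obtain ⟨M, hM, hM'⟩ := (h2.and (eventually_ge_atTop n)).exists
  exact ⟨M, hM', by simpa [TailSmall, Function.comp_def, add_assoc] using hM⟩

lemma sum_range_ge_tsum_sub_tail {f : ℕ → ℝ} {a s τ : ℝ} {M : ℕ} {g : ℕ → ℝ} (hf : HasSum f s)
    (hg : Summable fun k => g (k + M)) (hgs : ∑' k, g (k + M) ≤ τ)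
    (hle : ∀ k, M ≤ k → f k ≤ a * g k) (ha : 0 ≤ a) :
    s - a * τ ≤ ∑ k ∈ Finset.range M, f k := by
  have h := hf.summable.sum_add_tsum_nat_add M
  rw [hf.tsum_eq] at h
  have h2 : ∑' k, f (k + M) ≤ ∑' k, a * g (k + M) :=
    Summable.tsum_le_tsum (fun k => hle _ (Nat.le_add_left _ _))
      ((summable_nat_add_iff M).mpr hf.summable) (hg.mul_left a)
  rw [tsum_mul_left] at h2
  have := mul_le_mul_of_nonneg_left hgs ha
  linarith

lemma one_sub_cos_le_sq (x : ℝ) : 1 - Real.cos x ≤ x ^ 2 / 2 := by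
  have := Real.one_sub_sq_div_two_le_cos (x := x)
  linarith

lemma summable_tail {t : ℝ} (h0 : 0 < t) (M : ℕ) :
    Summable fun k : ℕ => ((k + M + 1 : ℕ) : ℝ) ^ 2 * Real.exp (-t) ^ (k + M + 1) := by
  simpa [add_assoc] using (summable_nat_add_iff (M + 1)).mpr (summable_sq_mul_exp h0)

/-- With m = `decay t θ`, the sum over all sizes and both colours contributes at least m/(8t).
Truncation at M costs at most θ^2 ≤ 10m, which is at most m/(32t) as t ≤ 1/320, and the indices in J
cost at most m/(32t). What remains is m/(16t). -/
lemma prod_norm_geomChar_le {t θ : ℝ} (h0 : 0 < t) (h1 : t ≤ 1 / 320) (hθ : |θ| ≤ Real.pi)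
    {M : ℕ} (hM : TailSmall t M) (J : Finset (Fin M × Bool))
    (hJ : ∀ i ∈ J, weight M i * t ≤ 1) (hJc : (J.card : ℝ) * (64 * t) ≤ 1) :
    ∏ i ∈ Jᶜ, ‖geomChar (Real.exp (-t) ^ weight M i) (weight M i * θ)‖ ≤
      Real.exp (-(decay t θ / (16 * t))) := by
  set q := Real.exp (-t) with hq
  have hq0 : 0 < q := Real.exp_pos _
  have hq1 : q < 1 := exp_neg_lt_one h0
  set m := decay t θ with hm
  have hm0 : 0 ≤ m := decay_nonneg t θ
  have hp := pow_weight_bounds hq0 hq1 (one_le_weight M)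
  set f : ℕ → ℝ := fun k => q ^ k * (1 - Real.cos (k * θ)) with hf
  have hstep : ∏ i ∈ Jᶜ, ‖geomChar (q ^ weight M i) (weight M i * θ)‖ ≤
      Real.exp (-∑ i ∈ Jᶜ, f (weight M i)) := by
    rw [← Finset.sum_neg_distrib, Real.exp_sum]
    exact Finset.prod_le_prod (fun _ _ => norm_nonneg _)
      fun i _ => norm_geomChar_le_exp (hp i).1 (hp i).2 _
  refine hstep.trans (Real.exp_le_exp.mpr (neg_le_neg ?_))
  have hsum : ∑ i ∈ Jᶜ, f (weight M i) =
      2 * ∑ k ∈ Finset.range M, f (k + 1) - ∑ i ∈ J, f (weight M i) := by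
    rw [← sum_weight, ← Finset.sum_add_sum_compl J]; ring
  have hfull := hasSum_geometric_one_sub_cos hq0.le hq1 θ
  have hG := decay_le_geometric h0 (by linarith) hθ
  rw [← hq, ← hm] at hG
  have htail := sum_range_ge_tsum_sub_tail (M := M) (a := θ ^ 2 / 2)
    (g := fun k => ((k + 1 : ℕ) : ℝ) ^ 2 * q ^ (k + 1)) hfull (summable_tail h0 M) hM
    (fun k _ => by
      have := one_sub_cos_le_sq ((k + 1 : ℕ) * θ)
      calc _ ≤ q ^ (k + 1) * ((((k + 1 : ℕ) : ℝ) * θ) ^ 2 / 2) := by gcongr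
        _ = _ := by ring) (by positivity)
  have hθm : θ ^ 2 ≤ 10 * m := by
    rw [hm, decay, mul_min_of_nonneg _ _ (by norm_num)]
    refine le_min ?_ ?_
    · rw [div_pow, ← mul_div_assoc, le_div_iff₀ (by positivity)]
      have : t ^ 2 ≤ 10 := by nlinarith
      nlinarith [mul_le_mul_of_nonneg_left this (sq_nonneg θ)]
    · rw [← sq_abs]
      have := pi_sq_le_ten
      have := pow_le_pow_left₀ (abs_nonneg θ) hθ 2
      linarith
  have hfJ : ∀ i ∈ J, f (weight M i) ≤ 2 * m := by
    intro i hi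
    have hw := hJ i hi
    have h1 : f (weight M i) ≤ 1 - Real.cos (weight M i * θ) := by
      rw [hf]
      have := Real.cos_le_one (weight M i * θ)
      have h2 := (hp i).2.le
      nlinarith
    refine h1.trans ?_
    rw [hm, decay, mul_min_of_nonneg _ _ (by norm_num)]
    refine le_min ?_ ?_
    · refine (one_sub_cos_le_sq _).trans ?_
      have h3 : (weight M i : ℝ) ≤ 1 / t := by rwa [le_div_iff₀ h0]
      have h4 : (weight M i : ℝ) ^ 2 ≤ (1 / t) ^ 2 := by gcongr
      have h5 := mul_le_mul_of_nonneg_right h4 (sq_nonneg θ)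
      have e : (1 / t) ^ 2 * θ ^ 2 = (θ / t) ^ 2 := by ring
      rw [mul_pow]
      have := sq_nonneg (θ / t)
      linarith
    · have := Real.neg_one_le_cos (weight M i * θ)
      linarith
  have hJsum : ∑ i ∈ J, f (weight M i) ≤ J.card * (2 * m) := by
    rw [← nsmul_eq_mul]
    exact Finset.sum_le_card_nsmul J _ _ hfJ
  have hJ2 : (J.card : ℝ) * (2 * m) ≤ m / (32 * t) := by
    rw [le_div_iff₀ (by positivity)]
    calc (J.card : ℝ) * (2 * m) * (32 * t) = (J.card * (64 * t)) * m := by ring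
      _ ≤ 1 * m := by gcongr
      _ = m := one_mul m
  have h10 : 10 * m ≤ m / (32 * t) := by
    rw [le_div_iff₀ (by positivity)]
    nlinarith
  have e1 : m / (16 * t) = 2 * (m / (32 * t)) := by field_simp; ring
  rw [hsum]
  change _ ≤ ∑ k ∈ Finset.range M, f (k + 1) at htail
  linarith

/-! ### First absolute moment of the characteristic function -/

lemma integral_symm_even {f : ℝ → ℝ} (hf : Continuous f) (he : ∀ x, f (-x) = f x) (a : ℝ) :
    ∫ x in (-a)..a, f x = 2 * ∫ x in (0 : ℝ)..a, f x := by
  rw [← intervalIntegral.integral_add_adjacent_intervals (b := 0)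
    (hf.intervalIntegrable _ _) (hf.intervalIntegrable _ _)]
  have : ∫ x in (-a)..0, f x = ∫ x in (0 : ℝ)..a, f x := by
    have := intervalIntegral.integral_comp_neg (a := 0) (b := a) f
    rw [neg_zero] at this
    rw [← this]
    simp only [he]
  rw [this]; ring

lemma integral_abs_mul_exp_neg_sq_le {b : ℝ} (hb : 0 < b) (a : ℝ) :
    ∫ x in (-a)..a, |x| * Real.exp (-(b * x ^ 2)) ≤ 1 / b := by
  rw [integral_symm_even (f := fun x => |x| * Real.exp (-(b * x ^ 2))) (by fun_prop) (by simp)]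
  rcases le_total 0 a with ha | ha
  · have h1 : ∫ x in (0 : ℝ)..a, |x| * Real.exp (-(b * x ^ 2)) =
        ∫ x in (0 : ℝ)..a, x * Real.exp (-(b * x ^ 2)) := by
      refine intervalIntegral.integral_congr fun x hx => ?_
      rw [Set.uIcc_of_le ha] at hx
      simp only [abs_of_nonneg hx.1]
    have h2 : ∫ x in (0 : ℝ)..a, x * Real.exp (-(b * x ^ 2)) =
        -(1 / (2 * b)) * Real.exp (-(b * a ^ 2)) - -(1 / (2 * b)) * Real.exp (-(b * 0 ^ 2)) := by
      have hc' : Continuous fun x => x * Real.exp (-(b * x ^ 2)) := by fun_prop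
      refine intervalIntegral.integral_eq_sub_of_hasDerivAt
        (f := fun x => -(1 / (2 * b)) * Real.exp (-(b * x ^ 2))) (fun x _ => ?_)
        (hc'.intervalIntegrable _ _)
      have hd : HasDerivAt (fun x : ℝ => -(b * x ^ 2)) (-(b * (2 * x))) x := by
        convert! ((hasDerivAt_pow 2 x).const_mul b).neg using 1
        simp
      convert! (hd.exp.const_mul (-(1 / (2 * b)))) using 1
      field_simp
    rw [h1, h2]
    have := Real.exp_pos (-(b * a ^ 2))
    have h3 : 0 ≤ 1 / (2 * b) * Real.exp (-(b * a ^ 2)) := by positivity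
    have h4 : 1 / b = 2 * (1 / (2 * b)) := by field_simp
    simp only [ne_eq, OfNat.ofNat_ne_zero, not_false_eq_true, zero_pow, mul_zero, neg_zero,
      Real.exp_zero, mul_one]
    linarith
  · have h1 : ∫ x in (0 : ℝ)..a, |x| * Real.exp (-(b * x ^ 2)) ≤ 0 := by
      rw [intervalIntegral.integral_symm, neg_nonpos]
      exact intervalIntegral.integral_nonneg ha fun x _ => by positivity
    have : 0 < 1 / b := by positivity
    linarith

lemma exp_neg_le_div_cube {x : ℝ} (hx : 0 < x) : Real.exp (-x) ≤ 6 / x ^ 3 := by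
  have h := Real.pow_div_factorial_le_exp x hx.le 3
  rw [Real.exp_neg, ← one_div, div_le_div_iff₀ (Real.exp_pos x) (by positivity)]
  norm_num [Nat.factorial] at h
  linarith

/-- The first absolute moment of the characteristic function has order `t ^ 3`. -/
lemma integral_abs_mul_prod_norm_le {t : ℝ} (h0 : 0 < t) (h1 : t ≤ 1 / 320)
    {M : ℕ} (hM : TailSmall t M) (J : Finset (Fin M × Bool))
    (hJ : ∀ i ∈ J, weight M i * t ≤ 1) (hJc : (J.card : ℝ) * (64 * t) ≤ 1) :
    ∫ θ in (-Real.pi)..Real.pi, |θ| *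
      ∏ i ∈ Jᶜ, ‖geomChar (Real.exp (-t) ^ weight M i) (weight M i * θ)‖ ≤
        250000 * t ^ 3 := by
  have hπ := Real.pi_pos
  have hp := pow_weight_bounds (Real.exp_pos (-t)) (exp_neg_lt_one h0) (one_le_weight M)
  set b : ℝ := 1 / (16 * t ^ 3) with hb
  have hb0 : 0 < b := by positivity
  have hle : ∀ θ ∈ Set.Icc (-Real.pi) Real.pi, |θ| *
      ∏ i ∈ Jᶜ, ‖geomChar (Real.exp (-t) ^ weight M i) (weight M i * θ)‖ ≤
      |θ| * Real.exp (-(b * θ ^ 2)) + Real.exp (-(1 / (16 * t))) * |θ| := by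
    intro θ hθ
    have h2 := prod_norm_geomChar_le h0 h1 (abs_le.mpr hθ) hM J hJ hJc
    -- The two values of the minimum give a Gaussian of variance of order t^3 and a constant that is
    -- exponentially small in 1/t; their sum covers both cases.
    have h3 : Real.exp (-(decay t θ / (16 * t))) ≤
        Real.exp (-(b * θ ^ 2)) + Real.exp (-(1 / (16 * t))) := by
      rcases min_choice ((θ / t) ^ 2) 1 with h | h
      · have e : decay t θ / (16 * t) = b * θ ^ 2 := by
          rw [decay, h, hb]; field_simp
        rw [e]; linarith [Real.exp_pos (-(1 / (16 * t)))]
      · rw [decay, h]; linarith [Real.exp_pos (-(b * θ ^ 2))]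
    calc _ ≤ |θ| * (Real.exp (-(b * θ ^ 2)) + Real.exp (-(1 / (16 * t)))) :=
          mul_le_mul_of_nonneg_left (h2.trans h3) (abs_nonneg θ)
      _ = _ := by ring
  have hcont : Continuous fun θ : ℝ => |θ| *
      ∏ i ∈ Jᶜ, ‖geomChar (Real.exp (-t) ^ weight M i) (weight M i * θ)‖ :=
    continuous_abs.mul (continuous_finsetProd _ fun i _ =>
      ((continuous_geomChar (hp i).1 (hp i).2).comp (by fun_prop)).norm)
  have hmono := intervalIntegral.integral_mono_on (μ := MeasureTheory.volume)
    (by linarith : -Real.pi ≤ Real.pi)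
    (hcont.intervalIntegrable _ _) (Continuous.intervalIntegrable (by fun_prop) _ _) hle
  refine hmono.trans ?_
  rw [intervalIntegral.integral_add (Continuous.intervalIntegrable (by fun_prop) _ _)
    (Continuous.intervalIntegrable (by fun_prop) _ _), intervalIntegral.integral_const_mul]
  have i1 := integral_abs_mul_exp_neg_sq_le hb0 Real.pi
  have i2 : ∫ θ in (-Real.pi)..Real.pi, |θ| = Real.pi ^ 2 := by
    rw [integral_symm_even continuous_abs (by simp)]
    have : ∫ x in (0 : ℝ)..Real.pi, |x| = ∫ x in (0 : ℝ)..Real.pi, x := by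
      refine intervalIntegral.integral_congr fun x hx => ?_
      rw [Set.uIcc_of_le hπ.le] at hx
      simp only [abs_of_nonneg hx.1]
    rw [this, integral_id]; ring
  -- The cubic bound turns the constant part into 6 · 16^3 · 10 t^3 = 245760 t^3. With 16 t^3 from
  -- the Gaussian part the total stays below 250000 t^3.
  have i3 := exp_neg_le_div_cube (show 0 < 1 / (16 * t) by positivity)
  have i4 : Real.exp (-(1 / (16 * t))) * Real.pi ^ 2 ≤ 6 / (1 / (16 * t)) ^ 3 * 10 :=
    mul_le_mul i3 pi_sq_le_ten (by positivity) (by positivity)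
  have e1 : 1 / b = 16 * t ^ 3 := by rw [hb]; field_simp
  have e2 : 6 / (1 / (16 * t)) ^ 3 * 10 = 245760 * t ^ 3 := by field_simp; norm_num
  have : 0 < t ^ 3 := by positivity
  rw [i2]
  linarith

/-! ### Mean and moments of the Boltzmann weight -/

/-- The two ways of summing the double series `∑ k q ^ (j k)`. -/
lemma exists_hasSum_lambert {q : ℝ} (h0 : 0 ≤ q) (h1 : q < 1) :
    ∃ S, HasSum (fun k : ℕ => ((k + 1 : ℕ) : ℝ) * (q ^ (k + 1) / (1 - q ^ (k + 1)))) S ∧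
      HasSum (fun j : ℕ => q ^ (j + 1) / (1 - q ^ (j + 1)) ^ 2) S := by
  have hq : ‖q‖ < 1 := by rwa [Real.norm_of_nonneg h0]
  have hlt : ∀ j : ℕ, ‖q ^ (j + 1)‖ < 1 := fun j => by
    rw [Real.norm_of_nonneg (by positivity)]
    exact pow_lt_one₀ h0 h1 (Nat.succ_ne_zero j)
  have hs : Summable fun c : ℕ × ℕ => ((c.2 + 1 : ℕ) : ℝ) * q ^ ((c.1 + 1) * (c.2 + 1)) := by
    have := summable_prod_mul_pow (𝕜 := ℝ) 1 hq
    rw [← (Equiv.pnatEquivNat.symm.prodCongr Equiv.pnatEquivNat.symm).summable_iff] at this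
    simpa [Function.comp_def] using this
  obtain ⟨S, hS⟩ := hs
  have hS' : HasSum (fun c : ℕ × ℕ => ((c.1 + 1 : ℕ) : ℝ) * q ^ ((c.2 + 1) * (c.1 + 1))) S := by
    rw [← (Equiv.prodComm ℕ ℕ).hasSum_iff] at hS
    simpa [Function.comp_def] using hS
  refine ⟨S, hS'.prod_fiberwise fun k => ?_, hS.prod_fiberwise fun j => ?_⟩
  · have h := ((hasSum_geometric_of_norm_lt_one (hlt k)).mul_left (q ^ (k + 1))).mul_left
      ((k + 1 : ℕ) : ℝ)
    convert! h using 2 with j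
    rw [mul_comm (j + 1), pow_mul, pow_succ (q ^ (k + 1)) j]; ring
  · have h := hasSum_coe_mul_geometric_of_norm_lt_one (hlt j)
    rw [← hasSum_nat_add_iff' 1] at h
    convert! h using 1
    · funext k
      rw [pow_mul]
    · simp

/-- This is x/2 ≤ sinh(x/2), multiplied by 2 exp(-x/2) and squared. -/
lemma sq_mul_exp_neg_le {x : ℝ} (hx : 0 ≤ x) :
    x ^ 2 * Real.exp (-x) ≤ (1 - Real.exp (-x)) ^ 2 := by
  have h1 := Real.self_le_sinh_iff.mpr (show 0 ≤ x / 2 by positivity)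
  rw [Real.sinh_eq] at h1
  have h2 : x * Real.exp (-(x / 2)) ≤ 1 - Real.exp (-x) := by
    have e1 : Real.exp (x / 2) * Real.exp (-(x / 2)) = 1 := by rw [← Real.exp_add]; simp
    have e2 : Real.exp (-(x / 2)) * Real.exp (-(x / 2)) = Real.exp (-x) := by
      rw [← Real.exp_add]; congr 1; ring
    have := Real.exp_pos (-(x / 2))
    nlinarith
  have e : x ^ 2 * Real.exp (-x) = (x * Real.exp (-(x / 2))) ^ 2 := by
    rw [mul_pow, ← Real.exp_nat_mul]; congr 2; push_cast; ring
  rw [e]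
  exact pow_le_pow_left₀ (by positivity) h2 2

lemma le_one_add_mul_one_sub_exp_neg (x : ℝ) : x ≤ (1 + x) * (1 - Real.exp (-x)) := by
  have h1 := Real.add_one_le_exp x
  have e1 : Real.exp x * Real.exp (-x) = 1 := by rw [← Real.exp_add]; simp
  have := Real.exp_pos (-x)
  nlinarith

/-- The quotient is 1/(2(cosh x - 1)) = 1/(4 sinh(x/2)^2). For x ≤ 1 the lower bound follows from
cosh x ≤ exp(x^2/2); for x ≥ 1 its left side is not positive. -/
lemma exp_div_one_sub_exp_sq_bounds {x : ℝ} (hx : 0 < x) :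
    Real.exp (-x) / (1 - Real.exp (-x)) ^ 2 ≤ 1 / x ^ 2 ∧
      1 / x ^ 2 - 1 ≤ Real.exp (-x) / (1 - Real.exp (-x)) ^ 2 := by
  have hd : 0 < 1 - Real.exp (-x) := by linarith [exp_neg_lt_one hx]
  constructor
  · rw [div_le_div_iff₀ (by positivity) (by positivity)]
    linarith [sq_mul_exp_neg_le hx.le]
  · rcases le_total 1 x with h | h
    · have : 1 / x ^ 2 ≤ 1 := by
        rw [div_le_one (by positivity)]; nlinarith
      have : 0 ≤ Real.exp (-x) / (1 - Real.exp (-x)) ^ 2 := by positivity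
      linarith
    · set u := x ^ 2 with hu
      have hu0 : 0 < u := by positivity
      have hu1 : u ≤ 1 := by rw [hu]; nlinarith
      have h2 : (1 - Real.exp (-x)) ^ 2 = 2 * Real.exp (-x) * (Real.cosh x - 1) := by
        rw [Real.cosh_eq]
        have e1 : Real.exp x * Real.exp (-x) = 1 := by rw [← Real.exp_add]; simp
        linear_combination (-1 : ℝ) * e1
      have h3 : Real.cosh x ≤ Real.exp (u / 2) := Real.cosh_le_exp_half_sq x
      have h4 : Real.exp (u / 2) * (1 - u / 2) ≤ 1 := by
        have := Real.add_one_le_exp (-(u / 2))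
        have e1 : Real.exp (u / 2) * Real.exp (-(u / 2)) = 1 := by rw [← Real.exp_add]; simp
        have := Real.exp_pos (u / 2)
        nlinarith
      have h5 : 2 * (Real.cosh x - 1) * (1 - u) ≤ u := by
        have h6 : Real.cosh x * (1 - u / 2) ≤ 1 := by nlinarith
        have := Real.one_le_cosh x
        nlinarith
      have e : 1 / u - 1 = (1 - u) / u := by field_simp
      rw [e, div_le_div_iff₀ hu0 (by positivity), h2]
      have := Real.exp_pos (-x)
      nlinarith

/-- The tail of ζ(2) telescopes through 1/(N+1)^2 ≤ 1/N - 1/(N+1). -/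
lemma sum_range_inv_sq_lower (J : ℕ) (hJ : 0 < J) :
    Real.pi ^ 2 / 6 - 1 / J ≤ ∑ j ∈ Finset.range J, 1 / ((j + 1 : ℕ) : ℝ) ^ 2 := by
  have hz := hasSum_zeta_two
  rw [← hasSum_nat_add_iff' 1] at hz
  simp only [Finset.sum_range_one, Nat.cast_zero, ne_eq, OfNat.ofNat_ne_zero, not_false_eq_true,
    zero_pow, div_zero, sub_zero] at hz
  have hmono : ∀ N, J ≤ N → ∑ j ∈ Finset.range N, 1 / ((j + 1 : ℕ) : ℝ) ^ 2 ≤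
      ∑ j ∈ Finset.range J, 1 / ((j + 1 : ℕ) : ℝ) ^ 2 + 1 / (J : ℝ) - 1 / (N : ℝ) := by
    intro N hN
    induction N, hN using Nat.le_induction with
    | base => simp
    | succ N hN ih =>
      rw [Finset.sum_range_succ]
      have hN0 : (0 : ℝ) < N := by exact_mod_cast hJ.trans_le hN
      have : 1 / ((N + 1 : ℕ) : ℝ) ^ 2 ≤ 1 / N - 1 / ((N + 1 : ℕ) : ℝ) := by
        push_cast
        rw [div_sub_div _ _ hN0.ne' (by positivity), div_le_div_iff₀ (by positivity)
          (by positivity)]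
        nlinarith
      linarith
  have := le_of_tendsto hz.tendsto_sum_nat (b := ∑ j ∈ Finset.range J, 1 / ((j + 1 : ℕ) : ℝ) ^ 2 +
    1 / (J : ℝ)) (by
      filter_upwards [eventually_ge_atTop J] with N hN
      have := hmono N hN
      have : (0 : ℝ) ≤ 1 / N := by positivity
      linarith)
  linarith

lemma exp_pow_eq (t : ℝ) (k : ℕ) : Real.exp (-t) ^ k = Real.exp (-(k * t)) := by
  rw [← Real.exp_nat_mul]; congr 1; ring

/-- The mean size of a pair of Boltzmann partitions. -/
lemma abs_mean_sub_le {t : ℝ} (h0 : 0 < t) (h1 : t ≤ 1) {M : ℕ} (hM : TailSmall t M) :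
    |∑ i, weight M i * (Real.exp (-t) ^ weight M i / (1 - Real.exp (-t) ^ weight M i)) -
      Real.pi ^ 2 / (3 * t ^ 2)| ≤ 12 / t := by
  set q := Real.exp (-t) with hq
  have hq0 : 0 < q := Real.exp_pos _
  have hq1 : q < 1 := exp_neg_lt_one h0
  obtain ⟨S, hS1, hS2⟩ := exists_hasSum_lambert hq0.le hq1
  rw [sum_weight M fun k => (k : ℝ) * (q ^ k / (1 - q ^ k))]
  have hx : ∀ j : ℕ, 0 < ((j + 1 : ℕ) : ℝ) * t := fun j => by positivity
  have hpowlt : ∀ k : ℕ, q ^ (k + 1) < 1 := fun k => pow_lt_one₀ hq0.le hq1 (Nat.succ_ne_zero k)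
  -- bounds for the full sum
  have hup : S ≤ Real.pi ^ 2 / (6 * t ^ 2) := by
    have hz := hasSum_zeta_two
    rw [← hasSum_nat_add_iff' 1] at hz
    simp only [Finset.sum_range_one, Nat.cast_zero, ne_eq, OfNat.ofNat_ne_zero,
      not_false_eq_true, zero_pow, div_zero, sub_zero] at hz
    have hz2 := hz.mul_left (1 / t ^ 2)
    have e : Real.pi ^ 2 / (6 * t ^ 2) = 1 / t ^ 2 * (Real.pi ^ 2 / 6) := by field_simp
    rw [e]
    refine hasSum_le (fun j => ?_) hS2 hz2
    rw [hq, exp_pow_eq]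
    refine (exp_div_one_sub_exp_sq_bounds (hx j)).1.trans (le_of_eq ?_)
    field_simp
  have hlow : Real.pi ^ 2 / (6 * t ^ 2) - 3 / t ≤ S := by
    -- The pointwise lower bound loses 1 per term, so at most 2/t over J terms; the discarded ζ(2)
    -- tail costs at most 1/t. A cut at 1/t balances the two.
    set J := ⌈1 / t⌉₊ with hJ
    have hJ0 : 0 < J := Nat.ceil_pos.mpr (by positivity)
    have hJ1 : 1 / t ≤ J := Nat.le_ceil _
    have hJ2 : (J : ℝ) ≤ 1 / t + 1 := (Nat.ceil_lt_add_one (by positivity)).le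
    have hJt : (J : ℝ) ≤ 2 / t := by
      have : 1 ≤ 1 / t := by rw [le_div_iff₀ h0]; linarith
      have e : 2 / t = 1 / t + 1 / t := by ring
      linarith
    have hpart : ∑ j ∈ Finset.range J, (1 / t ^ 2 * (1 / ((j + 1 : ℕ) : ℝ) ^ 2) - 1) ≤ S := by
      refine le_trans (Finset.sum_le_sum fun j _ => ?_)
        (sum_le_hasSum (Finset.range J) (fun j _ => by
          have := hpowlt j
          positivity) hS2)
      rw [hq, exp_pow_eq]
      refine le_trans (le_of_eq ?_) (exp_div_one_sub_exp_sq_bounds (hx j)).2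
      field_simp
    rw [Finset.sum_sub_distrib, ← Finset.mul_sum] at hpart
    simp only [Finset.sum_const, Finset.card_range, nsmul_eq_mul, mul_one] at hpart
    have h4 := mul_le_mul_of_nonneg_left (sum_range_inv_sq_lower J hJ0)
      (show 0 ≤ 1 / t ^ 2 by positivity)
    have h5 : 1 / t ^ 2 * (1 / J) ≤ 1 / t := by
      have hJ' : (0 : ℝ) < J := by exact_mod_cast hJ0
      have : 1 / (J : ℝ) ≤ t := by
        rw [div_le_iff₀ h0] at hJ1
        rw [div_le_iff₀ hJ']; linarith
      calc 1 / t ^ 2 * (1 / J) ≤ 1 / t ^ 2 * t := by gcongr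
        _ = 1 / t := by field_simp
    have e1 : 1 / t ^ 2 * (Real.pi ^ 2 / 6 - 1 / J) =
        Real.pi ^ 2 / (6 * t ^ 2) - 1 / t ^ 2 * (1 / J) := by field_simp
    have e2 : 3 / t = 1 / t + 2 / t := by ring
    linarith
  -- truncation
  have hsum_le : ∑ k ∈ Finset.range M, ((k + 1 : ℕ) : ℝ) * (q ^ (k + 1) / (1 - q ^ (k + 1))) ≤ S :=
    sum_le_hasSum _ (fun k _ => by
      have := hpowlt k
      have : 0 < 1 - q ^ (k + 1) := by linarith
      positivity) hS1
  have hd := (one_sub_exp_neg_bounds h0 h1).1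
  rw [← hq] at hd
  -- The denominators are at least t/2 and k ≤ k^2 for k ≥ 1, so the terms beyond M are dominated by
  -- those in `TailSmall`.
  have htail := sum_range_ge_tsum_sub_tail (M := M) (a := 2 / t)
    (g := fun k => ((k + 1 : ℕ) : ℝ) ^ 2 * q ^ (k + 1)) hS1 (summable_tail h0 M) hM
    (fun k _ => by
      have h2 : t / 2 ≤ 1 - q ^ (k + 1) := by
        have : q ^ (k + 1) ≤ q := pow_le_of_le_one hq0.le hq1.le (Nat.succ_ne_zero k)
        linarith
      have h3 : ((k + 1 : ℕ) : ℝ) ≤ ((k + 1 : ℕ) : ℝ) ^ 2 := by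
        have : (1 : ℝ) ≤ ((k + 1 : ℕ) : ℝ) := by push_cast; linarith [Nat.cast_nonneg (α := ℝ) k]
        nlinarith
      have hpos : 0 < q ^ (k + 1) := by positivity
      have hpos' : 0 ≤ q ^ (k + 1) / (1 - q ^ (k + 1)) := div_nonneg hpos.le (by linarith)
      calc ((k + 1 : ℕ) : ℝ) * (q ^ (k + 1) / (1 - q ^ (k + 1)))
          ≤ ((k + 1 : ℕ) : ℝ) ^ 2 * (q ^ (k + 1) / (t / 2)) := by gcongr
        _ = _ := by field_simp) (by positivity)
  have e3 : Real.pi ^ 2 / (3 * t ^ 2) = 2 * (Real.pi ^ 2 / (6 * t ^ 2)) := by field_simp; norm_num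
  have e4 : 12 / t = 2 * (3 / t) + 2 * (2 / t) + 2 / t := by ring
  have : 0 < 2 / t := by positivity
  rw [abs_le]
  constructor <;> linarith

/-- The inequality x ≤ (1+x)(1-exp(-x)) cancels the singular denominator, and half of the
exponential absorbs the remaining (1+x)^r. -/
lemma pow_mul_exp_div_le {x : ℝ} (hx : 0 < x) (r : ℕ) (hr : 1 ≤ r) :
    x ^ r * (Real.exp (-x) / (1 - Real.exp (-x)) ^ r) ≤ (2 * r) ^ r * Real.exp (-(x / 2)) := by
  have hd : 0 < 1 - Real.exp (-x) := by linarith [exp_neg_lt_one hx]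
  have h1 : x ≤ (1 + x) * (1 - Real.exp (-x)) :=
    le_one_add_mul_one_sub_exp_neg x
  have h2 : x ^ r ≤ (1 + x) ^ r * (1 - Real.exp (-x)) ^ r := by
    rw [← mul_pow]; exact pow_le_pow_left₀ hx.le h1 r
  have hr' : (1 : ℝ) ≤ r := by exact_mod_cast hr
  have h3 : (1 + x) ^ r ≤ (2 * r) ^ r * Real.exp (x / 2) := by
    have h4 : 1 + x ≤ 2 * r * Real.exp (x / (2 * r)) := by
      have := Real.add_one_le_exp (x / (2 * r))
      calc 1 + x ≤ 2 * r * (x / (2 * r) + 1) := by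
            have : 2 * (r : ℝ) * (x / (2 * r) + 1) = x + 2 * r := by field_simp
            linarith
        _ ≤ _ := by gcongr
    calc (1 + x) ^ r ≤ (2 * r * Real.exp (x / (2 * r))) ^ r := pow_le_pow_left₀ (by linarith) h4 r
      _ = _ := by
        rw [mul_pow, ← Real.exp_nat_mul]; congr 2; field_simp
  calc x ^ r * (Real.exp (-x) / (1 - Real.exp (-x)) ^ r)
      ≤ ((1 + x) ^ r * (1 - Real.exp (-x)) ^ r) * (Real.exp (-x) / (1 - Real.exp (-x)) ^ r) := by
        gcongr
    _ = (1 + x) ^ r * Real.exp (-x) := by field_simp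
    _ ≤ (2 * r) ^ r * Real.exp (x / 2) * Real.exp (-x) := by gcongr
    _ = _ := by rw [mul_assoc, ← Real.exp_add]; congr 2; ring

lemma sum_range_exp_half_le {t : ℝ} (h0 : 0 < t) (M : ℕ) :
    ∑ k ∈ Finset.range M, Real.exp (-(((k + 1 : ℕ) : ℝ) * t / 2)) ≤ 2 / t := by
  have h2 : Real.exp (-(t / 2)) < 1 := exp_neg_lt_one (by linarith)
  have hs := (hasSum_geometric_of_lt_one (Real.exp_pos (-(t / 2))).le h2).mul_left
    (Real.exp (-(t / 2)))
  refine (sum_le_hasSum (Finset.range M) (fun k _ => by positivity) hs).trans' ?_ |>.trans ?_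
  · refine Finset.sum_le_sum fun k _ => le_of_eq ?_
    rw [← pow_succ', exp_pow_eq]; congr 1; ring
  · have h3 := Real.add_one_le_exp (t / 2)
    have e1 : Real.exp (t / 2) * Real.exp (-(t / 2)) = 1 := by rw [← Real.exp_add]; simp
    have := Real.exp_pos (-(t / 2))
    rw [← div_eq_mul_inv, div_le_div_iff₀ (by linarith) h0]
    nlinarith

lemma sum_moment_le {t : ℝ} (h0 : 0 < t) (M r : ℕ) (hr : 1 ≤ r) :
    ∑ i, (weight M i : ℝ) ^ r *
      (Real.exp (-t) ^ weight M i / (1 - Real.exp (-t) ^ weight M i) ^ r) ≤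
      4 * (2 * r) ^ r / t ^ (r + 1) := by
  rw [sum_weight M fun k => (k : ℝ) ^ r * (Real.exp (-t) ^ k / (1 - Real.exp (-t) ^ k) ^ r)]
  have hk : ∀ k ∈ Finset.range M, ((k + 1 : ℕ) : ℝ) ^ r *
      (Real.exp (-t) ^ (k + 1) / (1 - Real.exp (-t) ^ (k + 1)) ^ r) ≤
      (2 * r) ^ r / t ^ r * Real.exp (-(((k + 1 : ℕ) : ℝ) * t / 2)) := by
    intro k _
    have h := pow_mul_exp_div_le (show 0 < ((k + 1 : ℕ) : ℝ) * t by positivity) r hr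
    rw [exp_pow_eq, div_mul_eq_mul_div, le_div_iff₀ (by positivity)]
    rw [mul_pow] at h
    linarith
  calc _ ≤ 2 * ((2 * r) ^ r / t ^ r * (2 / t)) := by
        refine mul_le_mul_of_nonneg_left ((Finset.sum_le_sum hk).trans ?_) zero_le_two
        rw [← Finset.mul_sum]
        gcongr
        exact sum_range_exp_half_le h0 M
    _ = _ := by field_simp; ring

/-! ### Gaussian comparison and the local lower bound -/

/-- The left half plane is convex and the derivative of exp has modulus at most 1 there. -/
lemma norm_exp_sub_exp_le {z w : ℂ} (hz : z.re ≤ 0) (hw : w.re ≤ 0) :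
    ‖Complex.exp z - Complex.exp w‖ ≤ ‖z - w‖ := by
  have hconv : Convex ℝ {x : ℂ | x.re ≤ 0} := convex_halfSpace_re_le 0
  have := hconv.norm_image_sub_le_of_norm_hasDerivWithin_le (f := Complex.exp)
    (f' := Complex.exp) (C := 1)
    (fun x _ => (Complex.hasDerivAt_exp x).hasDerivWithinAt)
    (fun x hx => by rw [Complex.norm_exp]; exact Real.exp_le_one_iff.mpr hx) hw hz
  simpa using this

/-- Local comparison of the centred characteristic function with a Gaussian. -/
lemma re_charFun_ge {t : ℝ} (h0 : 0 < t) (h1 : t ≤ 1) {M : ℕ} (hM : TailSmall t M) {n : ℕ}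
    (hn : n * (3 * t ^ 2) = Real.pi ^ 2) (θ : ℝ) :
    Real.exp (-(32 * θ ^ 2 / t ^ 3)) - (7000 * |θ| ^ 3 / t ^ 4 + 12 * |θ| / t) ≤
      ((∏ i, geomChar (Real.exp (-t) ^ weight M i) (weight M i * θ)) *
        Complex.exp (-(I * (n * θ : ℝ)))).re := by
  set q := Real.exp (-t) with hq
  have hq0 : 0 < q := Real.exp_pos _
  have hq1 : q < 1 := exp_neg_lt_one h0
  have hp := pow_weight_bounds hq0 hq1 (one_le_weight M)
  choose L hL1 hL2 hL3 using fun i => exists_log_geomChar (hp i).1 (hp i).2 (weight M i * θ)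
  set μ := ∑ i, weight M i * (q ^ weight M i / (1 - q ^ weight M i)) with hμ
  set V := ∑ i, (weight M i : ℝ) ^ 2 * (q ^ weight M i / (1 - q ^ weight M i) ^ 2) with hV
  set R := ∑ i, (weight M i : ℝ) ^ 3 * (q ^ weight M i / (1 - q ^ weight M i) ^ 3) with hR
  have hmean : |μ - n| ≤ 12 / t := by
    have : (n : ℝ) = Real.pi ^ 2 / (3 * t ^ 2) := by rw [eq_div_iff (by positivity)]; exact hn
    rw [this]
    exact abs_mean_sub_le h0 h1 hM
  have hVle : V ≤ 64 / t ^ 3 := by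
    refine (sum_moment_le h0 M 2 (by norm_num)).trans (le_of_eq ?_)
    norm_num
  have hRle : R ≤ 864 / t ^ 4 := by
    refine (sum_moment_le h0 M 3 (by norm_num)).trans (le_of_eq ?_)
    norm_num
  have hV0 : 0 ≤ V := Finset.sum_nonneg fun i _ => mul_nonneg (by positivity)
    (div_nonneg (hp i).1 (sq_nonneg _))
  set z : ℂ := ∑ i, L i - I * (n * θ : ℝ) with hz
  set w : ℂ := ((-(θ ^ 2 / 2 * V) : ℝ) : ℂ) with hw
  have hprod : (∏ i, geomChar (q ^ weight M i) (weight M i * θ)) *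
        Complex.exp (-(I * (n * θ : ℝ))) = Complex.exp z := by
    rw [hz, sub_eq_add_neg, Complex.exp_add, Complex.exp_sum]
    simp only [hL1]
  have hzre : z.re ≤ 0 := by
    have hre : z.re = ∑ i, (L i).re := by
      rw [hz, Complex.sub_re, Complex.re_sum, Complex.I_mul_re, Complex.ofReal_im]; ring
    rw [hre]
    refine Finset.sum_nonpos fun i _ => (hL3 i).trans ?_
    have := mul_nonneg (hp i).1 (sub_nonneg.mpr (Real.cos_le_one (weight M i * θ)))
    linarith
  have hwre : w.re ≤ 0 := by
    rw [hw, Complex.ofReal_re]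
    have : 0 ≤ θ ^ 2 / 2 * V := by positivity
    linarith
  -- The linear terms of the logarithms combine to i(μ - n)θ and the quadratic ones to w. The
  -- difference is the defect of the mean plus the cubic remainders.
  have hzw : ‖z - w‖ ≤ 8 * |θ| ^ 3 * R + |μ - n| * |θ| := by
    have e : z - w = ∑ i, (L i - I * (weight M i * θ : ℝ) *
        (q ^ weight M i / (1 - q ^ weight M i) : ℝ) + ((weight M i * θ : ℝ) : ℂ) ^ 2 / 2 *
        (q ^ weight M i / (1 - q ^ weight M i) ^ 2 : ℝ)) + I * (((μ - n) * θ : ℝ) : ℂ) := by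
      rw [Finset.sum_add_distrib, Finset.sum_sub_distrib]
      have e1 : ∑ i, I * ((weight M i * θ : ℝ) : ℂ) *
          ((q ^ weight M i / (1 - q ^ weight M i) : ℝ) : ℂ) = I * ((μ * θ : ℝ) : ℂ) := by
        rw [hμ, Finset.sum_mul, Complex.ofReal_sum, Finset.mul_sum]
        refine Finset.sum_congr rfl fun i _ => ?_
        push_cast; ring
      have e2 : ∑ i, ((weight M i * θ : ℝ) : ℂ) ^ 2 / 2 *
          ((q ^ weight M i / (1 - q ^ weight M i) ^ 2 : ℝ) : ℂ) = -w := by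
        rw [hw, hV, Complex.ofReal_neg, neg_neg, Finset.mul_sum, Complex.ofReal_sum]
        refine Finset.sum_congr rfl fun i _ => ?_
        push_cast; ring
      rw [e1, e2, hz]
      push_cast; ring
    rw [e]
    refine (norm_add_le _ _).trans (add_le_add ((norm_sum_le _ _).trans ?_) ?_)
    · rw [hR, Finset.mul_sum]
      refine Finset.sum_le_sum fun i _ => (hL2 i).trans (le_of_eq ?_)
      rw [abs_mul, Nat.abs_cast]; ring
    · rw [norm_mul, Complex.norm_I, one_mul, Complex.norm_real, Real.norm_eq_abs, abs_mul]
  have hfin := norm_exp_sub_exp_le hzre hwre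
  have hre := (Complex.abs_re_le_norm (Complex.exp z - Complex.exp w)).trans (hfin.trans hzw)
  have hwexp : (Complex.exp w).re = Real.exp (-(θ ^ 2 / 2 * V)) := by
    rw [hw, ← Complex.ofReal_exp, Complex.ofReal_re]
  rw [Complex.sub_re, hwexp] at hre
  rw [hprod]
  have h5 : Real.exp (-(32 * θ ^ 2 / t ^ 3)) ≤ Real.exp (-(θ ^ 2 / 2 * V)) := by
    refine Real.exp_le_exp.mpr (neg_le_neg ?_)
    calc θ ^ 2 / 2 * V ≤ θ ^ 2 / 2 * (64 / t ^ 3) := by gcongr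
      _ = _ := by ring
  have h6 : 8 * |θ| ^ 3 * R ≤ 7000 * |θ| ^ 3 / t ^ 4 := by
    calc 8 * |θ| ^ 3 * R ≤ 8 * |θ| ^ 3 * (864 / t ^ 4) := by gcongr
      _ = 6912 * |θ| ^ 3 / t ^ 4 := by ring
      _ ≤ _ := by gcongr; norm_num
  have h7 : |μ - n| * |θ| ≤ 12 * |θ| / t := by
    calc |μ - n| * |θ| ≤ 12 / t * |θ| := by gcongr
      _ = _ := by ring
  have := (abs_le.mp hre).1
  linarith

/-- Three zones: the core |x| ≤ s yields the main term, the zone up to δ costs the uniform error ε,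
and outside δ the first moment controls f. Between s and δ the nonnegative e is dropped. -/
lemma integral_ge_of_local_bounds {f g e : ℝ → ℝ} {a s δ κ ε : ℝ} (hf : Continuous f)
    (hg : Continuous g) (he : Continuous e) (hg0 : ∀ x, 0 ≤ g x) (he0 : ∀ x, 0 ≤ e x)
    (hs : 0 ≤ s) (hsδ : s ≤ δ) (hδ0 : 0 < δ) (hδ : δ ≤ a)
    (hin : ∀ x, |x| ≤ δ → e x - ε ≤ f x) (hes : ∀ x, |x| ≤ s → κ ≤ e x)
    (hout : ∀ x, δ ≤ |x| → |x| ≤ a → -(g x / δ) ≤ f x) :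
    2 * s * κ - 2 * δ * ε - (∫ x in (-a)..a, g x) / δ ≤ ∫ x in (-a)..a, f x := by
  have hfi : ∀ u v, IntervalIntegrable f MeasureTheory.volume u v := fun u v =>
    hf.intervalIntegrable _ _
  have hgi : ∀ u v, IntervalIntegrable g MeasureTheory.volume u v := fun u v =>
    hg.intervalIntegrable _ _
  have hei : ∀ u v, IntervalIntegrable e MeasureTheory.volume u v := fun u v =>
    he.intervalIntegrable _ _
  have hsplit : ∀ h : ℝ → ℝ, (∀ u v, IntervalIntegrable h MeasureTheory.volume u v) →
      ∀ b, ∫ x in (-a)..a, h x =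
        (∫ x in (-a)..(-b), h x) + (∫ x in (-b)..b, h x) + ∫ x in b..a, h x := by
    intro h hh b
    rw [intervalIntegral.integral_add_adjacent_intervals (hh _ _) (hh _ _),
      intervalIntegral.integral_add_adjacent_intervals (hh _ _) (hh _ _)]
  have hgδ : ∀ u v, ∫ x in u..v, -(g x / δ) = -((∫ x in u..v, g x) / δ) := by
    intro u v
    rw [intervalIntegral.integral_neg, intervalIntegral.integral_div]
  have hgneg : Continuous fun x => -(g x / δ) := (hg.div_const δ).neg
  have h1 : -((∫ x in (-a)..(-δ), g x) / δ) ≤ ∫ x in (-a)..(-δ), f x := by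
    rw [← hgδ]
    refine intervalIntegral.integral_mono_on (by linarith) (hgneg.intervalIntegrable _ _)
      (hfi _ _) fun x hx => hout x ?_ ?_
    · rw [abs_of_nonpos (by linarith [hx.2])]; linarith [hx.2]
    · rw [abs_of_nonpos (by linarith [hx.2])]; linarith [hx.1]
  have h2 : -((∫ x in δ..a, g x) / δ) ≤ ∫ x in δ..a, f x := by
    rw [← hgδ]
    refine intervalIntegral.integral_mono_on hδ (hgneg.intervalIntegrable _ _)
      (hfi _ _) fun x hx => hout x ?_ ?_
    · rw [abs_of_nonneg (by linarith [hx.1])]; exact hx.1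
    · rw [abs_of_nonneg (by linarith [hx.1])]; exact hx.2
  have h3 : 2 * s * κ ≤ ∫ x in (-δ)..δ, e x := by
    calc 2 * s * κ = ∫ _ in (-s)..s, κ := by
          rw [intervalIntegral.integral_const, smul_eq_mul]; ring
      _ ≤ ∫ x in (-s)..s, e x := by
          refine intervalIntegral.integral_mono_on (by linarith)
            intervalIntegrable_const (hei _ _) fun x hx => hes x (abs_le.mpr hx)
      _ ≤ ∫ x in (-δ)..δ, e x :=
          intervalIntegral.integral_mono_interval (by linarith) (by linarith) hsδ
            (Eventually.of_forall he0) (hei _ _)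
  have h4 : (∫ x in (-δ)..δ, e x) - 2 * δ * ε ≤ ∫ x in (-δ)..δ, f x := by
    have : ∫ x in (-δ)..δ, (e x - ε) = (∫ x in (-δ)..δ, e x) - 2 * δ * ε := by
      rw [intervalIntegral.integral_sub (hei _ _) intervalIntegrable_const,
        intervalIntegral.integral_const, smul_eq_mul]
      ring
    rw [← this]
    exact intervalIntegral.integral_mono_on (by linarith)
      ((he.sub continuous_const).intervalIntegrable _ _) (hfi _ _)
      fun x hx => hin x (abs_le.mpr hx)
  have h5 : 0 ≤ ∫ x in (-δ)..δ, g x :=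
    intervalIntegral.integral_nonneg (by linarith) fun x _ => hg0 x
  have h6 : (∫ x in (-a)..a, g x) / δ = (∫ x in (-a)..(-δ), g x) / δ +
      (∫ x in (-δ)..δ, g x) / δ + (∫ x in δ..a, g x) / δ := by
    rw [hsplit g hgi δ]; ring
  have h7 : 0 ≤ (∫ x in (-δ)..δ, g x) / δ := div_nonneg h5 hδ0.le
  rw [hsplit f hfi δ]
  linarith

/-- The Boltzmann probability of the size `n` has order at least `t ^ (3/2)`. -/
lemma exists_card_configs_lower : ∃ c > 0, ∃ t₀ > 0, ∀ t : ℝ, 0 < t → t ≤ t₀ →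
    ∀ M : ℕ, TailSmall t M → ∀ n : ℕ, n * (3 * t ^ 2) = Real.pi ^ 2 →
      c * (t * √t) ≤ (configs (weight M) n).card *
        (Real.exp (-t) ^ n * ∏ i, (1 - Real.exp (-t) ^ weight M i)) := by
  set κ := Real.exp (-32) with hκ
  have hκ0 : 0 < κ := Real.exp_pos _
  have hκ1 : κ ≤ 1 := Real.exp_le_one_iff.mpr (by norm_num)
  -- With s = t^(3/2) the main term is 2κs. This A bounds the outer contribution 250000 t^3/(As) by
  -- κs, and D is such that D√t ≤ κ keeps the inner error below κs/2. So κs/2 survives.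
  set A := 250000 / κ with hA
  have hA1 : 1 ≤ A := by rw [hA, le_div_iff₀ hκ0]; linarith
  set D := 4 * A * (7000 * A ^ 3 + 12 * A) with hD
  have hAD : A ≤ D := by
    have : 0 ≤ A ^ 3 := by positivity
    have : 1 ≤ 7000 * A ^ 3 + 12 * A := by linarith
    rw [hD]; nlinarith
  have hD0 : 0 < D := by linarith
  refine ⟨κ / (4 * Real.pi), by positivity, min (1 / 320) ((κ / D) ^ 2), by positivity, ?_⟩
  intro t h0 ht M hM n hn
  have ht1 : t ≤ 1 / 320 := ht.trans (min_le_left _ _)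
  have hsq : √t ≤ κ / D := by
    have := Real.sqrt_le_sqrt (ht.trans (min_le_right _ _))
    rwa [Real.sqrt_sq (by positivity)] at this
  have hsq0 : 0 < √t := Real.sqrt_pos.mpr h0
  have hsqD : D * √t ≤ κ := by rw [le_div_iff₀ hD0] at hsq; linarith
  have hss : √t * √t = t := Real.mul_self_sqrt h0.le
  set q := Real.exp (-t) with hq
  have hq0 : 0 < q := Real.exp_pos _
  have hq1 : q < 1 := exp_neg_lt_one h0
  have hp := pow_weight_bounds hq0 hq1 (one_le_weight M)
  set s := t * √t with hs
  have hs0 : 0 < s := by positivity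
  have hs2 : s ^ 2 = t ^ 3 := by rw [hs, mul_pow, Real.sq_sqrt h0.le]; ring
  set H : ℝ → ℂ := fun θ => (∏ i, geomChar (q ^ weight M i) (weight M i * θ)) *
    Complex.exp (-(I * (n * θ : ℝ))) with hH
  set g : ℝ → ℝ := fun θ => |θ| *
    ∏ i ∈ (∅ : Finset (Fin M × Bool))ᶜ, ‖geomChar (q ^ weight M i) (weight M i * θ)‖ with hg
  have cgeom : ∀ i, Continuous fun θ : ℝ => geomChar (q ^ weight M i) (weight M i * θ) := fun i =>
    (continuous_geomChar (hp i).1 (hp i).2).comp (by fun_prop)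
  have cH : Continuous H :=
    Continuous.mul (continuous_finsetProd _ fun i _ => cgeom i) (by fun_prop)
  have cg : Continuous g :=
    continuous_abs.mul (continuous_finsetProd _ fun i _ => (cgeom i).norm)
  have hgint := integral_abs_mul_prod_norm_le h0 ht1 hM ∅ (by simp) (by simp)
  have hnormH : ∀ θ, |θ| * ‖H θ‖ = g θ := by
    intro θ
    have : ‖Complex.exp (-(I * (n * θ : ℝ)))‖ = 1 := by
      rw [← mul_neg, ← Complex.ofReal_neg, norm_exp_I_mul]
    simp only [hH, hg, norm_mul, this, mul_one, norm_prod, Finset.compl_empty]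
  have hδπ : A * s ≤ Real.pi := by
    have h1 : A * √t ≤ 1 := by
      calc A * √t ≤ D * √t := by gcongr
        _ ≤ 1 := by linarith
    have : A * s = t * (A * √t) := by rw [hs]; ring
    rw [this]
    nlinarith [Real.pi_gt_three]
  have hmain := integral_ge_of_local_bounds (f := fun θ => (H θ).re) (g := g)
    (e := fun θ => Real.exp (-(32 * θ ^ 2 / t ^ 3))) (a := Real.pi) (s := s) (δ := A * s) (κ := κ)
    (ε := (7000 * A ^ 3 + 12 * A) * √t) (Complex.continuous_re.comp cH) cg (by fun_prop)
    (fun x => by positivity) (fun x => by positivity) hs0.le (by nlinarith) (by positivity) hδπ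
    (by
      intro θ hθ
      have h1 := re_charFun_ge h0 (by linarith) hM hn θ
      have h2 : 7000 * |θ| ^ 3 / t ^ 4 + 12 * |θ| / t ≤ (7000 * A ^ 3 + 12 * A) * √t := by
        have e1 : 7000 * (A * s) ^ 3 / t ^ 4 = 7000 * A ^ 3 * √t := by
          have : s ^ 3 = t ^ 4 * √t := by
            rw [show s ^ 3 = s ^ 2 * s by ring, hs2, hs]; ring
          rw [mul_pow, this]; field_simp
        have e2 : 12 * (A * s) / t = 12 * A * √t := by rw [hs]; field_simp
        calc 7000 * |θ| ^ 3 / t ^ 4 + 12 * |θ| / t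
            ≤ 7000 * (A * s) ^ 3 / t ^ 4 + 12 * (A * s) / t := by gcongr
          _ = _ := by rw [e1, e2]; ring
      linarith)
    (by
      intro θ hθ
      refine Real.exp_le_exp.mpr (neg_le_neg ?_)
      rw [div_le_iff₀ (by positivity), ← hs2, ← sq_abs θ]
      gcongr)
    (by
      intro θ hθ _
      have h1 := (abs_le.mp (Complex.abs_re_le_norm (H θ))).1
      have h2 : ‖H θ‖ ≤ g θ / (A * s) := by
        rw [le_div_iff₀ (by positivity), ← hnormH]
        nlinarith [norm_nonneg (H θ)]
      linarith)
  have hF := card_boxConfigs_fourier (one_le_weight M) n ∅ (fun _ => 0) hq0 hq1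
  rw [boxConfigs_empty] at hF
  simp only [Finset.notMem_empty, if_false] at hF
  have hre : ((configs (weight M) n).card : ℝ) * (q ^ n * ∏ i, (1 - q ^ weight M i)) =
      1 / (2 * Real.pi) * ∫ θ in (-Real.pi)..Real.pi, (H θ).re := by
    have h1 : (∫ θ in (-Real.pi)..Real.pi, (H θ).re) = (∫ θ in (-Real.pi)..Real.pi, H θ).re :=
      Complex.reCLM.intervalIntegral_comp_comm (cH.intervalIntegrable _ _)
    have h2 : ((1 / (2 * Real.pi) : ℝ) : ℂ) = 1 / (2 * Real.pi) := by push_cast; rfl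
    rw [h1, ← Complex.re_ofReal_mul, ← Complex.ofReal_re (_ * _), hF, h2]
  rw [hre]
  have hlast : (∫ x in (-Real.pi)..Real.pi, g x) / (A * s) ≤ κ * s := by
    rw [div_le_iff₀ (by positivity)]
    refine hgint.trans (le_of_eq ?_)
    rw [← hs2, hA]; field_simp
  have hmid : 2 * (A * s) * ((7000 * A ^ 3 + 12 * A) * √t) ≤ κ * s / 2 := by
    have : 2 * (A * s) * ((7000 * A ^ 3 + 12 * A) * √t) = (D * √t) * s / 2 := by rw [hD]; ring
    rw [this]
    gcongr
  have hfin : κ * s / 2 ≤ ∫ θ in (-Real.pi)..Real.pi, (H θ).re := by linarith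
  calc κ / (4 * Real.pi) * s = 1 / (2 * Real.pi) * (κ * s / 2) := by field_simp; norm_num
    _ ≤ _ := by gcongr

/-! ### Near independence of the small multiplicities -/

/-- With x = kt this is x exp(-x) ≤ 1 - exp(-x). Every part size costs at most 1/t, so only the
number of constrained parts enters the error. -/
lemma weight_mul_geometric_le {t : ℝ} (h0 : 0 < t) {k : ℕ} (hk : 1 ≤ k) :
    (k : ℝ) * (Real.exp (-t) ^ k / (1 - Real.exp (-t) ^ k)) ≤ 1 / t := by
  have hk' : (0 : ℝ) < k := by exact_mod_cast hk
  have hx : 0 < (k : ℝ) * t := by positivity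
  rw [exp_pow_eq]
  set x := (k : ℝ) * t with hxd
  have hd : 0 < 1 - Real.exp (-x) := by linarith [exp_neg_lt_one hx]
  have h1 := Real.add_one_le_exp x
  have e1 : Real.exp x * Real.exp (-x) = 1 := by rw [← Real.exp_add]; simp
  have h2 : x * Real.exp (-x) ≤ 1 - Real.exp (-x) := by nlinarith [Real.exp_pos (-x)]
  rw [← mul_div_assoc, div_le_div_iff₀ hd h0]
  have : (k : ℝ) * Real.exp (-x) * t = x * Real.exp (-x) := by rw [hxd]; ring
  linarith

lemma partitionFactor_pos {ι : Type*} [Fintype ι] {q : ℝ} (hq0 : 0 < q) (hq1 : q < 1)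
    {w : ι → ℕ} (hw : ∀ i, 1 ≤ w i) (n : ℕ) : 0 < q ^ n * ∏ i, (1 - q ^ w i) :=
  mul_pos (by positivity)
    (Finset.prod_pos fun i _ => by linarith [(pow_weight_bounds hq0 hq1 hw i).2])

/-- Under the uniform measure on pairs of partitions, the multiplicities of few small parts are
close to independent geometric variables. -/
lemma exists_box_estimate : ∃ C > 0, ∃ t₀ > 0, ∀ t : ℝ, 0 < t → t ≤ t₀ →
    ∀ M : ℕ, TailSmall t M → ∀ n : ℕ, n * (3 * t ^ 2) = Real.pi ^ 2 →
      0 < (configs (weight M) n).card ∧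
      ∀ (J : Finset (Fin M × Bool)) (b : Fin M × Bool → ℕ),
        (∀ i ∈ J, weight M i * t ≤ 1) → (J.card : ℝ) * (64 * t) ≤ 1 →
        |((boxConfigs (weight M) n J b).card : ℝ) - (configs (weight M) n).card *
          ∏ i ∈ J, (1 - (Real.exp (-t) ^ weight M i) ^ b i)| ≤
          C * J.card * √t * (configs (weight M) n).card := by
  obtain ⟨c, hc, t₀, ht₀, hlow⟩ := exists_card_configs_lower
  refine ⟨250000 / c, by positivity, min t₀ (1 / 320), by positivity, ?_⟩
  intro t h0 ht M hM n hn
  have hl := hlow t h0 (ht.trans (min_le_left _ _)) M hM n hn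
  have ht1 : t ≤ 1 / 320 := ht.trans (min_le_right _ _)
  have hq0 : 0 < Real.exp (-t) := Real.exp_pos _
  have hq1 := exp_neg_lt_one h0
  have hZ := partitionFactor_pos hq0 hq1 (one_le_weight M) n
  set Z := Real.exp (-t) ^ n * ∏ i, (1 - Real.exp (-t) ^ weight M i) with hZd
  have hsq0 : 0 < √t := Real.sqrt_pos.mpr h0
  constructor
  · rw [Nat.pos_iff_ne_zero]
    intro h
    rw [h] at hl
    have : 0 < c * (t * √t) := by positivity
    simp only [Nat.cast_zero, zero_mul] at hl
    linarith
  · intro J b hJ hJc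
    have h1 := abs_card_boxConfigs_sub_le (one_le_weight M) n J b hq0 hq1
    have h2 := integral_abs_mul_prod_norm_le h0 ht1 hM J hJ hJc
    have h3 : ∑ i ∈ J, weight M i * (Real.exp (-t) ^ weight M i /
        (1 - Real.exp (-t) ^ weight M i)) ≤ J.card * (1 / t) := by
      rw [← nsmul_eq_mul]
      exact Finset.sum_le_card_nsmul J _ _ fun i _ =>
        weight_mul_geometric_le h0 (one_le_weight M i)
    have h4 := h1.trans (mul_le_mul_of_nonneg_right h3 (intervalIntegral.integral_nonneg
      (by linarith [Real.pi_pos]) fun x _ => mul_nonneg (abs_nonneg x)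
        (Finset.prod_nonneg fun _ _ => norm_nonneg _)))
    have h5 := h4.trans (mul_le_mul_of_nonneg_left h2
      (show 0 ≤ (J.card : ℝ) * (1 / t) by positivity))
    refine le_of_mul_le_mul_right (h5.trans ?_) hZ
    have hss : √t * √t = t := Real.mul_self_sqrt h0.le
    -- The absolute error |J| t^2 is measured against the lower bound c t^(3/2) for the probability
    -- of weight n; a factor √t is gained.
    calc (J.card : ℝ) * (1 / t) * (250000 * t ^ 3) = J.card * 250000 * t ^ 2 := by field_simp
      _ = 250000 / c * J.card * √t * (c * (t * √t)) := by
          have : t ^ 2 = t * (√t * √t) := by rw [hss]; ring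
          rw [this]; field_simp
      _ ≤ 250000 / c * J.card * √t * ((configs (weight M) n).card * Z) := by gcongr
      _ = _ := by ring

/-! ### Rarity of pairs with small parts only -/

/-- The left side is the Boltzmann probability that the weight is n and no part of J occurs.
Forgetting the weight leaves ∏(1 - q^w) over J; on the Fourier side, a factor truncated at 1 is the
constant 1 - q^w. -/
lemma card_boxConfigs_one_le {ι : Type*} [Fintype ι] [DecidableEq ι] {w : ι → ℕ}
    (hw : ∀ i, 1 ≤ w i) (n : ℕ) (J : Finset ι) {q : ℝ} (hq0 : 0 < q) (hq1 : q < 1) :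
    ((boxConfigs w n J fun _ => 1).card : ℝ) * (q ^ n * ∏ i, (1 - q ^ w i)) ≤
      Real.exp (-∑ i ∈ J, q ^ w i) := by
  have hp := pow_weight_bounds hq0 hq1 hw
  have hF := card_boxConfigs_fourier hw n J (fun _ => 1) hq0 hq1
  have hpos := partitionFactor_pos hq0 hq1 hw n
  have hexp : ∏ i ∈ J, (1 - q ^ w i) ≤ Real.exp (-∑ i ∈ J, q ^ w i) := by
    rw [← Finset.sum_neg_distrib, Real.exp_sum]
    refine Finset.prod_le_prod (fun i _ => by linarith [(hp i).2]) fun i _ => ?_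
    linarith [Real.add_one_le_exp (-(q ^ w i))]
  refine le_trans ?_ hexp
  have hptw : ∀ θ ∈ Set.uIoc (-Real.pi) Real.pi,
      ‖(∏ i, if i ∈ J then truncChar (q ^ w i) 1 (w i * θ) else geomChar (q ^ w i) (w i * θ)) *
        Complex.exp (-(I * (n * θ : ℝ)))‖ ≤ ∏ i ∈ J, (1 - q ^ w i) := by
    intro θ _
    have h1 : ‖Complex.exp (-(I * (n * θ : ℝ)))‖ = 1 := by
      rw [← mul_neg, ← Complex.ofReal_neg, norm_exp_I_mul]
    rw [norm_mul, h1, mul_one, norm_prod, ← Finset.prod_mul_prod_compl J]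
    have h2 : ∏ i ∈ Jᶜ, ‖if i ∈ J then truncChar (q ^ w i) 1 (w i * θ) else
        geomChar (q ^ w i) (w i * θ)‖ ≤ 1 := by
      refine Finset.prod_le_one (fun _ _ => norm_nonneg _) fun i hi => ?_
      rw [if_neg (Finset.mem_compl.mp hi)]
      exact norm_geomChar_le_one (hp i).1 (hp i).2 _
    have h3 : ∏ i ∈ J, ‖if i ∈ J then truncChar (q ^ w i) 1 (w i * θ) else
        geomChar (q ^ w i) (w i * θ)‖ = ∏ i ∈ J, (1 - q ^ w i) := by
      refine Finset.prod_congr rfl fun i hi => ?_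
      rw [if_pos hi, truncChar]
      simp only [Finset.sum_range_one, pow_zero, mul_one]
      rw [← Complex.ofReal_one, ← Complex.ofReal_sub, Complex.norm_real,
        Real.norm_of_nonneg (by linarith [(hp i).2])]
    rw [h3]
    exact mul_le_of_le_one_right (Finset.prod_nonneg fun i _ => by linarith [(hp i).2]) h2
  have hint := intervalIntegral.norm_integral_le_of_norm_le_const hptw
  have hπ := Real.pi_pos
  have h5 : |((boxConfigs w n J fun _ => 1).card : ℝ) * (q ^ n * ∏ i, (1 - q ^ w i))| ≤
      ∏ i ∈ J, (1 - q ^ w i) := by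
    rw [← Real.norm_eq_abs, ← Complex.norm_real, hF, norm_mul]
    have hn : ‖(1 / (2 * Real.pi) : ℂ)‖ = 1 / (2 * Real.pi) := by
      rw [show (1 / (2 * Real.pi) : ℂ) = ((1 / (2 * Real.pi) : ℝ) : ℂ) by push_cast; rfl,
        Complex.norm_real, Real.norm_of_nonneg (by positivity)]
    rw [hn]
    calc _ ≤ 1 / (2 * Real.pi) * ((∏ i ∈ J, (1 - q ^ w i)) * |Real.pi - -Real.pi|) := by gcongr
      _ = _ := by
        rw [abs_of_pos (by linarith)]; field_simp; ring
  exact (le_abs_self _).trans h5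

lemma exp_neg_le_div_pow_four {x : ℝ} (hx : 0 < x) : Real.exp (-x) ≤ 24 / x ^ 4 := by
  have h := Real.pow_div_factorial_le_exp x hx.le 4
  rw [Real.exp_neg, ← one_div, div_le_div_iff₀ (Real.exp_pos x) (by positivity)]
  norm_num [Nat.factorial] at h
  linarith

/-- Pairs of partitions all of whose parts are at most `k` are rare. -/
lemma exists_small_parts_estimate : ∃ C > 0, ∃ t₀ > 0, ∀ t : ℝ, 0 < t → t ≤ t₀ →
    ∀ M : ℕ, TailSmall t M → ∀ n : ℕ, n * (3 * t ^ 2) = Real.pi ^ 2 → ∀ k : ℕ, 2 * k ≤ M →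
      Real.log (1 / t) / (4 * t) ≤ k → (k : ℝ) ≤ Real.log (1 / t) / (4 * t) + 1 →
      ((boxConfigs (weight M) n (Finset.univ.filter fun i => k < weight M i) fun _ => 1).card : ℝ)
        ≤ C * √t * (configs (weight M) n).card := by
  obtain ⟨c, hc, t₀, ht₀, hlow⟩ := exists_card_configs_lower
  refine ⟨24 * 16 ^ 4 / c, by positivity, min t₀ (Real.exp (-4)), by positivity, ?_⟩
  intro t h0 ht M hM n hn k hkM hk1 hk2
  have hl := hlow t h0 (ht.trans (min_le_left _ _)) M hM n hn
  have ht4 : t ≤ Real.exp (-4) := ht.trans (min_le_right _ _)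
  have hq0 : 0 < Real.exp (-t) := Real.exp_pos _
  have hq1 := exp_neg_lt_one h0
  have hZ := partitionFactor_pos hq0 hq1 (one_le_weight M) n
  have hcard := card_boxConfigs_one_le (one_le_weight M) n
    (Finset.univ.filter fun i => k < weight M i) hq0 hq1
  set Z := Real.exp (-t) ^ n * ∏ i, (1 - Real.exp (-t) ^ weight M i) with hZd
  have hsq0 : 0 < √t := Real.sqrt_pos.mpr h0
  have hss : √t * √t = t := Real.mul_self_sqrt h0.le
  have hlog : 4 ≤ Real.log (1 / t) := by
    rw [one_div, Real.log_inv]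
    have := Real.log_le_log h0 ht4
    rw [Real.log_exp] at this
    linarith
  have hk3 : 1 / t ≤ k := by
    refine le_trans ?_ hk1
    rw [div_le_div_iff₀ h0 (by positivity)]
    nlinarith
  -- By the upper bound on k, 2kt ≤ log(1/t)/2 + 2t, so q^(2k) is at least √t exp(-2), and exp 2 <
  -- 8.
  have hpow : √t / 8 ≤ Real.exp (-t) ^ (2 * k) := by
    have h8 : (1 : ℝ) / 8 ≤ Real.exp (-2) := by
      rw [Real.exp_neg, ← one_div]
      refine one_div_le_one_div_of_le (Real.exp_pos 2) ?_
      have : Real.exp 2 = Real.exp 1 * Real.exp 1 := by rw [← Real.exp_add]; norm_num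
      have := Real.exp_one_lt_d9
      have := Real.exp_pos 1
      nlinarith
    have hst : √t = Real.exp (-(Real.log (1 / t) / 2)) := by
      rw [one_div, Real.log_inv, Real.sqrt_eq_rpow, Real.rpow_def_of_pos h0]
      congr 1; ring
    have ht1 : t ≤ 1 := ht4.trans (Real.exp_le_one_iff.mpr (by norm_num))
    calc √t / 8 = √t * (1 / 8) := by ring
      _ ≤ √t * Real.exp (-2) := by gcongr
      _ = Real.exp (-(Real.log (1 / t) / 2) + -2) := by rw [Real.exp_add, ← hst]
      _ ≤ _ := by
        rw [exp_pow_eq]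
        refine Real.exp_le_exp.mpr ?_
        push_cast
        have : (k : ℝ) * t ≤ (Real.log (1 / t) / (4 * t) + 1) * t := by gcongr
        have e : (Real.log (1 / t) / (4 * t) + 1) * t = Real.log (1 / t) / 4 + t := by field_simp
        linarith
  -- Sizes in (k, 2k] suffice: there are k ≥ 1/t of them, in two colours, each contributing at least
  -- √t/8.
  have hsum : 1 / (4 * √t) ≤
      ∑ i ∈ Finset.univ.filter (fun i => k < weight M i), Real.exp (-t) ^ weight M i := by
    rw [Finset.sum_filter,
      sum_weight M fun j => if k < j then Real.exp (-t) ^ j else 0]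
    have hsub : Finset.Ico k (2 * k) ⊆ Finset.range M := by
      intro j hj
      rw [Finset.mem_Ico] at hj
      rw [Finset.mem_range]; omega
    have h1 : (k : ℝ) * (√t / 8) ≤
        ∑ j ∈ Finset.range M, if k < j + 1 then Real.exp (-t) ^ (j + 1) else 0 := by
      calc (k : ℝ) * (√t / 8) = ∑ _j ∈ Finset.Ico k (2 * k), √t / 8 := by
            rw [Finset.sum_const, Nat.card_Ico, nsmul_eq_mul]
            congr 2; omega
        _ ≤ ∑ j ∈ Finset.Ico k (2 * k), if k < j + 1 then Real.exp (-t) ^ (j + 1) else 0 := by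
            refine Finset.sum_le_sum fun j hj => ?_
            rw [Finset.mem_Ico] at hj
            rw [if_pos (by omega)]
            exact hpow.trans (pow_le_pow_of_le_one hq0.le hq1.le (by omega))
        _ ≤ _ := Finset.sum_le_sum_of_subset_of_nonneg hsub fun j _ _ => by
            split_ifs <;> positivity
    have h2 : 1 / (8 * √t) ≤ (k : ℝ) * (√t / 8) := by
      calc 1 / (8 * √t) = 1 / (√t * √t) * (√t / 8) := by field_simp
        _ = 1 / t * (√t / 8) := by rw [hss]
        _ ≤ _ := by gcongr
    have e : 1 / (4 * √t) = 2 * (1 / (8 * √t)) := by field_simp; norm_num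
    rw [e]
    linarith
  -- The fourth power makes the bound O(t^2), which still gains √t after division by t^(3/2).
  have hexp : Real.exp (-∑ i ∈ Finset.univ.filter (fun i => k < weight M i),
      Real.exp (-t) ^ weight M i) ≤ 24 * 16 ^ 4 * (t * t) := by
    refine (Real.exp_le_exp.mpr (neg_le_neg hsum)).trans
      ((exp_neg_le_div_pow_four (by positivity)).trans ?_)
    have e : 24 / (1 / (4 * √t)) ^ 4 = 24 * 4 ^ 4 * ((√t * √t) * (√t * √t)) := by field_simp
    rw [e, hss]
    have : 0 ≤ t * t := by positivity
    linarith
  refine le_of_mul_le_mul_right ((hcard.trans hexp).trans ?_) hZ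
  calc 24 * 16 ^ 4 * (t * t) = 24 * 16 ^ 4 / c * √t * (c * (t * √t)) := by
        have : t * t = t * √t * √t := by rw [mul_assoc, hss]
        rw [this]; field_simp
    _ ≤ 24 * 16 ^ 4 / c * √t * ((configs (weight M) n).card * Z) := by gcongr
    _ = _ := by ring

/-! ### Colour symmetry and ties for the largest part -/

section Top

variable {M : ℕ}

/-- The largest part occurring in a configuration. -/
def topPart (a : Fin M × Bool → ℕ) : ℕ := (Finset.univ.filter fun i => a i ≠ 0).sup (weight M)

/-- The largest part occurs in the colour `c`. -/
def Leads (a : Fin M × Bool → ℕ) (c : Bool) : Prop :=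
  ∃ k : Fin M, (k : ℕ) + 1 = topPart a ∧ a (k, c) ≠ 0

lemma weight_le_topPart {a : Fin M × Bool → ℕ} {i : Fin M × Bool} (h : a i ≠ 0) :
    weight M i ≤ topPart a :=
  Finset.le_sup (f := weight M) (by simpa using h)

lemma topPart_le_iff {a : Fin M × Bool → ℕ} {K : ℕ} :
    topPart a ≤ K ↔ ∀ i, a i ≠ 0 → weight M i ≤ K := by
  simp [topPart, Finset.sup_le_iff]

lemma topPart_eq {a : Fin M × Bool → ℕ} {i : Fin M × Bool} (h : a i ≠ 0)
    (hmax : ∀ j, a j ≠ 0 → weight M j ≤ weight M i) : topPart a = weight M i :=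
  le_antisymm (topPart_le_iff.mpr hmax) (weight_le_topPart h)

lemma exists_leads {a : Fin M × Bool → ℕ} (h : ∃ i, a i ≠ 0) : ∃ c, Leads a c := by
  obtain ⟨i, hi⟩ := h
  obtain ⟨j, hj, hj'⟩ := Finset.exists_mem_eq_sup (Finset.univ.filter fun i => a i ≠ 0)
    ⟨i, by simpa using hi⟩ (weight M)
  exact ⟨j.2, j.1, hj'.symm, by simpa using hj⟩

lemma exists_ne_zero_of_mem {n : ℕ} (hn : 0 < n) {a : Fin M × Bool → ℕ}
    (ha : a ∈ configs (weight M) n) : ∃ i, a i ≠ 0 := by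
  rw [mem_configs (one_le_weight M)] at ha
  by_contra! h
  simp [h] at ha
  omega

/-- Exchange the two colours for all parts larger than `K`. -/
def swapAbove (K : ℕ) (a : Fin M × Bool → ℕ) : Fin M × Bool → ℕ :=
  fun i => if weight M i ≤ K then a i else a (i.1, !i.2)

lemma weight_not (i : Fin M × Bool) : weight M (i.1, !i.2) = weight M i := rfl

lemma swapAbove_swapAbove (K : ℕ) (a : Fin M × Bool → ℕ) : swapAbove K (swapAbove K a) = a := by
  funext i
  unfold swapAbove
  by_cases h : weight M i ≤ K
  · simp [h]
  · simp [h, weight_not]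

lemma sum_swapAbove (K : ℕ) (a : Fin M × Bool → ℕ) :
    ∑ i, weight M i * swapAbove K a i = ∑ i, weight M i * a i := by
  rw [Fintype.sum_prod_type, Fintype.sum_prod_type]
  refine Finset.sum_congr rfl fun k _ => ?_
  simp only [Fintype.sum_bool, swapAbove, weight]
  by_cases h : (k : ℕ) + 1 ≤ K
  · simp [h]
  · simp only [h, if_false, Bool.not_true, Bool.not_false]; ring

lemma topPart_swapAbove {K : ℕ} {a : Fin M × Bool → ℕ} (h : K < topPart a) :
    topPart (swapAbove K a) = topPart a := by
  have hne : ∃ i, a i ≠ 0 := by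
    by_contra! h0
    have : topPart a ≤ 0 := topPart_le_iff.mpr fun i hi => absurd (h0 i) hi
    omega
  obtain ⟨c, k, hk, hkc⟩ := exists_leads hne
  have hs : swapAbove K a (k, !c) ≠ 0 := by
    have : ¬ weight M (k, !c) ≤ K := by simp only [weight]; omega
    simpa [swapAbove, this] using hkc
  rw [topPart_eq hs, ← hk]
  · rfl
  · intro j hj
    have h1 : weight M j ≤ topPart a := by
      unfold swapAbove at hj
      split_ifs at hj
      · exact weight_le_topPart hj
      · rw [← weight_not]; exact weight_le_topPart hj
    simpa [weight, hk] using h1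

lemma leads_swapAbove {K : ℕ} {a : Fin M × Bool → ℕ} (h : K < topPart a) {c : Bool}
    (hl : Leads a c) : Leads (swapAbove K a) (!c) := by
  obtain ⟨k, hk, hkc⟩ := hl
  refine ⟨k, by rw [topPart_swapAbove h, hk], ?_⟩
  have : ¬ weight M (k, !c) ≤ K := by simp only [weight]; omega
  simpa [swapAbove, this] using hkc

lemma swapAbove_mem_boxConfigs {n K : ℕ} {J : Finset (Fin M × Bool)} {b : Fin M × Bool → ℕ}
    (hJ : ∀ i ∈ J, weight M i ≤ K) {a : Fin M × Bool → ℕ} (ha : a ∈ boxConfigs (weight M) n J b) :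
    swapAbove K a ∈ boxConfigs (weight M) n J b := by
  simp only [boxConfigs, Finset.mem_filter, mem_configs (one_le_weight M)] at ha ⊢
  refine ⟨by rw [sum_swapAbove]; exact ha.1, fun i hi => ?_⟩
  simpa [swapAbove, hJ i hi] using ha.2 i hi

/-- Configurations with all parts at most `K`. -/
def smallConfigs (M n K : ℕ) : Finset (Fin M × Bool → ℕ) :=
  boxConfigs (weight M) n (Finset.univ.filter fun i => K < weight M i) fun _ => 1

lemma mem_smallConfigs {n K : ℕ} {a : Fin M × Bool → ℕ} :
    a ∈ smallConfigs M n K ↔ a ∈ configs (weight M) n ∧ topPart a ≤ K := by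
  simp only [smallConfigs, boxConfigs, Finset.mem_filter, Finset.mem_univ, true_and,
    topPart_le_iff, Nat.lt_one_iff]
  refine and_congr_right fun _ => forall_congr' fun i => ?_
  rw [← not_le, not_imp_comm]

open Classical in
/-- Configurations whose largest part occurs in both colours. -/
noncomputable def tieConfigs (M n : ℕ) : Finset (Fin M × Bool → ℕ) :=
  (configs (weight M) n).filter fun a => Leads a false ∧ Leads a true

-- `swapAbove K` is an involution of the box. Once the largest part exceeds K, it keeps that part
-- and exchanges the leading colours.
open Classical in
lemma card_leads_swap {n K : ℕ} {J : Finset (Fin M × Bool)} {b : Fin M × Bool → ℕ}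
    (hJ : ∀ i ∈ J, weight M i ≤ K) :
    ((boxConfigs (weight M) n J b).filter fun a => Leads a false ∧ K < topPart a).card =
      ((boxConfigs (weight M) n J b).filter fun a => Leads a true ∧ K < topPart a).card := by
  refine Finset.card_nbij' (swapAbove K) (swapAbove K) ?_ ?_
    (fun a _ => swapAbove_swapAbove K a) (fun a _ => swapAbove_swapAbove K a)
  · intro a ha
    simp only [Finset.coe_filter, Set.mem_ofPred_eq] at ha ⊢
    exact ⟨swapAbove_mem_boxConfigs hJ ha.1, leads_swapAbove ha.2.2 ha.2.1,
      by rw [topPart_swapAbove ha.2.2]; exact ha.2.2⟩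
  · intro a ha
    simp only [Finset.coe_filter, Set.mem_ofPred_eq] at ha ⊢
    exact ⟨swapAbove_mem_boxConfigs hJ ha.1, leads_swapAbove ha.2.2 ha.2.1,
      by rw [topPart_swapAbove ha.2.2]; exact ha.2.2⟩

-- The two leading classes cover the box, overlap only in ties, and have equal size by the swap
-- apart from configurations with no part above K. Positivity of n excludes the empty configuration,
-- which has no leading colour.
open Classical in
lemma two_mul_card_leads {n : ℕ} (hn : 0 < n) {K : ℕ} {J : Finset (Fin M × Bool)}
    {b : Fin M × Bool → ℕ} (hJ : ∀ i ∈ J, weight M i ≤ K) :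
    (boxConfigs (weight M) n J b).card ≤
        2 * ((boxConfigs (weight M) n J b).filter fun a => Leads a false).card +
          (smallConfigs M n K).card ∧
      2 * ((boxConfigs (weight M) n J b).filter fun a => Leads a false).card ≤
        (boxConfigs (weight M) n J b).card + (tieConfigs M n).card + (smallConfigs M n K).card := by
  set B := boxConfigs (weight M) n J b with hB
  have hsub : B ⊆ configs (weight M) n := Finset.filter_subset _ _
  have hcolour : ∀ c, (B.filter fun a => Leads a c).card ≤
      (B.filter fun a => Leads a c ∧ K < topPart a).card + (smallConfigs M n K).card := by
    intro c
    refine (Finset.card_le_card ?_).trans (Finset.card_union_le _ _)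
    intro a ha
    rw [Finset.mem_filter] at ha
    rw [Finset.mem_union, Finset.mem_filter, mem_smallConfigs]
    rcases lt_or_ge K (topPart a) with h | h
    · exact Or.inl ⟨ha.1, ha.2, h⟩
    · exact Or.inr ⟨hsub ha.1, h⟩
  have hcolour' : ∀ c, (B.filter fun a => Leads a c ∧ K < topPart a).card ≤
      (B.filter fun a => Leads a c).card := fun c =>
    Finset.card_le_card fun a ha => by
      rw [Finset.mem_filter] at ha ⊢
      exact ⟨ha.1, ha.2.1⟩
  have hswap := card_leads_swap (n := n) (b := b) hJ
  rw [← hB] at hswap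
  have hunion : (B.filter fun a => Leads a false) ∪ (B.filter fun a => Leads a true) = B := by
    rw [← Finset.filter_or, Finset.filter_true_of_mem]
    intro a ha
    obtain ⟨c, hc⟩ := exists_leads (exists_ne_zero_of_mem hn (hsub ha))
    cases c
    · exact Or.inl hc
    · exact Or.inr hc
  have hinter : ((B.filter fun a => Leads a false) ∩ (B.filter fun a => Leads a true)).card ≤
      (tieConfigs M n).card := by
    refine Finset.card_le_card fun a ha => ?_
    rw [Finset.mem_inter, Finset.mem_filter, Finset.mem_filter] at ha
    exact Finset.mem_filter.mpr ⟨hsub ha.1.1, ha.1.2, ha.2.2⟩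
  have hcard := Finset.card_union_add_card_inter (B.filter fun a => Leads a false)
    (B.filter fun a => Leads a true)
  rw [hunion] at hcard
  have h1 := hcolour false
  have h2 := hcolour true
  have h3 := hcolour' false
  have h4 := hcolour' true
  constructor <;> omega

open Classical in
/-- Replace one copy of the largest part in the second colour by ones. -/
lemma card_tieConfigs_le {n : ℕ} (hM : 0 < M) (k : ℕ) :
    (tieConfigs M n).card + (boxConfigs (weight M) n {(⟨0, hM⟩, true)} fun _ => k).card ≤
      (smallConfigs M n k).card + (configs (weight M) n).card := by
  set o : Fin M × Bool := (⟨0, hM⟩, true) with ho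
  set T' := (tieConfigs M n).filter fun a => k < topPart a with hT'
  have h1 : (tieConfigs M n).card ≤ (smallConfigs M n k).card + T'.card := by
    refine (Finset.card_le_card ?_).trans (Finset.card_union_le _ _)
    intro a ha
    rw [Finset.mem_union, mem_smallConfigs]
    rcases lt_or_ge k (topPart a) with h | h
    · exact Or.inr (Finset.mem_filter.mpr ⟨ha, h⟩)
    · exact Or.inl ⟨(Finset.mem_filter.mp ha).1, h⟩
  let e : (Fin M × Bool → ℕ) → Fin M × Bool → ℕ := fun a j =>
    a j + (if j = o then topPart a else 0) -
      (if weight M j = topPart a ∧ j.2 = true then 1 else 0)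
  -- A tie has a copy of the largest part in colour `true`, so the natural number subtraction in e
  -- is never truncated.
  have hsub : ∀ a ∈ tieConfigs M n, ∀ j,
      (if weight M j = topPart a ∧ j.2 = true then 1 else 0) ≤
        a j + (if j = o then topPart a else 0) := by
    intro a ha j
    split_ifs with h1 h2 h2
    · have : 1 ≤ weight M j := one_le_weight M j
      omega
    · obtain ⟨k', hk', hk''⟩ := (Finset.mem_filter.mp ha).2.2
      have : j = (k', true) := by
        refine Prod.ext (Fin.ext ?_) h1.2
        have h3 := h1.1
        simp only [weight] at h3
        simp only
        omega
      rw [this]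
      omega
    · omega
    · omega
  -- The copy in colour `false` survives, so the largest part can be read off e a. This makes e
  -- injective.
  have htop : ∀ a ∈ tieConfigs M n, topPart (e a) = topPart a := by
    intro a ha
    obtain ⟨k', hk', hk''⟩ := (Finset.mem_filter.mp ha).2.1
    have hne : e a (k', false) ≠ 0 := by
      simp only [e, ho]
      simpa using hk''
    rw [topPart_eq hne]
    · exact hk'
    · intro j hj
      change weight M j ≤ (k' : ℕ) + 1
      rw [hk']
      by_cases hjo : j = o
      · rw [hjo, ho, ← hk']; simp [weight]
      · refine weight_le_topPart fun h0 => hj ?_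
        simp [e, hjo, h0]
  have hinj : Set.InjOn e (T' : Set (Fin M × Bool → ℕ)) := by
    intro a ha a' ha' h
    have hta := (Finset.mem_filter.mp ha).1
    have hta' := (Finset.mem_filter.mp ha').1
    have ht : topPart a = topPart a' := by rw [← htop a hta, ← htop a' hta', h]
    funext j
    have h2 := congrFun h j
    have h3 := hsub a hta j
    have h4 := hsub a' hta' j
    simp only [e] at h2
    rw [ht] at h2 h3
    omega
  have hmem : ∀ a ∈ T', e a ∈ (configs (weight M) n).filter fun a => ¬ a o < k := by
    intro a ha
    obtain ⟨hta, hk⟩ := Finset.mem_filter.mp ha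
    have haW := (Finset.mem_filter.mp hta).1
    obtain ⟨k', hk', hk''⟩ := (Finset.mem_filter.mp hta).2.2
    rw [mem_configs (one_le_weight M)] at haW
    rw [Finset.mem_filter, mem_configs (one_le_weight M)]
    constructor
    · have hadd : ∑ i, weight M i * e a i + ∑ i, weight M i *
          (if weight M i = topPart a ∧ i.2 = true then 1 else 0) =
          ∑ i, weight M i * a i + ∑ i, weight M i * (if i = o then topPart a else 0) := by
        rw [← Finset.sum_add_distrib, ← Finset.sum_add_distrib]
        refine Finset.sum_congr rfl fun i _ => ?_
        rw [← mul_add, ← mul_add]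
        congr 1
        exact Nat.sub_add_cancel (hsub a hta i)
      have e1 : ∑ i, weight M i * (if i = o then topPart a else 0) = topPart a := by
        simp [ho, weight]
      have e2 : ∑ i, weight M i * (if weight M i = topPart a ∧ i.2 = true then 1 else 0) =
          topPart a := by
        rw [Finset.sum_eq_single (k', true)]
        · have : weight M (k', true) = topPart a := hk'
          simp [this]
        · intro j _ hj
          rw [if_neg, mul_zero]
          rintro ⟨h1, h2⟩
          refine hj (Prod.ext (Fin.ext ?_) h2)
          simp only [weight] at h1
          simp only
          omega
        · simp
      rw [e1, e2] at hadd
      omega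
    · simp only [e, if_true]
      have h2 := hsub a hta o
      simp only [if_true] at h2
      -- When the largest part is 1, the removed copy and the added one share the index o.
      by_cases h3 : weight M o = topPart a
      · have h4 : k' = ⟨0, hM⟩ := by
          refine Fin.ext ?_
          simp only [weight, ho] at h3
          simp only
          omega
        have : a o ≠ 0 := by rw [ho, ← h4]; exact hk''
        split_ifs <;> omega
      · rw [if_neg (fun h => h3 h.1)]
        omega
  have h2 := Finset.card_le_card_of_injOn e hmem hinj
  have h3 : ((configs (weight M) n).filter fun a => a o < k).card +
      ((configs (weight M) n).filter fun a => ¬ a o < k).card = (configs (weight M) n).card :=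
    Finset.card_filter_add_card_filter_not _
  have h4 : boxConfigs (weight M) n {o} (fun _ => k) =
      (configs (weight M) n).filter fun a => a o < k := by
    simp [boxConfigs]
  rw [h4]
  omega

end Top

/-! ### Unimodal sequences as configurations led by the left colour -/

section Shape

variable {M : ℕ}

lemma sum_mul_count {l : List ℕ} (h : ∀ x ∈ l, 1 ≤ x ∧ x ≤ M) :
    ∑ k : Fin M, ((k : ℕ) + 1) * l.count ((k : ℕ) + 1) = l.sum := by
  have hsub : l.toFinset ⊆ (Finset.range M).image (· + 1) := by
    intro x hx
    obtain ⟨h1, h2⟩ := h x (List.mem_toFinset.mp hx)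
    exact Finset.mem_image.mpr ⟨x - 1, Finset.mem_range.mpr (by omega), by omega⟩
  rw [Finset.sum_list_count_of_subset l _ hsub,
    Finset.sum_image (fun x _ y _ hxy => Nat.succ_injective hxy),
    Fin.sum_univ_eq_sum_range (fun k => (k + 1) * l.count (k + 1))]
  exact Finset.sum_congr rfl fun k _ => by rw [smul_eq_mul, mul_comm]

/-- The multiplicities of the parts of a unimodal sequence, the peak being counted on the left. -/
def shape (M : ℕ) (s : UnimodalSequence) (i : Fin M × Bool) : ℕ :=
  if i.2 then s.right.count (weight M i) else (s.left ++ [s.peak]).count (weight M i)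

/-- The number of parts of size `weight M i` on the side `i.2` of the peak. -/
def sideCount (M : ℕ) (s : UnimodalSequence) (i : Fin M × Bool) : ℕ :=
  if i.2 then s.XR (weight M i) else s.XL (weight M i)

lemma left_bounds {s : UnimodalSequence} (hs : s.size ≤ M) :
    ∀ x ∈ s.left ++ [s.peak], 1 ≤ x ∧ x ≤ M := by
  intro x hx
  refine ⟨s.pos x (by simp only [List.mem_append, List.mem_cons] at hx ⊢; tauto), ?_⟩
  have := List.le_sum_of_mem hx
  simp only [List.sum_append, List.sum_singleton] at this
  have h2 : s.size = s.left.sum + s.peak + s.right.sum := rfl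
  omega

lemma right_bounds {s : UnimodalSequence} (hs : s.size ≤ M) :
    ∀ x ∈ s.right, 1 ≤ x ∧ x ≤ M := by
  intro x hx
  refine ⟨s.pos x (by simp only [List.mem_append, List.mem_cons]; tauto), ?_⟩
  have := List.le_sum_of_mem hx
  have h2 : s.size = s.left.sum + s.peak + s.right.sum := rfl
  omega

lemma le_peak_of_mem_left {s : UnimodalSequence} {x : ℕ} (hx : x ∈ s.left ++ [s.peak]) :
    x ≤ s.peak := by
  rcases List.mem_append.mp hx with h | h
  · exact (List.pairwise_append.mp s.increasing).2.2 x h _ (List.mem_singleton_self _)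
  · rw [List.mem_singleton.mp h]

lemma le_peak_of_mem_right {s : UnimodalSequence} {x : ℕ} (hx : x ∈ s.right) : x ≤ s.peak :=
  (List.pairwise_cons.mp s.decreasing).1 x hx

lemma shape_mem_configs {s : UnimodalSequence} {n : ℕ} (hs : s.size = n) (hn : n ≤ M) :
    shape M s ∈ configs (weight M) n := by
  rw [mem_configs (one_le_weight M), Fintype.sum_prod_type]
  simp only [Fintype.sum_bool, shape, weight, if_true, Bool.false_eq_true, if_false]
  rw [Finset.sum_add_distrib, sum_mul_count (right_bounds (hs.trans_le hn)),
    sum_mul_count (left_bounds (hs.trans_le hn))]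
  simp only [List.sum_append, List.sum_singleton]
  have h2 : s.size = s.left.sum + s.peak + s.right.sum := rfl
  omega

lemma exists_peak_index {s : UnimodalSequence} (hs : s.size ≤ M) :
    ∃ k : Fin M, (k : ℕ) + 1 = s.peak ∧ shape M s (k, false) ≠ 0 := by
  obtain ⟨h1, h2⟩ := left_bounds hs s.peak (by simp)
  refine ⟨⟨s.peak - 1, by omega⟩, by simp only; omega, ?_⟩
  have : s.peak - 1 + 1 = s.peak := by omega
  simp [shape, weight, this]

lemma topPart_shape {s : UnimodalSequence} (hs : s.size ≤ M) : topPart (shape M s) = s.peak := by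
  obtain ⟨k, hk, hk'⟩ := exists_peak_index hs
  have hw : weight M (k, false) = s.peak := hk
  rw [topPart_eq hk', hw]
  intro j hj
  rw [hw]
  unfold shape at hj
  split_ifs at hj
  · exact le_peak_of_mem_right (List.count_pos_iff.mp (Nat.pos_of_ne_zero hj))
  · exact le_peak_of_mem_left (List.count_pos_iff.mp (Nat.pos_of_ne_zero hj))

lemma leads_shape {s : UnimodalSequence} (hs : s.size ≤ M) : Leads (shape M s) false := by
  obtain ⟨k, hk, hk'⟩ := exists_peak_index hs
  exact ⟨k, by rw [topPart_shape hs, hk], hk'⟩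

lemma sideCount_le_shape (s : UnimodalSequence) (i : Fin M × Bool) :
    sideCount M s i ≤ shape M s i := by
  unfold sideCount shape UnimodalSequence.XL UnimodalSequence.XR
  split_ifs
  · exact le_rfl
  · rw [List.count_append]; omega

lemma shape_eq_sideCount {s : UnimodalSequence} {i : Fin M × Bool} (h : weight M i < s.peak) :
    shape M s i = sideCount M s i := by
  unfold sideCount shape UnimodalSequence.XL UnimodalSequence.XR
  split_ifs
  · rfl
  · rw [List.count_append, List.count_singleton]
    have : s.peak ≠ weight M i := by omega
    simp [this]

lemma perm_of_count_eq {l l' : List ℕ} (h : ∀ x ∈ l, 1 ≤ x ∧ x ≤ M) (h' : ∀ x ∈ l', 1 ≤ x ∧ x ≤ M)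
    (hc : ∀ k : Fin M, l.count ((k : ℕ) + 1) = l'.count ((k : ℕ) + 1)) : l.Perm l' := by
  rw [List.perm_iff_count]
  intro x
  by_cases hx : 1 ≤ x ∧ x ≤ M
  · have := hc ⟨x - 1, by omega⟩
    have e : x - 1 + 1 = x := by omega
    simpa [e] using this
  · rw [List.count_eq_zero_of_not_mem fun hm => hx (h x hm),
      List.count_eq_zero_of_not_mem fun hm => hx (h' x hm)]

/-- Sorted lists are determined by their multiplicities, and the peak is recovered as the last entry
of the left list. -/
lemma shape_injOn {n : ℕ} (hn : n ≤ M) :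
    Set.InjOn (shape M) {s : UnimodalSequence | s.size = n} := by
  intro s hs s' hs' h
  have hs1 : s.size ≤ M := (show s.size = n from hs).trans_le hn
  have hs2 : s'.size ≤ M := (show s'.size = n from hs').trans_le hn
  have h1 : (s.left ++ [s.peak]) = s'.left ++ [s'.peak] := by
    refine List.Perm.eq_of_pairwise' s.increasing s'.increasing
      (perm_of_count_eq (left_bounds hs1) (left_bounds hs2) fun k => ?_)
    simpa [shape, weight] using congrFun h (k, false)
  have h2 : s.right = s'.right := by
    refine List.Perm.eq_of_pairwise' (List.pairwise_cons.mp s.decreasing).2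
      (List.pairwise_cons.mp s'.decreasing).2
      (perm_of_count_eq (right_bounds hs1) (right_bounds hs2) fun k => ?_)
    simpa [shape, weight] using congrFun h (k, true)
  obtain ⟨h3, h4⟩ := List.append_inj' h1 rfl
  cases s
  cases s'
  simp only [List.cons.injEq, and_true] at h3 h4 h2
  subst h2 h3 h4
  rfl

/-- The multiset of the parts of colour `c` of a configuration. -/
def partsOf (a : Fin M × Bool → ℕ) (c : Bool) : Multiset ℕ :=
  ∑ k : Fin M, Multiset.replicate (a (k, c)) ((k : ℕ) + 1)

lemma count_partsOf (a : Fin M × Bool → ℕ) (c : Bool) (k : Fin M) :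
    (partsOf a c).count ((k : ℕ) + 1) = a (k, c) := by
  rw [partsOf, Multiset.count_sum', Finset.sum_eq_single k]
  · simp
  · intro j _ hj
    rw [Multiset.count_replicate, if_neg]
    intro h
    exact hj (Fin.ext (by omega))
  · simp

lemma mem_partsOf {a : Fin M × Bool → ℕ} {c : Bool} {x : ℕ} (h : x ∈ partsOf a c) :
    ∃ k : Fin M, x = k + 1 ∧ a (k, c) ≠ 0 := by
  rw [partsOf, Multiset.mem_sum] at h
  obtain ⟨k, _, hk⟩ := h
  rw [Multiset.mem_replicate] at hk
  exact ⟨k, hk.2, hk.1⟩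

/-- Sort the parts of each colour. As `false` leads, the last entry of its list bounds every part
and can serve as the peak. -/
lemma exists_shape_eq {n : ℕ} {a : Fin M × Bool → ℕ} (ha : a ∈ configs (weight M) n)
    (hl : Leads a false) : ∃ s : UnimodalSequence, s.size = n ∧ shape M s = a := by
  obtain ⟨k, hk, hk'⟩ := hl
  set l := (partsOf a false).sort (· ≤ ·) with hldef
  set r := (partsOf a true).sort (· ≥ ·) with hr
  have hkl : (k : ℕ) + 1 ∈ l := by
    rw [hldef, Multiset.mem_sort, ← Multiset.count_pos, count_partsOf]
    exact Nat.pos_of_ne_zero hk'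
  have hne : l ≠ [] := List.ne_nil_of_mem hkl
  have hlast : l.dropLast ++ [l.getLast hne] = l := List.dropLast_append_getLast hne
  have hsorted : l.Pairwise (· ≤ ·) := Multiset.pairwise_sort _ _
  have hlmem : ∀ x ∈ l, 1 ≤ x ∧ x ≤ topPart a := by
    intro x hx
    obtain ⟨j, rfl, hj⟩ := mem_partsOf ((Multiset.mem_sort _).mp hx)
    exact ⟨Nat.le_add_left _ _, weight_le_topPart hj⟩
  have hrmem : ∀ x ∈ r, 1 ≤ x ∧ x ≤ topPart a := by
    intro x hx
    obtain ⟨j, rfl, hj⟩ := mem_partsOf ((Multiset.mem_sort _).mp hx)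
    exact ⟨Nat.le_add_left _ _, weight_le_topPart hj⟩
  have htop : l.getLast hne = topPart a := by
    refine le_antisymm (hlmem _ (List.getLast_mem hne)).2 ?_
    rw [← hk]
    rw [← hlast] at hkl hsorted
    rcases List.mem_append.mp hkl with h | h
    · exact (List.pairwise_append.mp hsorted).2.2 _ h _ (List.mem_singleton_self _)
    · rw [List.mem_singleton.mp h]
  let s : UnimodalSequence :=
    { left := l.dropLast
      peak := l.getLast hne
      right := r
      pos := by
        intro x hx
        rcases List.mem_append.mp hx with h | h
        · exact (hlmem x (List.mem_of_mem_dropLast h)).1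
        · rcases List.mem_cons.mp h with rfl | h
          · exact (hlmem _ (List.getLast_mem hne)).1
          · exact (hrmem x h).1
      increasing := by rw [hlast]; exact hsorted
      decreasing := by
        rw [List.pairwise_cons]
        refine ⟨fun x hx => ?_, Multiset.pairwise_sort _ _⟩
        rw [htop]
        exact (hrmem x hx).2 }
  have hshape : shape M s = a := by
    funext i
    obtain ⟨j, c⟩ := i
    have hcl : ∀ x, l.count x = (partsOf a false).count x := fun x => by
      rw [← Multiset.coe_count, hldef, Multiset.sort_eq]
    have hcr : ∀ x, r.count x = (partsOf a true).count x := fun x => by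
      rw [← Multiset.coe_count, hr, Multiset.sort_eq]
    cases c
    · simp only [shape, s, weight, Bool.false_eq_true, if_false, hlast]
      rw [hcl, count_partsOf]
    · simp only [shape, s, weight, if_true]
      rw [hcr, count_partsOf]
  refine ⟨s, ?_, hshape⟩
  have htopM : topPart a ≤ M := by rw [← hk]; exact k.2
  rw [mem_configs (one_le_weight M)] at ha
  rw [← hshape, Fintype.sum_prod_type] at ha
  simp only [Fintype.sum_bool, shape, weight, if_true, Bool.false_eq_true, if_false] at ha
  have hL : ∀ x ∈ s.left ++ [s.peak], 1 ≤ x ∧ x ≤ M := by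
    intro x hx
    have : x ∈ l := by rw [← hlast]; exact hx
    exact ⟨(hlmem x this).1, (hlmem x this).2.trans htopM⟩
  have hR : ∀ x ∈ s.right, 1 ≤ x ∧ x ≤ M := fun x hx =>
    ⟨(hrmem x hx).1, (hrmem x hx).2.trans htopM⟩
  rw [Finset.sum_add_distrib, sum_mul_count hR, sum_mul_count hL] at ha
  simp only [List.sum_append, List.sum_singleton] at ha
  have h2 : s.size = s.left.sum + s.peak + s.right.sum := rfl
  omega

lemma finite_size (n : ℕ) : {s : UnimodalSequence | s.size = n}.Finite := by
  refine Set.Finite.of_injOn (f := shape n) (t := (configs (weight n) n : Set _)) ?_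
    (shape_injOn le_rfl) (Finset.finite_toSet _)
  intro s hs
  exact shape_mem_configs hs le_rfl

open Classical in
/-- The number of unimodal sequences with prescribed bounds on the multiplicities of small parts is
the number of configurations led by the left colour, up to configurations with small parts only. -/
lemma ncard_box_bounds {n K : ℕ} (hn : n ≤ M) {J : Finset (Fin M × Bool)}
    {b : Fin M × Bool → ℕ} (hJ : ∀ i ∈ J, weight M i ≤ K) :
    ((boxConfigs (weight M) n J b).filter fun a => Leads a false).card ≤
        {s : UnimodalSequence | s.size = n ∧ ∀ i ∈ J, sideCount M s i < b i}.ncard ∧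
      {s : UnimodalSequence | s.size = n ∧ ∀ i ∈ J, sideCount M s i < b i}.ncard ≤
        ((boxConfigs (weight M) n J b).filter fun a => Leads a false).card +
          (smallConfigs M n K).card := by
  set X := {s : UnimodalSequence | s.size = n ∧ ∀ i ∈ J, sideCount M s i < b i} with hX
  set N := (boxConfigs (weight M) n J b).filter fun a => Leads a false with hN
  have hfin : X.Finite := (finite_size n).subset fun s hs => hs.1
  have hinj : Set.InjOn (shape M) X := (shape_injOn hn).mono fun s hs => hs.1
  constructor
  · rw [← hinj.ncard_image, ← Set.ncard_coe_finset]
    refine Set.ncard_le_ncard ?_ (hfin.image _)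
    intro a ha
    rw [Finset.mem_coe, hN, Finset.mem_filter, boxConfigs, Finset.mem_filter] at ha
    obtain ⟨s, hs, rfl⟩ := exists_shape_eq ha.1.1 ha.2
    exact ⟨s, ⟨hs, fun i hi => (sideCount_le_shape s i).trans_lt (ha.1.2 i hi)⟩, rfl⟩
  · refine le_trans ?_ (Finset.card_union_le N (smallConfigs M n K))
    rw [← Set.ncard_coe_finset]
    refine Set.ncard_le_ncard_of_injOn (shape M) ?_ hinj (Finset.finite_toSet _)
    rintro s ⟨hs, hsb⟩
    have hmem := shape_mem_configs hs hn
    have htop := topPart_shape (hs.trans_le hn)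
    rw [Finset.mem_coe, Finset.mem_union, mem_smallConfigs]
    -- `shape` and `sideCount` differ only at the peak. If the peak exceeds K they agree on J;
    -- otherwise all parts are at most K.
    rcases lt_or_ge K s.peak with h | h
    · left
      rw [hN, Finset.mem_filter, boxConfigs, Finset.mem_filter]
      refine ⟨⟨hmem, fun i hi => ?_⟩, leads_shape (hs.trans_le hn)⟩
      rw [shape_eq_sideCount ((hJ i hi).trans_lt h)]
      exact hsb i hi
    · right
      exact ⟨hmem, by rw [htop]; exact h⟩

lemma P_real_eq (n : ℕ) (E : Set UnimodalSequence) :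
    (UnimodalSequence.P n).real E =
      ({s : UnimodalSequence | s.size = n} ∩ E).ncard /
        ({s : UnimodalSequence | s.size = n}).ncard := by
  have hcount : ∀ A : Set UnimodalSequence, A.Finite →
      (MeasureTheory.Measure.count A).toReal = A.ncard := by
    intro A hA
    rw [MeasureTheory.Measure.count_apply MeasurableSpace.measurableSet_top,
      ← hA.cast_ncard_eq]
    simp
  rw [UnimodalSequence.P, MeasureTheory.measureReal_def, ProbabilityTheory.uniformOn,
    ProbabilityTheory.cond_apply MeasurableSpace.measurableSet_top, ENNReal.toReal_mul,
    ENNReal.toReal_inv, hcount _ (finite_size n),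
    hcount _ ((finite_size n).subset Set.inter_subset_left)]
  rw [div_eq_inv_mul]

end Shape

/-! ### Transfer to the uniform measure -/

/-- With x = X/U ≤ 1 one has (x - B/W) W = (2X - B) - x(2U - W), so no lower bound on U is needed
and the factors 2 cancel. -/
lemma abs_div_sub_div_le {X U B W τ : ℝ} (hX0 : 0 ≤ X) (hXU : X ≤ U) (hW : 0 < W)
    (h1 : |2 * X - B| ≤ τ * W) (h2 : |2 * U - W| ≤ τ * W) : |X / U - B / W| ≤ 2 * τ := by
  set x := X / U with hx
  have hx0 : 0 ≤ x := div_nonneg hX0 (hX0.trans hXU)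
  have hx1 : x ≤ 1 := div_le_one_of_le₀ hXU (hX0.trans hXU)
  have hxU : x * U = X := by
    rcases eq_or_ne U 0 with h | h
    · have : X = 0 := by linarith
      rw [h, this, mul_zero]
    · rw [hx]; field_simp
  have hτ : 0 ≤ τ * W := (abs_nonneg _).trans h1
  have e : (x - B / W) * W = (2 * X - B) - x * (2 * U - W) := by
    have : B / W * W = B := by field_simp
    rw [sub_mul, this]
    linear_combination 2 * hxU
  have h3 : |x - B / W| * W ≤ (2 * τ) * W := by
    rw [← abs_of_pos hW, ← abs_mul, abs_of_pos hW, e]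
    refine (abs_sub _ _).trans ?_
    rw [abs_mul, abs_of_nonneg hx0]
    have := mul_le_mul hx1 h2 (abs_nonneg _) zero_le_one
    linarith
  exact le_of_mul_le_mul_right h3 hW

/-- The multiplicities of few small parts in a uniform unimodal sequence are close to independent
geometric variables; here the parts are indexed by their size and side. -/
lemma exists_P_box_estimate : ∃ C > 0, ∃ t₀ > 0, ∀ t : ℝ, 0 < t → t ≤ t₀ →
    ∀ n : ℕ, n * (3 * t ^ 2) = Real.pi ^ 2 → ∀ N : ℕ, ∃ M, N ≤ M ∧
      ∀ (K : ℕ) (J : Finset (Fin M × Bool)) (b : Fin M × Bool → ℕ),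
        (∀ i ∈ J, weight M i ≤ K) → K * t ≤ 1 → (J.card : ℝ) * (64 * t) ≤ 1 →
        |(UnimodalSequence.P n).real {s | ∀ i ∈ J, sideCount M s i < b i} -
          ∏ i ∈ J, (1 - (Real.exp (-t) ^ weight M i) ^ b i)| ≤ C * (J.card * √t + √√t) := by
  obtain ⟨C₁, hC₁, t₁, ht₁, hbox⟩ := exists_box_estimate
  obtain ⟨C₂, hC₂, t₂, ht₂, hsmall⟩ := exists_small_parts_estimate
  refine ⟨3 * C₁ + 8 * C₂ + 2, by positivity,
    min (min t₁ t₂) (min (1 / 64) (Real.exp (-4))), by positivity, ?_⟩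
  intro t h0 ht n hn N
  have htt₁ : t ≤ t₁ := ht.trans ((min_le_left _ _).trans (min_le_left _ _))
  have htt₂ : t ≤ t₂ := ht.trans ((min_le_left _ _).trans (min_le_right _ _))
  have ht64 : t ≤ 1 / 64 := ht.trans ((min_le_right _ _).trans (min_le_left _ _))
  have ht4 : t ≤ Real.exp (-4) := ht.trans ((min_le_right _ _).trans (min_le_right _ _))
  have hlog : 4 ≤ Real.log (1 / t) := by
    rw [one_div, Real.log_inv]
    have := Real.log_le_log h0 ht4
    rw [Real.log_exp] at this
    linarith
  -- The threshold is large enough that k ones have geometric probability exp(-kt) ≤ t^(1/4), and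
  -- small enough that pairs without parts above k remain rare.
  set k := ⌈Real.log (1 / t) / (4 * t)⌉₊ with hk
  have hk1 : Real.log (1 / t) / (4 * t) ≤ k := Nat.le_ceil _
  have hk2 : (k : ℝ) ≤ Real.log (1 / t) / (4 * t) + 1 := (Nat.ceil_lt_add_one (by positivity)).le
  obtain ⟨M, hMge, hM⟩ := exists_tailSmall t (N + n + 2 * k + 1)
  refine ⟨M, by omega, ?_⟩
  intro K J b hJK hKt hJc
  obtain ⟨hW, hboxJ⟩ := hbox t h0 htt₁ M hM n hn
  have hZ := hsmall t h0 htt₂ M hM n hn k (by omega) hk1 hk2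
  change ((smallConfigs M n k).card : ℝ) ≤ _ at hZ
  have hn0 : 0 < n := by
    rw [Nat.pos_iff_ne_zero]
    rintro rfl
    have := pow_pos Real.pi_pos 2
    simp only [Nat.cast_zero, zero_mul] at hn
    linarith
  have hM0 : 0 < M := by omega
  have hnM : n ≤ M := by omega
  set W : ℝ := ((configs (weight M) n).card : ℝ) with hWd
  have hWpos : 0 < W := by rw [hWd]; exact_mod_cast hW
  have hsq0 : 0 < √t := Real.sqrt_pos.mpr h0
  have hsq1 : √t ≤ √√t := by
    refine Real.le_sqrt_of_sq_le ?_
    rw [Real.sq_sqrt h0.le]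
    refine Real.le_sqrt_of_sq_le ?_
    nlinarith
  -- configurations with small parts
  have hKk : K ≤ k := by
    have : (K : ℝ) ≤ k := by
      refine le_trans ?_ hk1
      rw [le_div_iff₀ (by positivity)]
      linarith
    exact_mod_cast this
  have hZK : ((smallConfigs M n K).card : ℝ) ≤ C₂ * √t * W := by
    refine le_trans ?_ hZ
    have : smallConfigs M n K ⊆ smallConfigs M n k := by
      intro a ha
      rw [mem_smallConfigs] at ha ⊢
      exact ⟨ha.1, ha.2.trans hKk⟩
    exact_mod_cast Finset.card_le_card this
  -- ties
  have hT : ((tieConfigs M n).card : ℝ) ≤ (C₂ * √t + √√t + C₁ * √t) * W := by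
    have h1 := card_tieConfigs_le (n := n) hM0 k
    have h1' : ((tieConfigs M n).card : ℝ) +
        (boxConfigs (weight M) n {(⟨0, hM0⟩, true)} fun _ => k).card ≤
        (smallConfigs M n k).card + W := by rw [hWd]; exact_mod_cast h1
    have h2 := hboxJ {(⟨0, hM0⟩, true)} (fun _ => k)
      (by intro i hi; rw [Finset.mem_singleton.mp hi]; simp only [weight]; push_cast; linarith)
      (by simp only [Finset.card_singleton, Nat.cast_one]; linarith)
    rw [Finset.prod_singleton, Finset.card_singleton] at h2
    have h3 : (Real.exp (-t) ^ weight M (⟨0, hM0⟩, true)) ^ k ≤ √√t := by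
      have e : √√t = Real.exp (-(Real.log (1 / t) / 4)) := by
        rw [one_div, Real.log_inv, Real.sqrt_eq_rpow, Real.sqrt_eq_rpow, ← Real.rpow_mul h0.le,
          Real.rpow_def_of_pos h0]
        congr 1; ring
      simp only [weight, zero_add, pow_one]
      rw [exp_pow_eq, e]
      refine Real.exp_le_exp.mpr (neg_le_neg ?_)
      rw [div_le_iff₀ (by positivity)] at hk1
      linarith
    have h4 := (abs_le.mp h2).1
    have h5 := mul_le_mul_of_nonneg_left h3 hWpos.le
    simp only [Nat.cast_one, mul_one] at h4
    linarith
  -- Ties are counted once. Small configurations are counted three times besides: once in the swap,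
  -- and twice on passing from sequences to led configurations.
  set τ := 4 * C₂ * √t + √√t + C₁ * √t with hτ
  -- comparison of the sequences with the configurations
  have hcomp : ∀ (J' : Finset (Fin M × Bool)) (b' : Fin M × Bool → ℕ),
      (∀ i ∈ J', weight M i ≤ K) →
      |2 * (({s : UnimodalSequence | s.size = n ∧ ∀ i ∈ J', sideCount M s i < b' i}).ncard : ℝ) -
        (boxConfigs (weight M) n J' b').card| ≤ τ * W := by
    intro J' b' hJ'
    obtain ⟨a1, a2⟩ := ncard_box_bounds (b := b') hnM hJ'
    obtain ⟨a3, a4⟩ := two_mul_card_leads hn0 (b := b') hJ'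
    have a1' := (Nat.cast_le (α := ℝ)).mpr a1
    have a2' := (Nat.cast_le (α := ℝ)).mpr a2
    have a3' := (Nat.cast_le (α := ℝ)).mpr a3
    have a4' := (Nat.cast_le (α := ℝ)).mpr a4
    push_cast at a2' a3' a4'
    have hτW : τ * W = (C₂ * √t + √√t + C₁ * √t) * W + 3 * (C₂ * √t * W) := by rw [hτ]; ring
    have : (0 : ℝ) ≤ (tieConfigs M n).card := Nat.cast_nonneg _
    have : (0 : ℝ) ≤ (smallConfigs M n K).card := Nat.cast_nonneg _
    rw [abs_le]
    constructor <;> linarith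
  have h1 := hcomp J b hJK
  have h2 := hcomp ∅ b (by simp)
  rw [boxConfigs_empty] at h2
  simp only [Finset.notMem_empty, false_imp_iff, implies_true, and_true] at h2
  have hPeq := P_real_eq n {s | ∀ i ∈ J, sideCount M s i < b i}
  have hset : {s : UnimodalSequence | s.size = n} ∩ {s | ∀ i ∈ J, sideCount M s i < b i} =
      {s : UnimodalSequence | s.size = n ∧ ∀ i ∈ J, sideCount M s i < b i} := rfl
  rw [hset] at hPeq
  have hXU : ({s : UnimodalSequence | s.size = n ∧ ∀ i ∈ J, sideCount M s i < b i}).ncard ≤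
      ({s : UnimodalSequence | s.size = n}).ncard :=
    Set.ncard_le_ncard (fun s hs => hs.1) (finite_size n)
  have h3 := abs_div_sub_div_le (Nat.cast_nonneg _) ((Nat.cast_le (α := ℝ)).mpr hXU) hWpos h1 h2
  rw [← hPeq] at h3
  have h4 := hboxJ J b (fun i hi => by
    have : (weight M i : ℝ) ≤ K := by exact_mod_cast hJK i hi
    nlinarith) hJc
  have h5 : |((boxConfigs (weight M) n J b).card : ℝ) / W -
      ∏ i ∈ J, (1 - (Real.exp (-t) ^ weight M i) ^ b i)| ≤ C₁ * J.card * √t := by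
    have e : ((boxConfigs (weight M) n J b).card : ℝ) / W -
        ∏ i ∈ J, (1 - (Real.exp (-t) ^ weight M i) ^ b i) =
        (((boxConfigs (weight M) n J b).card : ℝ) -
          W * ∏ i ∈ J, (1 - (Real.exp (-t) ^ weight M i) ^ b i)) / W := by field_simp
    rw [e, abs_div, abs_of_pos hWpos, div_le_iff₀ hWpos]
    exact h4
  refine (abs_sub_le _ _ _).trans ((add_le_add h3 h5).trans ?_)
  have hJ0 : (0 : ℝ) ≤ J.card * √t := by positivity
  rw [hτ]
  linarith [mul_le_mul_of_nonneg_left hsq1 hC₁.le, mul_le_mul_of_nonneg_left hsq1 hC₂.le,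
    mul_nonneg hC₁.le hJ0, mul_nonneg hC₂.le hJ0, mul_nonneg hC₁.le (Real.sqrt_nonneg √t)]

/-- The multiplicities of the parts with size in a small set `S` are close to independent
geometric variables. -/
lemma exists_P_estimate : ∃ C > 0, ∃ t₀ > 0, ∀ t : ℝ, 0 < t → t ≤ t₀ →
    ∀ n : ℕ, n * (3 * t ^ 2) = Real.pi ^ 2 → ∀ (K : ℕ) (S : Finset ℕ) (bL bR : ℕ → ℕ),
      (∀ k ∈ S, 1 ≤ k ∧ k ≤ K) → K * t ≤ 1 → (S.card : ℝ) * (128 * t) ≤ 1 →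
      |(UnimodalSequence.P n).real {s | ∀ k ∈ S, s.XL k < bL k ∧ s.XR k < bR k} -
        ∏ k ∈ S, ((1 - Real.exp (-(k * bL k * t))) * (1 - Real.exp (-(k * bR k * t))))| ≤
        C * (S.card * √t + √√t) := by
  obtain ⟨C, hC, t₀, ht₀, h⟩ := exists_P_box_estimate
  refine ⟨2 * C, by positivity, t₀, ht₀, ?_⟩
  intro t h0 ht n hn K S bL bR hS hKt hSc
  obtain ⟨M, hKM, hM⟩ := h t h0 ht n hn K
  set S' : Finset (Fin M) := Finset.univ.filter fun k => (k : ℕ) + 1 ∈ S with hS'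
  have hprod : ∀ f : ℕ → ℝ, ∏ k ∈ S', f ((k : ℕ) + 1) = ∏ k ∈ S, f k := by
    intro f
    refine Finset.prod_nbij (fun k => (k : ℕ) + 1) ?_ ?_ ?_ (fun _ _ => rfl)
    · intro k hk
      exact (Finset.mem_filter.mp hk).2
    · intro k _ k' _ hkk
      exact Fin.ext (Nat.succ_injective hkk)
    · intro k hk
      obtain ⟨h1, h2⟩ := hS k hk
      have e : k - 1 + 1 = k := by omega
      exact ⟨⟨k - 1, by omega⟩, by simpa [hS', e] using hk, e⟩
  have hcard : S'.card = S.card := by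
    refine Finset.card_nbij (fun k => (k : ℕ) + 1) ?_ ?_ ?_
    · intro k hk
      exact (Finset.mem_filter.mp hk).2
    · intro k _ k' _ hkk
      exact Fin.ext (Nat.succ_injective hkk)
    · intro k hk
      obtain ⟨h1, h2⟩ := hS k hk
      have e : k - 1 + 1 = k := by omega
      exact ⟨⟨k - 1, by omega⟩, by simpa [hS', e] using hk, e⟩
  set b : Fin M × Bool → ℕ := fun i => if i.2 then bR (weight M i) else bL (weight M i) with hb
  have hJcard : ((S' ×ˢ (Finset.univ : Finset Bool)).card : ℝ) = 2 * S.card := by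
    rw [Finset.card_product, hcard]
    simp [mul_comm]
  have hmain := hM K (S' ×ˢ Finset.univ) b (by
    intro i hi
    exact (hS _ (Finset.mem_filter.mp (Finset.mem_product.mp hi).1).2).2) hKt (by
    rw [hJcard]; linarith)
  have hset : {s : UnimodalSequence | ∀ i ∈ S' ×ˢ (Finset.univ : Finset Bool),
      sideCount M s i < b i} = {s | ∀ k ∈ S, s.XL k < bL k ∧ s.XR k < bR k} := by
    ext s
    simp only [Set.mem_ofPred_eq]
    constructor
    · intro hs k hk
      obtain ⟨h1, h2⟩ := hS k hk
      have e : k - 1 + 1 = k := by omega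
      have hmem : (⟨k - 1, by omega⟩ : Fin M) ∈ S' := by simpa [hS', e] using hk
      have a1 := hs (_, false) (Finset.mem_product.mpr ⟨hmem, Finset.mem_univ _⟩)
      have a2 := hs (_, true) (Finset.mem_product.mpr ⟨hmem, Finset.mem_univ _⟩)
      simp only [sideCount, hb, weight, e] at a1 a2
      exact ⟨by simpa using a1, by simpa using a2⟩
    · rintro hs ⟨k, c⟩ hi
      have hk := (Finset.mem_filter.mp (Finset.mem_product.mp hi).1).2
      have := hs _ hk
      cases c
      · simpa [sideCount, hb, weight] using this.1
      · simpa [sideCount, hb, weight] using this.2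
  have hprodJ : ∏ i ∈ S' ×ˢ (Finset.univ : Finset Bool),
      (1 - (Real.exp (-t) ^ weight M i) ^ b i) =
      ∏ k ∈ S, ((1 - Real.exp (-(k * bL k * t))) * (1 - Real.exp (-(k * bR k * t)))) := by
    rw [Finset.prod_product, ← hprod]
    refine Finset.prod_congr rfl fun k _ => ?_
    simp only [Fintype.prod_bool, hb, weight, if_true, Bool.false_eq_true, if_false]
    rw [← pow_mul, ← pow_mul, exp_pow_eq, exp_pow_eq, mul_comm]
    push_cast
    rfl
  rw [hset, hprodJ, hJcard] at hmain
  refine hmain.trans ?_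
  have : 0 ≤ √√t := Real.sqrt_nonneg _
  nlinarith

/-! ### Rescaling and the limits -/

/-- The saddle point parameter `π / √(3 n)`, with `constB * √n = 1 / saddle n`. -/
noncomputable def saddle (n : ℕ) : ℝ := Real.pi / Real.sqrt 3 / √(n : ℝ)

lemma saddle_pos {n : ℕ} (hn : 0 < n) : 0 < saddle n := by
  have : (0 : ℝ) < n := by exact_mod_cast hn
  have := Real.pi_pos
  unfold saddle
  positivity

lemma constB_mul_sqrt (n : ℕ) : constB * √(n : ℝ) = 1 / saddle n := by
  unfold constB saddle
  rw [one_div, inv_div, div_div_eq_mul_div]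
  ring

lemma saddle_equation {n : ℕ} (hn : 0 < n) : n * (3 * saddle n ^ 2) = Real.pi ^ 2 := by
  have : (0 : ℝ) < n := by exact_mod_cast hn
  unfold saddle
  rw [div_pow, div_pow, Real.sq_sqrt (by norm_num), Real.sq_sqrt this.le]
  field_simp

lemma tendsto_saddle : Tendsto saddle atTop (nhds 0) := by
  unfold saddle
  exact Tendsto.const_div_atTop (Real.tendsto_sqrt_atTop.comp tendsto_natCast_atTop_atTop) _

lemma tendsto_sqrt_saddle : Tendsto (fun n => √(saddle n)) atTop (nhds 0) := by
  simpa [Function.comp_def] using (Real.continuous_sqrt.tendsto 0).comp tendsto_saddle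

lemma tendsto_sqrt_sqrt_saddle : Tendsto (fun n => √√(saddle n)) atTop (nhds 0) := by
  simpa [Function.comp_def] using (Real.continuous_sqrt.tendsto 0).comp tendsto_sqrt_saddle

lemma tendsto_mul_saddle {K : ℕ → ℕ}
    (hK : (fun n : ℕ => (K n : ℝ)) =o[atTop] (fun n : ℕ => (n : ℝ) ^ (1 / 2 : ℝ))) :
    Tendsto (fun n => K n * saddle n) atTop (nhds 0) := by
  have h := hK.tendsto_div_nhds_zero.mul_const (Real.pi / Real.sqrt 3)
  rw [zero_mul] at h
  refine h.congr fun n => ?_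
  unfold saddle
  rw [Real.sqrt_eq_rpow (n : ℝ)]
  ring

lemma tendsto_mul_sqrt_saddle {K : ℕ → ℕ}
    (hK : (fun n : ℕ => (K n : ℝ)) =o[atTop] (fun n : ℕ => (n : ℝ) ^ (1 / 4 : ℝ))) :
    Tendsto (fun n => K n * √(saddle n)) atTop (nhds 0) := by
  have h := hK.tendsto_div_nhds_zero.mul_const (√(Real.pi / Real.sqrt 3))
  rw [zero_mul] at h
  refine h.congr fun n => ?_
  unfold saddle
  have e : √√(n : ℝ) = (n : ℝ) ^ (1 / 4 : ℝ) := by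
    rw [Real.sqrt_eq_rpow, Real.sqrt_eq_rpow, ← Real.rpow_mul (Nat.cast_nonneg n)]
    norm_num
  rw [Real.sqrt_div' (Real.pi / Real.sqrt 3) (Real.sqrt_nonneg (n : ℝ)), e]
  ring

/-- The number of multiplicities allowed by the bound `v` on the rescaled multiplicity of `k`. -/
noncomputable def levelCount (t v : ℝ) (k : ℕ) : ℕ := ⌊v / (k * t)⌋₊ + 1

lemma rescaled_le_iff {t v : ℝ} (ht : 0 < t) (hv : 0 ≤ v) {k : ℕ} (hk : 1 ≤ k) (x : ℕ) :
    (k : ℝ) * x / (1 / t) ≤ v ↔ x < levelCount t v k := by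
  have hk' : (0 : ℝ) < k := by exact_mod_cast hk
  rw [levelCount, Nat.lt_succ_iff, Nat.le_floor_iff (by positivity), le_div_iff₀ (by positivity),
    div_div_eq_mul_div, div_one]
  have : (k : ℝ) * x * t = x * (k * t) := by ring
  rw [this]

/-- The number k · `levelCount t v k` · t is the first multiple of kt above v. It overshoots v by at
most kt, and exp(-x) is 1-Lipschitz for x ≥ 0. -/
lemma abs_exp_levelCount_sub_le {t v : ℝ} (ht : 0 < t) (hv : 0 ≤ v) {k : ℕ} (hk : 1 ≤ k) :
    |(1 - Real.exp (-(k * levelCount t v k * t))) - (1 - Real.exp (-v))| ≤ k * t := by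
  have hk' : (0 : ℝ) < k := by exact_mod_cast hk
  have hkt : 0 < k * t := by positivity
  set y := k * levelCount t v k * t with hy
  have e : y = (⌊v / (k * t)⌋₊ + 1) * (k * t) := by
    rw [hy, levelCount]; push_cast; ring
  have h1 : v ≤ y := by
    have := (Nat.lt_floor_add_one (v / (k * t))).le
    rw [div_le_iff₀ hkt] at this
    rw [e]; exact this
  have h2 : y ≤ v + k * t := by
    have := Nat.floor_le (show 0 ≤ v / (k * t) by positivity)
    rw [le_div_iff₀ hkt] at this
    rw [e]; linarith
  have h3 : Real.exp (-y) ≤ Real.exp (-v) := Real.exp_le_exp.mpr (by linarith)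
  have h4 : Real.exp (-v) * (1 - (y - v)) ≤ Real.exp (-y) := by
    have : Real.exp (-y) = Real.exp (-v) * Real.exp (-(y - v)) := by
      rw [← Real.exp_add]; congr 1; ring
    rw [this]
    have := Real.add_one_le_exp (-(y - v))
    gcongr
    linarith
  have h5 : Real.exp (-v) ≤ 1 := Real.exp_le_one_iff.mpr (by linarith)
  have h6 := Real.exp_pos (-v)
  rw [abs_le]
  constructor <;> nlinarith

lemma norm_one_sub_exp_neg_le {x : ℝ} (hx : 0 ≤ x) : ‖1 - Real.exp (-x)‖ ≤ 1 := by
  have h1 : Real.exp (-x) ≤ 1 := Real.exp_le_one_iff.mpr (by linarith)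
  have h2 := Real.exp_pos (-x)
  rw [Real.norm_eq_abs, abs_le]
  constructor <;> linarith

/-- Exponential approximation of the rescaled multiplicities of the parts with size in `S`. -/
lemma exists_P_exponential_estimate : ∃ C > 0, ∃ t₀ > 0, ∀ n : ℕ, 0 < n → saddle n ≤ t₀ →
    ∀ (K : ℕ) (S : Finset ℕ) (vL vR : ℕ → ℝ), (∀ k ∈ S, 1 ≤ k ∧ k ≤ K) →
      (∀ k ∈ S, 0 ≤ vL k ∧ 0 ≤ vR k) → K * saddle n ≤ 1 → (S.card : ℝ) * (128 * saddle n) ≤ 1 →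
      |(UnimodalSequence.P n).real {s | ∀ k ∈ S,
          (k : ℝ) * (s.XL k : ℝ) / (constB * √(n : ℝ)) ≤ vL k ∧
          (k : ℝ) * (s.XR k : ℝ) / (constB * √(n : ℝ)) ≤ vR k} -
        ∏ k ∈ S, ((1 - Real.exp (-vL k)) * (1 - Real.exp (-vR k)))| ≤
        C * (S.card * √(saddle n) + √√(saddle n)) + 2 * S.card * (K * saddle n) := by
  obtain ⟨C, hC, t₀, ht₀, h⟩ := exists_P_estimate
  refine ⟨C, hC, t₀, ht₀, ?_⟩
  intro n hn hnt K S vL vR hS hv hK hSc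
  have ht := saddle_pos hn
  set t := saddle n with htd
  have hmain := h t ht hnt n (saddle_equation hn) K S (fun k => levelCount t (vL k) k)
    (fun k => levelCount t (vR k) k) hS hK hSc
  have hset : {s : UnimodalSequence | ∀ k ∈ S,
      (k : ℝ) * (s.XL k : ℝ) / (constB * √(n : ℝ)) ≤ vL k ∧
      (k : ℝ) * (s.XR k : ℝ) / (constB * √(n : ℝ)) ≤ vR k} =
      {s | ∀ k ∈ S, s.XL k < levelCount t (vL k) k ∧ s.XR k < levelCount t (vR k) k} := by
    ext s
    simp only [Set.mem_ofPred_eq, constB_mul_sqrt]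
    refine forall₂_congr fun k hk => ?_
    rw [rescaled_le_iff ht (hv k hk).1 (hS k hk).1, rescaled_le_iff ht (hv k hk).2 (hS k hk).1]
  rw [hset]
  have hprod : |∏ k ∈ S, ((1 - Real.exp (-(k * levelCount t (vL k) k * t))) *
      (1 - Real.exp (-(k * levelCount t (vR k) k * t)))) -
      ∏ k ∈ S, ((1 - Real.exp (-vL k)) * (1 - Real.exp (-vR k)))| ≤ 2 * S.card * (K * t) := by
    have hle : ∀ x y : ℝ, 0 ≤ x → 0 ≤ y →
        ‖(1 - Real.exp (-x)) * (1 - Real.exp (-y))‖ ≤ 1 := by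
      intro x y hx hy
      rw [norm_mul]
      exact mul_le_one₀ (norm_one_sub_exp_neg_le hx) (norm_nonneg _) (norm_one_sub_exp_neg_le hy)
    rw [← Real.norm_eq_abs]
    refine (norm_prod_sub_prod_le S _ _ (fun k _ => hle _ _ (by positivity) (by positivity))
      (fun k hk => hle _ _ (hv k hk).1 (hv k hk).2)).trans ?_
    have hterm : ∀ k ∈ S, ‖(1 - Real.exp (-(k * levelCount t (vL k) k * t))) *
        (1 - Real.exp (-(k * levelCount t (vR k) k * t))) -
        (1 - Real.exp (-vL k)) * (1 - Real.exp (-vR k))‖ ≤ 2 * (K * t) := by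
      intro k hk
      have a1 := abs_exp_levelCount_sub_le ht (hv k hk).1 (hS k hk).1
      have a2 := abs_exp_levelCount_sub_le ht (hv k hk).2 (hS k hk).1
      rw [← Real.norm_eq_abs] at a1 a2
      have a3 := norm_one_sub_exp_neg_le (show 0 ≤ k * levelCount t (vR k) k * t by positivity)
      have a4 := norm_one_sub_exp_neg_le (hv k hk).1
      have hkK : (k : ℝ) * t ≤ K * t := by
        have : (k : ℝ) ≤ K := by exact_mod_cast (hS k hk).2
        gcongr
      set A := 1 - Real.exp (-(k * levelCount t (vL k) k * t))
      set B := 1 - Real.exp (-(k * levelCount t (vR k) k * t))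
      set A' := 1 - Real.exp (-vL k)
      set B' := 1 - Real.exp (-vR k)
      have e : A * B - A' * B' = (A - A') * B + A' * (B - B') := by ring
      rw [e]
      refine (norm_add_le _ _).trans ?_
      rw [norm_mul, norm_mul]
      have b1 := mul_le_mul a1 a3 (norm_nonneg _) (by positivity)
      have b2 := mul_le_mul a4 a2 (norm_nonneg _) zero_le_one
      linarith
    refine (Finset.sum_le_card_nsmul S _ _ hterm).trans (le_of_eq ?_)
    rw [nsmul_eq_mul]; ring
  exact (abs_sub_le _ _ _).trans (add_le_add hmain hprod)

lemma integral_exp_neg (v : ℝ) : ∫ u in (0 : ℝ)..v, Real.exp (-u) = 1 - Real.exp (-v) := by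
  have := intervalIntegral.integral_comp_neg (a := 0) (b := v) Real.exp
  rw [this, integral_exp, neg_zero, Real.exp_zero]

lemma eventually_saddle_conditions {t₀ : ℝ} (ht₀ : 0 < t₀) {K c : ℕ → ℕ}
    (hK : Tendsto (fun n => K n * saddle n) atTop (nhds 0)) (hc : ∀ n, c n ≤ K n) :
    ∀ᶠ n : ℕ in atTop, 0 < n ∧ saddle n ≤ t₀ ∧ K n * saddle n ≤ 1 ∧
      (c n : ℝ) * (128 * saddle n) ≤ 1 := by
  filter_upwards [eventually_gt_atTop 0, tendsto_saddle.eventually (ge_mem_nhds ht₀),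
    hK.eventually (ge_mem_nhds (show (0 : ℝ) < 1 / 128 by norm_num))] with n h1 h2 h3
  have hs := saddle_pos h1
  have : (c n : ℝ) ≤ K n := by exact_mod_cast hc n
  have := mul_le_mul_of_nonneg_right this hs.le
  exact ⟨h1, h2, by linarith, by linarith⟩

lemma tendsto_P_joint (K : ℕ → ℕ) (vL vR : ℕ → ℕ → ℝ)
    (hK : (fun n : ℕ => (K n : ℝ)) =o[atTop] (fun n : ℕ => (n : ℝ) ^ (1 / 4 : ℝ)))
    (hv : ∀ n k : ℕ, 1 ≤ k → k ≤ K n → 0 ≤ vL n k ∧ 0 ≤ vR n k) :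
    Tendsto
      (fun n : ℕ =>
        (UnimodalSequence.P n).real
            {s | ∀ k : ℕ, 1 ≤ k → k ≤ K n →
              (k : ℝ) * (s.XL k : ℝ) / (constB * Real.sqrt n) ≤ vL n k ∧
              (k : ℝ) * (s.XR k : ℝ) / (constB * Real.sqrt n) ≤ vR n k} -
          ∏ k ∈ Finset.Icc 1 (K n),
            ((∫ u in (0 : ℝ)..(vL n k), Real.exp (-u)) *
              (∫ u in (0 : ℝ)..(vR n k), Real.exp (-u))))
      atTop (nhds 0) := by
  obtain ⟨C, hC, t₀, ht₀, h⟩ := exists_P_exponential_estimate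
  have hK4 := tendsto_mul_sqrt_saddle hK
  have hK2 : Tendsto (fun n => K n * saddle n) atTop (nhds 0) := by
    have := hK4.mul tendsto_sqrt_saddle
    rw [zero_mul] at this
    refine this.congr' ?_
    filter_upwards [eventually_gt_atTop 0] with n hn
    rw [mul_assoc, Real.mul_self_sqrt (saddle_pos hn).le]
  -- With |S| = K the discretisation error 2|S|Kt equals 2(K√t)^2, so K = o(n^(1/4)) controls both
  -- errors.
  have hlim : Tendsto (fun n => C * (K n * √(saddle n) + √√(saddle n)) +
      2 * (K n * √(saddle n)) ^ 2) atTop (nhds 0) := by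
    have := ((hK4.add tendsto_sqrt_sqrt_saddle).const_mul C).add ((hK4.pow 2).const_mul 2)
    simpa using this
  refine squeeze_zero_norm' ?_ hlim
  filter_upwards [eventually_saddle_conditions ht₀ hK2 (fun n => le_rfl)]
    with n ⟨hn, hnt, hn1, hn2⟩
  have hb := h n hn hnt (K n) (Finset.Icc 1 (K n)) (vL n) (vR n)
    (fun k hk => Finset.mem_Icc.mp hk)
    (fun k hk => hv n k (Finset.mem_Icc.mp hk).1 (Finset.mem_Icc.mp hk).2) hn1 (by simpa using hn2)
  simp only [Finset.mem_Icc, and_imp, Nat.card_Icc, add_tsub_cancel_right] at hb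
  simp only [integral_exp_neg, Real.norm_eq_abs]
  refine hb.trans (le_of_eq ?_)
  rw [mul_pow, Real.sq_sqrt (saddle_pos hn).le]
  ring

lemma tendsto_P_single (k : ℕ → ℕ) (vL vR : ℝ) (hk : ∀ n : ℕ, 1 ≤ k n)
    (hko : (fun n : ℕ => (k n : ℝ)) =o[atTop] (fun n : ℕ => (n : ℝ) ^ (1 / 2 : ℝ))) :
    Tendsto
      (fun n : ℕ =>
        (UnimodalSequence.P n).real
          {s | (k n : ℝ) * (s.XL (k n) : ℝ) / (constB * Real.sqrt n) ≤ vL ∧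
               (k n : ℝ) * (s.XR (k n) : ℝ) / (constB * Real.sqrt n) ≤ vR})
      atTop
      (nhds ((1 - Real.exp (-max vL 0)) * (1 - Real.exp (-max vR 0)))) := by
  have hB : 0 ≤ constB := div_nonneg (Real.sqrt_nonneg _) Real.pi_pos.le
  by_cases hv : 0 ≤ vL ∧ 0 ≤ vR
  · rw [max_eq_left hv.1, max_eq_left hv.2]
    obtain ⟨C, hC, t₀, ht₀, h⟩ := exists_P_exponential_estimate
    have hk2 := tendsto_mul_saddle hko
    -- Here |S| = 1, and k enters only through the discretisation error 2kt.
    have hlim : Tendsto (fun n => C * (√(saddle n) + √√(saddle n)) +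
        2 * (k n * saddle n)) atTop (nhds 0) := by
      have := ((tendsto_sqrt_saddle.add tendsto_sqrt_sqrt_saddle).const_mul C).add
        (hk2.const_mul 2)
      simpa using this
    rw [tendsto_iff_norm_sub_tendsto_zero]
    refine squeeze_zero' (Eventually.of_forall fun _ => norm_nonneg _) ?_ hlim
    filter_upwards [eventually_saddle_conditions ht₀ hk2 (c := fun _ => 1) hk]
      with n ⟨hn, hnt, hn1, hn2⟩
    have hb := h n hn hnt (k n) {k n} (fun _ => vL) (fun _ => vR)
      (fun j hj => by rw [Finset.mem_singleton.mp hj]; exact ⟨hk n, le_rfl⟩)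
      (fun _ _ => hv) hn1 (by simpa using hn2)
    simpa using hb
  -- For a negative threshold the event is empty, since rescaled multiplicities are nonnegative, and
  -- the corresponding factor of the limit vanishes.
  · have hzero : ∀ n : ℕ, (UnimodalSequence.P n).real
          {s | (k n : ℝ) * (s.XL (k n) : ℝ) / (constB * Real.sqrt n) ≤ vL ∧
               (k n : ℝ) * (s.XR (k n) : ℝ) / (constB * Real.sqrt n) ≤ vR} = 0 := by
      intro n
      have hempty : {s : UnimodalSequence |
          (k n : ℝ) * (s.XL (k n) : ℝ) / (constB * Real.sqrt n) ≤ vL ∧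
          (k n : ℝ) * (s.XR (k n) : ℝ) / (constB * Real.sqrt n) ≤ vR} = ∅ := by
        rw [Set.eq_empty_iff_forall_notMem]
        rintro s ⟨h1, h2⟩
        exact hv ⟨le_trans (by positivity) h1, le_trans (by positivity) h2⟩
      rw [hempty, MeasureTheory.measureReal_empty]
    have hval : (1 - Real.exp (-max vL 0)) * (1 - Real.exp (-max vR 0)) = 0 := by
      rw [not_and_or, not_le, not_le] at hv
      rcases hv with hv | hv
      · rw [max_eq_right hv.le]; simp
      · rw [max_eq_right hv.le]; simp
    simp only [hzero, hval]
    exact tendsto_const_nhds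

end UnimodalLimit

theorem theorem1p5 :
    (∀ (K : ℕ → ℕ) (vL vR : ℕ → ℕ → ℝ),
      (fun n : ℕ => (K n : ℝ)) =o[atTop] (fun n : ℕ => (n : ℝ) ^ (1 / 4 : ℝ)) →
      (∀ n k : ℕ, 1 ≤ k → k ≤ K n → 0 ≤ vL n k ∧ 0 ≤ vR n k) →
      Tendsto
        (fun n : ℕ =>
          (UnimodalSequence.P n).real
              {s | ∀ k : ℕ, 1 ≤ k → k ≤ K n →
                (k : ℝ) * (s.XL k : ℝ) / (constB * Real.sqrt n) ≤ vL n k ∧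
                (k : ℝ) * (s.XR k : ℝ) / (constB * Real.sqrt n) ≤ vR n k} -
            ∏ k ∈ Finset.Icc 1 (K n),
              ((∫ u in (0 : ℝ)..(vL n k), Real.exp (-u)) *
                (∫ u in (0 : ℝ)..(vR n k), Real.exp (-u))))
        atTop (nhds 0)) ∧
    (∀ (k : ℕ → ℕ) (vL vR : ℝ),
      (∀ n : ℕ, 1 ≤ k n) →
      (fun n : ℕ => (k n : ℝ)) =o[atTop] (fun n : ℕ => (n : ℝ) ^ (1 / 2 : ℝ)) →
      Tendsto
        (fun n : ℕ =>
          (UnimodalSequence.P n).real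
            {s | (k n : ℝ) * (s.XL (k n) : ℝ) / (constB * Real.sqrt n) ≤ vL ∧
                 (k n : ℝ) * (s.XR (k n) : ℝ) / (constB * Real.sqrt n) ≤ vR})
        atTop
        (nhds ((1 - Real.exp (-max vL 0)) * (1 - Real.exp (-max vR 0))))) :=
  ⟨UnimodalLimit.tendsto_P_joint, UnimodalLimit.tendsto_P_single⟩
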